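/- Let $k\ge 3$ and $n\ge 1$. A $(k,n)$-ladder is a graph obtained as follows. Start with a $k$-cycle and call all its edges free. Then, $n-1$ times, choose a free edge $rs$ and add a new $k$-cycle consisting of $rs$ and a path from $r$ to $s$ through $k-2$ new vertices; after this the free edges are exactly the edges of which both end points are among the vertices just introduced. Two distinct edges are adjacent if they share an end point. Consider the following problems on a graph $G=(V,E)$. MSTAC: given costs $c_e\in\mathbb{R}$ ($e\in E$) and a set $S$ of unordered pairs of adjacent edges, find a spanning tree $T$ that contains at most one edge of each pair in $S$ and minimizes $\sum_{e\in T}c_e$, or report that there is no such tree. BSTAC: the same with $\max_{e\in T}c_e$ in place of $\sum_{e\in T}c_e$. AQBST: given a real matrix $(q(e,f))_{e,f\in E}$ such that $q(e,f)=0$ whenever $e\ne f$ are not adjacent (the diagonal entry $q(e,e)=c_e$ is the cost of the edge $e$ and is arbitrary), find a spanning tree $T$ that minimizes $\max\{q(e,f): e,f\in T\}$. For each of these three problems there are an algorithm and a constant $C$ such that, for all $k\ge 3$ and $n\ge 1$, the algorithm solves the problem on every $(k,n)$-ladder in at most $C\,kn$ steps, that is, in $O(kn)$ time; it outputs an optimal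 tree and the optimal value, or reports infeasibility. Here time is counted on a unit-cost random access machine with real arithmetic; the input consists of $k$, $n$, the graph given by incidence lists with arbitrary numberings of its vertices and edges, the costs $c_e$ and the list of the pairs in $S$ for MSTAC and BSTAC, and the cost matrix with random access to its entries for AQBST. -/

import Mathlib

namespace LadderTrees

/-! ## Ladders -/

/-- The set of edges joining consecutive entries of a list of vertices. -/
def pathEdges {V : Type} : List V → Set (Sym2 V)
  | a :: b :: l => insert s(a, b) (pathEdges (b :: l))
  | _ => ∅

/-- The construction of ladders by fusing `k`-cycles.  `LadderBuild k i A E F` says that after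
fusing `i` cycles one can have the vertex set `A`, the edge set `E` and the set `F` of free edges.
At first there is one `k`-cycle, all of whose edges are free.  Then a free edge `rs` is chosen and a
new `k`-cycle through `rs` and `k - 2` new vertices is added; the free edges are now those edges
both of whose end points are vertices introduced in this step. -/
inductive LadderBuild {V : Type} (k : ℕ) : ℕ → Set V → Set (Sym2 V) → Set (Sym2 V) → Prop
  | init (a : V) (p : List V) (hnodup : (a :: p).Nodup) (hlen : p.length + 1 = k) :
      LadderBuild k 1 {v | v ∈ a :: p} (pathEdges (a :: p ++ [a])) (pathEdges (a :: p ++ [a]))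
  | step (i : ℕ) (A : Set V) (E F : Set (Sym2 V)) (h : LadderBuild k i A E F)
      (r s : V) (hfree : s(r, s) ∈ F)
      (p : List V) (hnodup : p.Nodup) (hlen : p.length + 2 = k) (hnew : ∀ v ∈ p, v ∉ A) :
      LadderBuild k (i + 1) (A ∪ {v | v ∈ p}) (E ∪ pathEdges (r :: p ++ [s])) (pathEdges p)

/-- `G` is a `(k, n)`-ladder. -/
def IsLadder {V : Type} (k n : ℕ) (G : SimpleGraph V) : Prop :=
  3 ≤ k ∧ 1 ≤ n ∧ ∃ F : Set (Sym2 V), LadderBuild k n Set.univ G.edgeSet F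

/-! ## The optimization problems -/

/-- The edge set `T` forms a spanning tree of `G`. -/
def IsSpanningTree {V : Type} (G : SimpleGraph V) (T : Finset G.edgeSet) : Prop :=
  (SimpleGraph.fromEdgeSet ((fun e : G.edgeSet => (e : Sym2 V)) '' (T : Set G.edgeSet))).IsTree

/-- Two distinct edges are adjacent if they share an end point. -/
def EdgeAdj {V : Type} (G : SimpleGraph V) (e f : G.edgeSet) : Prop :=
  e ≠ f ∧ ∃ v : V, v ∈ (e : Sym2 V) ∧ v ∈ (f : Sym2 V)

/-- `S` is a set of unordered pairs of adjacent edges. -/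
def AdjacentConflicts {V : Type} (G : SimpleGraph V) (S : Finset (Sym2 G.edgeSet)) : Prop :=
  ∀ e f : G.edgeSet, s(e, f) ∈ S → EdgeAdj G e f

/-- `T` is a spanning tree that contains at most one edge of each conflict pair. -/
def IsConflictFreeTree {V : Type} (G : SimpleGraph V) (S : Finset (Sym2 G.edgeSet))
    (T : Finset G.edgeSet) : Prop :=
  IsSpanningTree G T ∧ ∀ e f : G.edgeSet, s(e, f) ∈ S → ¬ (e ∈ T ∧ f ∈ T)

/-- The sum of the costs of the edges of `T`. -/
noncomputable def sumCost {E : Type} (c : E → ℝ) (T : Finset E) : ℝ :=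
  ∑ e ∈ T, c e

/-- The maximum of the costs of the edges of `T` (only used for nonempty `T`). -/
noncomputable def maxCost {E : Type} (c : E → ℝ) (T : Finset E) : ℝ :=
  sSup {z | ∃ e ∈ T, z = c e}

/-- The maximum of `q e f` over all `e` and `f` in `T` (only used for nonempty `T`).  The diagonal
entry `q e e` is the cost of the single edge `e`. -/
noncomputable def maxPairCost {E : Type} (q : E → E → ℝ) (T : Finset E) : ℝ :=
  sSup {z | ∃ e ∈ T, ∃ f ∈ T, z = q e f}

/-- `T` minimizes `obj` among all feasible edge sets. -/
def IsOptimal {E : Type} (feasible : Finset E → Prop) (obj : Finset E → ℝ)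
    (T : Finset E) : Prop :=
  feasible T ∧ ∀ T' : Finset E, feasible T' → obj T ≤ obj T'

/-! ## A random access machine

The memory consists of arrays of natural numbers and arrays of real numbers.  An array has a fixed
name (a numeral in the program) and is accessed by two computed indices.  On natural numbers a
program can only count up and down and compare, so no natural number exceeds the largest
number of the input and the program by more than the number of steps.  Reals can be copied, added,
subtracted and compared, and cannot be turned into natural numbers.  Each elementary operation,
memory access and test takes one unit of time. -/

structure Store where
  nat : ℕ → ℕ → ℕ → ℕ
  real : ℕ → ℕ → ℕ → ℝ

def Store.setNat (σ : Store) (a i j x : ℕ) : Store where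
  nat a' i' j' := if a' = a ∧ i' = i ∧ j' = j then x else σ.nat a' i' j'
  real := σ.real

noncomputable def Store.setReal (σ : Store) (a i j : ℕ) (x : ℝ) : Store where
  nat := σ.nat
  real a' i' j' := if a' = a ∧ i' = i ∧ j' = j then x else σ.real a' i' j'

inductive NExp where
  | const (x : ℕ)
  | cell (a : ℕ) (i j : NExp)
  | succ (x : NExp)
  | pred (x : NExp)

def NExp.eval (σ : Store) : NExp → ℕ
  | const x => x
  | cell a i j => σ.nat a (i.eval σ) (j.eval σ)
  | succ x => x.eval σ + 1
  | pred x => x.eval σ - 1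

def NExp.time : NExp → ℕ
  | const _ => 1
  | cell _ i j => i.time + j.time + 1
  | succ x => x.time + 1
  | pred x => x.time + 1

inductive RExp where
  | cell (a : ℕ) (i j : NExp)
  | add (x y : RExp)
  | sub (x y : RExp)

noncomputable def RExp.eval (σ : Store) : RExp → ℝ
  | cell a i j => σ.real a (i.eval σ) (j.eval σ)
  | add x y => x.eval σ + y.eval σ
  | sub x y => x.eval σ - y.eval σ

def RExp.time : RExp → ℕ
  | cell _ i j => i.time + j.time + 1
  | add x y => x.time + y.time + 1
  | sub x y => x.time + y.time + 1

inductive BExp where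
  | natEq (x y : NExp)
  | natLe (x y : NExp)
  | realLe (x y : RExp)
  | neg (b : BExp)
  | conj (b c : BExp)

def BExp.eval (σ : Store) : BExp → Prop
  | natEq x y => x.eval σ = y.eval σ
  | natLe x y => x.eval σ ≤ y.eval σ
  | realLe x y => x.eval σ ≤ y.eval σ
  | neg b => ¬ b.eval σ
  | conj b c => b.eval σ ∧ c.eval σ

def BExp.time : BExp → ℕ
  | natEq x y => x.time + y.time + 1
  | natLe x y => x.time + y.time + 1
  | realLe x y => x.time + y.time + 1
  | neg b => b.time + 1
  | conj b c => b.time + c.time + 1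

inductive Program where
  | skip
  | setNat (a : ℕ) (i j x : NExp)
  | setReal (a : ℕ) (i j : NExp) (x : RExp)
  | comp (P Q : Program)
  | branch (b : BExp) (P Q : Program)
  | loop (b : BExp) (P : Program)

/-- `P.Run σ t τ`: started in the store `σ`, the program `P` halts after `t` units of time in the
store `τ`. -/
inductive Program.Run : Program → Store → ℕ → Store → Prop
  | skip (σ : Store) : Run .skip σ 1 σ
  | setNat (σ : Store) (a : ℕ) (i j x : NExp) :
      Run (.setNat a i j x) σ (i.time + j.time + x.time + 1)
        (σ.setNat a (i.eval σ) (j.eval σ) (x.eval σ))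
  | setReal (σ : Store) (a : ℕ) (i j : NExp) (x : RExp) :
      Run (.setReal a i j x) σ (i.time + j.time + x.time + 1)
        (σ.setReal a (i.eval σ) (j.eval σ) (x.eval σ))
  | comp (P Q : Program) (σ τ υ : Store) (t u : ℕ) (hP : Run P σ t τ) (hQ : Run Q τ u υ) :
      Run (.comp P Q) σ (t + u) υ
  | branchTrue (b : BExp) (P Q : Program) (σ τ : Store) (t : ℕ) (hb : b.eval σ)
      (hP : Run P σ t τ) : Run (.branch b P Q) σ (b.time + t + 1) τ
  | branchFalse (b : BExp) (P Q : Program) (σ τ : Store) (t : ℕ) (hb : ¬ b.eval σ)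
      (hQ : Run Q σ t τ) : Run (.branch b P Q) σ (b.time + t + 1) τ
  | loopTrue (b : BExp) (P : Program) (σ τ υ : Store) (t u : ℕ) (hb : b.eval σ)
      (hP : Run P σ t τ) (hloop : Run (.loop b P) τ u υ) :
      Run (.loop b P) σ (b.time + t + u + 1) υ
  | loopFalse (b : BExp) (P : Program) (σ : Store) (hb : ¬ b.eval σ) :
      Run (.loop b P) σ (b.time + 1) σ

/-! ## Input and output

Vertices are numbered by `Fin N` and edges by `Fin m`, both in an arbitrary order; the input does
not show how a ladder is composed of cycles. -/

/-- The store holds the graph `G` as incidence lists, and the numbers `k`, `n`: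
array 0 holds `N, m, k, n`, array 1 the two end points of each edge, array 2 the degrees,
array 3 the list of the edges at each vertex, in any order.  Arrays of natural numbers
other than 0, ..., 4 and arrays of reals other than 0 are initially zero. -/
structure EncodesGraph {N m : ℕ} (k n : ℕ) (G : SimpleGraph (Fin N)) (edge : Fin m ≃ G.edgeSet)
    (σ : Store) : Prop where
  numVertices : σ.nat 0 0 0 = N
  numEdges : σ.nat 0 0 1 = m
  cycleLength : σ.nat 0 0 2 = k
  numCycles : σ.nat 0 0 3 = n
  ends : ∀ e : Fin m, ∃ u v : Fin N, (edge e : Sym2 (Fin N)) = s(u, v) ∧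
    σ.nat 1 e 0 = u ∧ σ.nat 1 e 1 = v
  incidence : ∀ v : Fin N, Set.BijOn (fun i : ℕ => σ.nat 3 v i) {i | i < σ.nat 2 v 0}
    {x | ∃ e : Fin m, v ∈ (edge e : Sym2 (Fin N)) ∧ x = (e : ℕ)}
  natZero : ∀ a i j : ℕ, 5 ≤ a → σ.nat a i j = 0
  realZero : ∀ a i j : ℕ, 1 ≤ a → σ.real a i j = 0

/-- The store holds the set `S` of conflict pairs: the entry `(0, 4)` of array 0 is the number of
pairs, and array 4 lists each pair once, in any order. -/
def EncodesConflicts {E : Type} {m : ℕ} (edge : Fin m ≃ E) (S : Finset (Sym2 E))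
    (σ : Store) : Prop :=
  Set.BijOn (fun i : ℕ => s(σ.nat 4 i 0, σ.nat 4 i 1)) {i | i < σ.nat 0 0 4}
    (Sym2.map (fun e : E => (edge.symm e : ℕ)) '' (S : Set (Sym2 E)))

/-- Array 0 of reals holds the edge costs. -/
def EncodesCosts {E : Type} {m : ℕ} (edge : Fin m ≃ E) (c : E → ℝ) (σ : Store) : Prop :=
  ∀ e : Fin m, σ.real 0 e 0 = c (edge e)

/-- Array 0 of reals holds the cost matrix. -/
def EncodesMatrix {E : Type} {m : ℕ} (edge : Fin m ≃ E) (q : E → E → ℝ) (σ : Store) : Prop :=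
  ∀ e f : Fin m, σ.real 0 e f = q (edge e) (edge f)

/-- The store holds a solution of the minimization problem.  If the problem is feasible then the
entry `(0, 0)` of array 5 is `1`, array 6 is the 0-1 vector of an optimal edge set, and the entry
`(0, 0)` of the array 1 of reals is the optimal value; otherwise the entry `(0, 0)` of
array 5 is `0`. -/
def HoldsSolution {E : Type} {m : ℕ} (edge : Fin m ≃ E) (feasible : Finset E → Prop)
    (obj : Finset E → ℝ) (σ : Store) : Prop :=
  (∃ T : Finset E, IsOptimal feasible obj T ∧ σ.nat 5 0 0 = 1 ∧
    (∀ e : Fin m, (edge e ∈ T → σ.nat 6 e 0 = 1) ∧ (edge e ∉ T → σ.nat 6 e 0 = 0)) ∧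
    σ.real 1 0 0 = obj T) ∨
  ((∀ T : Finset E, ¬ feasible T) ∧ σ.nat 5 0 0 = 0)

end LadderTrees

open LadderTrees

open LadderTrees

namespace LadderTrees

/-! ## Running programs -/

/-! A ladder can be swept edge by edge with a frontier of only two vertices `u`, `v`: the processed
edges lie in a vertex set `A`, and no vertex of `A` other than `u` and `v` meets an unprocessed
edge. A set `T` of processed edges that can still become part of a spanning tree is either a tree on
`A` or a forest with two components, one containing `u` and the other `v` (`SpansBetween`). All
degrees are at most three, so a bounded amount of data about `T` decides how it may be continued:
whether `u` and `v` are connected, and which positions of their incidence lists hold edges of `T`. A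
newly processed edge is adjacent only to processed edges at the frontier (`Op.Fits.edgeAdj_iff`), so
conflicts and costs of adjacent pairs can be read off from these positions. All nonadjacent pairs
have the cost 0, so for the quadratic objective it suffices to know in addition whether `T` has an
edge avoiding `u`, `v`, or both. Hence there is an absolute constant number of states.

The algorithm is a dynamic program with one layer per processed edge, keeping for each state the
best value and a back pointer. `Op.Fits.step` says that the transitions between states describe
exactly the extensions of the sets `T`; `Mode.Correct` says that the new objective value depends
only on the state, the old value and the edge; and `Mode.value_mono` says that this dependence is
monotone, so that keeping only the best value per state loses nothing. Together they give
`SweepState.exec_opProg`.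

The input does not show the cells, so the sweep must find its own way. Its rule is: process the edge
`uv` if it is still there; otherwise move `u` along its only unprocessed edge; if that is
impossible, do the same with `v`. This is deterministic (`SweepStep.unique`), so it is enough to
find a start from which some sweep processes everything. In crossing a cell, one end walks along its
side until it reaches the shared edge, where it is blocked by two unprocessed edges; then the other
end walks along the other side, and the shared edge is the next rung (`reaches_cell`).

If `n = 1`, any edge is a good start. If `n ≥ 2`, the search looks for a path of `k - 1` edges that
begins at a vertex of degree three and has inner vertices of degree two. The last cell contains one
(`LadderBuild.exists_run`). Conversely, any such path belongs to the first or to the last cell,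
since the sides of an intermediate cell are too short (`IsRun.blocked`), and the sweep from there
succeeds (`LadderBuild.completes_run`): downwards by `LadderBuild.completes`, upwards by
`LadderBuild.run_reaches`.

The time is linear because there are at most `k n` edges and vertices, each edge costs constant time
in the sweep, there are at most nine conflict pairs per vertex, and only the at most `2 n` ends of
edges used for fusing can have degree three, so that few walks of length at most `k` are tried. -/

/-- Started in `σ`, the program `P` halts within `B` units of time in a store satisfying `Q`. -/
def Program.Ensures (P : Program) (σ : Store) (B : ℕ) (Q : Store → Prop) : Prop :=
  ∃ t τ, P.Run σ t τ ∧ t ≤ B ∧ Q τ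

theorem Program.Ensures.mono {P : Program} {σ : Store} {B B' : ℕ} {Q Q' : Store → Prop}
    (h : P.Ensures σ B Q) (hB : B ≤ B') (hQ : ∀ τ, Q τ → Q' τ) : P.Ensures σ B' Q' := by
  obtain ⟨t, τ, hr, ht, hq⟩ := h
  exact ⟨t, τ, hr, ht.trans hB, hQ τ hq⟩

theorem Program.Ensures.comp {P R : Program} {σ : Store} {B B' : ℕ} {Q Q' : Store → Prop}
    (h : P.Ensures σ B Q) (h' : ∀ τ, Q τ → R.Ensures τ B' Q') :
    (Program.comp P R).Ensures σ (B + B') Q' := by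
  obtain ⟨t, τ, hr, ht, hq⟩ := h
  obtain ⟨t', τ', hr', ht', hq'⟩ := h' τ hq
  exact ⟨t + t', τ', .comp _ _ _ _ _ _ _ hr hr', Nat.add_le_add ht ht', hq'⟩

theorem Program.Ensures.branch {P R : Program} {b : BExp} {σ : Store} {B : ℕ} {Q : Store → Prop}
    (h : b.eval σ → P.Ensures σ B Q) (h' : ¬ b.eval σ → R.Ensures σ B Q) :
    (Program.branch b P R).Ensures σ (b.time + B + 1) Q := by
  by_cases hb : b.eval σ
  · obtain ⟨t, τ, hr, ht, hq⟩ := h hb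
    exact ⟨_, τ, .branchTrue _ _ _ _ _ _ hb hr, by omega, hq⟩
  · obtain ⟨t, τ, hr, ht, hq⟩ := h' hb
    exact ⟨_, τ, .branchFalse _ _ _ _ _ _ hb hr, by omega, hq⟩

/-- The rule for loops.  In `I B σ` the number `B` is the time that may still be spent on full
iterations. -/
theorem Program.Ensures.loop {P : Program} {b : BExp} (I : ℕ → Store → Prop)
    (h : ∀ B σ, I B σ → b.eval σ →
      ∃ c B', c + B' + b.time + 1 ≤ B ∧ P.Ensures σ c (I B')) {B : ℕ} {σ : Store} (hI : I B σ) :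
    (Program.loop b P).Ensures σ (B + b.time + 1) (fun τ => ∃ B', I B' τ ∧ ¬ b.eval τ) := by
  induction B using Nat.strong_induction_on generalizing σ with
  | _ B ih =>
    by_cases hb : b.eval σ
    · obtain ⟨c, B', hc, t, τ, hr, ht, hq⟩ := h B σ hI hb
      obtain ⟨t', τ', hr', ht', hq'⟩ := ih B' (by omega) hq
      exact ⟨_, τ', .loopTrue _ _ _ _ _ _ _ hb hr hr', by omega, hq'⟩
    · exact ⟨_, σ, .loopFalse _ _ _ hb, by omega, B, hI, hb⟩

/-- The rule for loops whose iterations take bounded time; in `I i σ` at most `i` iterations are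
left. -/
theorem Program.Ensures.loop_count {P : Program} {b : BExp} (c : ℕ) (I : ℕ → Store → Prop)
    (h : ∀ i σ, I i σ → b.eval σ → ∃ i', i' < i ∧ P.Ensures σ c (I i')) {i : ℕ} {σ : Store}
    (hI : I i σ) :
    (Program.loop b P).Ensures σ (i * (c + b.time + 1) + b.time + 1)
      (fun τ => ∃ i', I i' τ ∧ ¬ b.eval τ) := by
  refine (Program.Ensures.loop
    (fun B σ => ∃ i, B = i * (c + b.time + 1) ∧ I i σ) ?_ ⟨i, rfl, hI⟩).mono le_rfl ?_
  · rintro _ σ ⟨i, rfl, hi⟩ hb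
    obtain ⟨i', hi', hP⟩ := h i σ hi hb
    refine ⟨c, i' * (c + b.time + 1), ?_, hP.mono le_rfl fun τ hτ => ⟨i', rfl, hτ⟩⟩
    have := Nat.mul_le_mul_right (c + b.time + 1) (Nat.succ_le_of_lt hi')
    rw [Nat.succ_mul] at this
    omega
  · rintro τ ⟨_, ⟨i', -, hi'⟩, hb⟩
    exact ⟨i', hi', hb⟩

/-! ## Loop-free programs -/

/-- The program contains no loop. -/
def Program.LoopFree : Program → Prop
  | comp P Q => P.LoopFree ∧ Q.LoopFree
  | branch _ P Q => P.LoopFree ∧ Q.LoopFree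
  | loop _ _ => False
  | _ => True

/-- The effect of a loop-free program. -/
noncomputable def Program.exec : Program → Store → Store
  | skip, σ => σ
  | setNat a i j x, σ => σ.setNat a (i.eval σ) (j.eval σ) (x.eval σ)
  | setReal a i j x, σ => σ.setReal a (i.eval σ) (j.eval σ) (x.eval σ)
  | comp P Q, σ => Q.exec (P.exec σ)
  | branch b P Q, σ => open Classical in if b.eval σ then P.exec σ else Q.exec σ
  -- A junk value; `exec` is related to runs only for loop-free programs.
  | loop _ _, σ => σ

theorem Program.exec_branch_of {b : BExp} {P Q : Program} {σ : Store} (h : b.eval σ) :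
    (Program.branch b P Q).exec σ = P.exec σ := by rw [Program.exec, if_pos h]

theorem Program.exec_branch_of_not {b : BExp} {P Q : Program} {σ : Store} (h : ¬ b.eval σ) :
    (Program.branch b P Q).exec σ = Q.exec σ := by rw [Program.exec, if_neg h]

/-- An upper bound for the running time of a loop-free program. -/
def Program.cost : Program → ℕ
  | setNat _ i j x => i.time + j.time + x.time + 1
  | setReal _ i j x => i.time + j.time + x.time + 1
  | comp P Q => P.cost + Q.cost
  -- The sum of both branches instead of the maximum: only the existence of a constant matters.
  | branch b P Q => b.time + (P.cost + Q.cost) + 1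
  | _ => 1

theorem Program.LoopFree.run_exec {P : Program} (hP : P.LoopFree) (σ : Store) :
    ∃ t, P.Run σ t (P.exec σ) ∧ t ≤ P.cost := by
  induction P generalizing σ with
  | skip => exact ⟨1, .skip σ, le_rfl⟩
  | setNat a i j x => exact ⟨_, .setNat σ a i j x, le_rfl⟩
  | setReal a i j x => exact ⟨_, .setReal σ a i j x, le_rfl⟩
  | comp P Q ihP ihQ =>
    obtain ⟨t, hr, ht⟩ := ihP hP.1 σ
    obtain ⟨t', hr', ht'⟩ := ihQ hP.2 (P.exec σ)
    exact ⟨t + t', .comp _ _ _ _ _ _ _ hr hr', Nat.add_le_add ht ht'⟩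
  | branch b P Q ihP ihQ =>
    by_cases hb : b.eval σ
    · obtain ⟨t, hr, ht⟩ := ihP hP.1 σ
      refine ⟨b.time + t + 1, ?_, by simp only [Program.cost]; omega⟩
      rw [Program.exec, if_pos hb]
      exact .branchTrue _ _ _ _ _ _ hb hr
    · obtain ⟨t, hr, ht⟩ := ihQ hP.2 σ
      refine ⟨b.time + t + 1, ?_, by simp only [Program.cost]; omega⟩
      rw [Program.exec, if_neg hb]
      exact .branchFalse _ _ _ _ _ _ hb hr
  | loop b P => exact hP.elim

theorem Program.LoopFree.ensures {P : Program} (hP : P.LoopFree) {σ : Store} {Q : Store → Prop}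
    (h : Q (P.exec σ)) : P.Ensures σ P.cost Q := by
  obtain ⟨t, hr, ht⟩ := hP.run_exec σ
  exact ⟨t, _, hr, ht, h⟩

/-- Programs executed one after the other. -/
def Program.seq (l : List Program) : Program := l.foldr .comp .skip

theorem Program.LoopFree.seq {l : List Program} (h : ∀ P ∈ l, P.LoopFree) :
    (Program.seq l).LoopFree := by
  induction l with
  | nil => trivial
  | cons P l ih => exact ⟨h P (by simp), ih fun Q hQ => h Q (by simp [hQ])⟩

@[simp] theorem Program.exec_seq_nil (σ : Store) : (Program.seq []).exec σ = σ := rfl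

@[simp] theorem Program.exec_seq_cons (P : Program) (l : List Program) (σ : Store) :
    (Program.seq (P :: l)).exec σ = (Program.seq l).exec (P.exec σ) := rfl

/-- The program that does `f a` for the first `a` of the list that passes the test `b a`. -/
def Program.firstMatch {α : Type} (b : α → BExp) (f : α → Program) (l : List α) : Program :=
  l.foldr (fun a P => .branch (b a) (f a) P) .skip

theorem Program.LoopFree.firstMatch {α : Type} {b : α → BExp} {f : α → Program} {l : List α}
    (h : ∀ a ∈ l, (f a).LoopFree) : (Program.firstMatch b f l).LoopFree := by
  induction l with
  | nil => trivial
  | cons P l ih => exact ⟨h P (by simp), ih fun Q hQ => h Q (by simp [hQ])⟩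

/-- The failure of all earlier tests is part of the conclusion because the sweep relies on it:
operations with an exchange are listed last and must be taken only when no other one applies. -/
theorem Program.exec_firstMatch {α : Type} {b : α → BExp} {f : α → Program} {l : List α}
    {σ : Store} (h : ∃ a ∈ l, (b a).eval σ) :
    ∃ a l₁ l₂, l = l₁ ++ a :: l₂ ∧ (b a).eval σ ∧ (∀ a' ∈ l₁, ¬ (b a').eval σ) ∧
      (Program.firstMatch b f l).exec σ = (f a).exec σ := by
  induction l with
  | nil => simp at h
  | cons a l ih =>
    by_cases ha : (b a).eval σ
    · exact ⟨a, [], l, rfl, ha, by simp, by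
        simp [Program.firstMatch, Program.exec, ha]⟩
    · obtain ⟨a', l₁, l₂, rfl, h1, h2, h3⟩ := ih (by simpa [ha] using h)
      refine ⟨a', a :: l₁, l₂, rfl, h1, by simpa [ha] using h2, ?_⟩
      rw [← h3]
      simp [Program.firstMatch, Program.exec, ha]

/-! ## Conditions on a list -/

/-- The condition that is always true. -/
def BExp.tt : BExp := .natEq (.const 0) (.const 0)

/-- The conjunction of a list of conditions. -/
def BExp.all (l : List BExp) : BExp := l.foldr .conj .tt

@[simp] theorem BExp.eval_all (l : List BExp) (σ : Store) :
    (BExp.all l).eval σ ↔ ∀ b ∈ l, b.eval σ := by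
  induction l with
  | nil => simp [BExp.all, BExp.tt, BExp.eval]
  | cons b l ih =>
    have : (BExp.all (b :: l)).eval σ ↔ b.eval σ ∧ (BExp.all l).eval σ := Iff.rfl
    simp [this, ih]

/-- A scalar variable, stored in an array of its own. -/
def NExp.reg (a : ℕ) : NExp := .cell a (.const 0) (.const 0)

/-- Assignment to a scalar variable. -/
def Program.setReg (a : ℕ) (x : NExp) : Program := .setNat a (.const 0) (.const 0) x

@[simp] theorem Store.setNat_nat (σ : Store) (a i j x a' i' j' : ℕ) :
    (σ.setNat a i j x).nat a' i' j' = if a' = a ∧ i' = i ∧ j' = j then x else σ.nat a' i' j' :=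
  rfl

@[simp] theorem Store.setNat_real (σ : Store) (a i j x : ℕ) :
    (σ.setNat a i j x).real = σ.real := rfl

@[simp] theorem Store.setReal_nat (σ : Store) (a i j : ℕ) (x : ℝ) :
    (σ.setReal a i j x).nat = σ.nat := rfl

@[simp] theorem Store.setReal_real (σ : Store) (a i j : ℕ) (x : ℝ) (a' i' j' : ℕ) :
    (σ.setReal a i j x).real a' i' j' =
      if a' = a ∧ i' = i ∧ j' = j then x else σ.real a' i' j' :=
  rfl

theorem Store.setReal_setReal (σ : Store) (a i j : ℕ) (x y : ℝ) :
    (σ.setReal a i j x).setReal a i j y = σ.setReal a i j y := by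
  unfold Store.setReal
  congr 1
  funext a' i' j'
  by_cases h : a' = a ∧ i' = i ∧ j' = j <;> simp [h]

attribute [simp] NExp.eval RExp.eval BExp.eval NExp.reg Program.exec Program.setReg
  Program.LoopFree

end LadderTrees

namespace LadderTrees

/-! ## One layer of a dynamic program

Layer `i` of the table is kept in row `i` of the following arrays: natural arrays 9 (`1` if
the entry is present), 10 (the previous state), 11 (`1` if the edge of the layer is used) and real
array 2 (the value).  The scalar 15 is the index of the last complete layer; the real scalar 3
holds a candidate for a new value. -/

/-- A possible transition from the state with code `src` to the state with code `tgt`. -/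
structure Trans where
  src : ℕ
  tgt : ℕ
  used : ℕ
  ok : BExp
  prog : Program
  value : Store → ℝ

/-- Enter the candidate value into the next layer if it is an improvement. -/
def Trans.relax (t : Trans) : Program :=
  .branch (.conj (.natEq (.cell 9 (.reg 15) (.const t.src)) (.const 1)) t.ok)
    (.comp t.prog (.branch
      (.conj (.natEq (.cell 9 (.succ (.reg 15)) (.const t.tgt)) (.const 1))
        (.realLe (.cell 2 (.succ (.reg 15)) (.const t.tgt)) (.cell 3 (.const 0) (.const 0))))
      .skip
      (.seq [.setNat 9 (.succ (.reg 15)) (.const t.tgt) (.const 1),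
        .setReal 2 (.succ (.reg 15)) (.const t.tgt) (.cell 3 (.const 0) (.const 0)),
        .setNat 10 (.succ (.reg 15)) (.const t.tgt) (.const t.src),
        .setNat 11 (.succ (.reg 15)) (.const t.tgt) (.const t.used)])))
    .skip

/-- The stores differ at most in layer `i + 1` and in the candidate value. -/
structure LayerFrame (i : ℕ) (σ τ : Store) : Prop where
  nat : ∀ a x y, ¬ (9 ≤ a ∧ a ≤ 11 ∧ x = i + 1) → τ.nat a x y = σ.nat a x y
  real : ∀ a x y, a ≠ 3 → ¬ (a = 2 ∧ x = i + 1) → τ.real a x y = σ.real a x y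

theorem LayerFrame.refl (i : ℕ) (σ : Store) : LayerFrame i σ σ :=
  ⟨fun _ _ _ _ => rfl, fun _ _ _ _ _ => rfl⟩

theorem LayerFrame.trans {i : ℕ} {σ τ υ : Store} (h : LayerFrame i σ τ) (h' : LayerFrame i τ υ) :
    LayerFrame i σ υ :=
  ⟨fun a x y hn => (h'.nat a x y hn).trans (h.nat a x y hn),
    fun a x y h3 hn => (h'.real a x y h3 hn).trans (h.real a x y h3 hn)⟩

/-- The condition and the value of a transition do not depend on the next layer. -/
structure Trans.Valid (t : Trans) : Prop where
  loopFree : t.prog.LoopFree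
  exec : ∀ σ, t.prog.exec σ = σ.setReal 3 0 0 (t.value σ)
  ok_frame : ∀ σ τ, LayerFrame (σ.nat 15 0 0) σ τ → (t.ok.eval τ ↔ t.ok.eval σ)
  value_frame : ∀ σ τ, LayerFrame (σ.nat 15 0 0) σ τ → t.value τ = t.value σ

/-- The transition can be made. -/
def Trans.App (t : Trans) (σ : Store) : Prop :=
  σ.nat 9 (σ.nat 15 0 0) t.src = 1 ∧ t.ok.eval σ

/-- In `τ` the next layer is the result of the transitions in `L`, started in `σ`. -/
structure LayerDone (σ : Store) (L : List Trans) (τ : Store) : Prop where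
  frame : LayerFrame (σ.nat 15 0 0) σ τ
  sound : ∀ c, τ.nat 9 (σ.nat 15 0 0 + 1) c = 1 → ∃ t ∈ L, t.tgt = c ∧ t.App σ ∧
    τ.real 2 (σ.nat 15 0 0 + 1) c = t.value σ ∧
    τ.nat 10 (σ.nat 15 0 0 + 1) c = t.src ∧ τ.nat 11 (σ.nat 15 0 0 + 1) c = t.used
  complete : ∀ t ∈ L, t.App σ → τ.nat 9 (σ.nat 15 0 0 + 1) t.tgt = 1 ∧
    τ.real 2 (σ.nat 15 0 0 + 1) t.tgt ≤ t.value σ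

theorem Trans.loopFree_relax {t : Trans} (ht : t.Valid) : t.relax.LoopFree := by
  simp [Trans.relax, Program.seq, ht.loopFree]

/-- A transition reads only layer `i` and data outside the table, so its condition and value are the
same in `τ` as in the initial store `σ`. The target entry is replaced only if it is absent or
larger. Hence every entry still comes from some transition, and is at most the value of each
applicable one. -/
theorem Trans.exec_relax {t : Trans} (ht : t.Valid) {L : List Trans} {σ τ : Store}
    (h : LayerDone σ L τ) : LayerDone σ (L ++ [t]) (t.relax.exec τ) := by
  obtain ⟨i, hi⟩ : ∃ i, σ.nat 15 0 0 = i := ⟨_, rfl⟩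
  obtain ⟨hf, hs, hc⟩ := h
  have hiτ : τ.nat 15 0 0 = i := by rw [hf.nat _ _ _ (by omega), hi]
  have hok := ht.ok_frame σ τ hf
  have hval := ht.value_frame σ τ hf
  have hsrc : τ.nat 9 i t.src = σ.nat 9 i t.src := hf.nat _ _ _ (by omega)
  rw [hi] at hf hs hc
  by_cases happ : t.App σ
  · have happ' := happ
    rw [Trans.App, hi] at happ
    have e1 : t.relax.exec τ = (if τ.nat 9 (i + 1) t.tgt = 1 ∧ τ.real 2 (i + 1) t.tgt ≤ t.value σ
        then τ.setReal 3 0 0 (t.value σ) else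
        ((((τ.setReal 3 0 0 (t.value σ)).setNat 9 (i + 1) t.tgt 1).setReal 2 (i + 1) t.tgt
          (t.value σ)).setNat 10 (i + 1) t.tgt t.src).setNat 11 (i + 1) t.tgt t.used) := by
      simp [Trans.relax, hiτ, hsrc, happ.1, hok, happ.2, ht.exec, hval]
    rw [e1]
    split_ifs with hlt
    · refine ⟨?_, ?_, ?_⟩ <;> rw [hi]
      · exact hf.trans ⟨fun _ _ _ _ => rfl, fun a x y h3 _ => by simp [h3]⟩
      · intro c hcc
        obtain ⟨t', ht', h'⟩ := hs c hcc
        exact ⟨t', by simp [ht'], by simpa using h'⟩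
      · intro t' ht' ha'
        rcases List.mem_append.1 ht' with ht' | ht'
        · simpa using hc t' ht' ha'
        · obtain rfl := List.mem_singleton.1 ht'
          simpa using hlt
    · refine ⟨?_, ?_, ?_⟩ <;> rw [hi]
      · refine hf.trans ⟨fun a x y hn => ?_, fun a x y h3 hn => ?_⟩
        · have e11 : ¬ (a = 11 ∧ x = i + 1 ∧ y = t.tgt) := by rintro ⟨rfl, rfl, -⟩; omega
          have e10 : ¬ (a = 10 ∧ x = i + 1 ∧ y = t.tgt) := by rintro ⟨rfl, rfl, -⟩; omega
          have e9 : ¬ (a = 9 ∧ x = i + 1 ∧ y = t.tgt) := by rintro ⟨rfl, rfl, -⟩; omega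
          simp [e11, e10, e9]
        · have e2 : ¬ (a = 2 ∧ x = i + 1 ∧ y = t.tgt) := by rintro ⟨rfl, rfl, -⟩; omega
          simp [h3, e2]
      · intro c hcc
        by_cases hct : c = t.tgt
        · subst hct
          exact ⟨t, by simp, rfl, happ', by simp, by simp, by simp⟩
        · obtain ⟨t', ht', h'⟩ := hs c (by simpa [hct] using hcc)
          exact ⟨t', by simp [ht'], by simpa [hct] using h'⟩
      · intro t' ht' ha'
        rcases List.mem_append.1 ht' with ht' | ht'
        · obtain ⟨h1, h2⟩ := hc t' ht' ha'
          by_cases hct : t'.tgt = t.tgt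
          · rw [hct] at h1 h2 ⊢
            simp only [h1, true_and, not_le] at hlt
            simpa using hlt.le.trans h2
          · simpa [hct] using ⟨h1, h2⟩
        · obtain rfl := List.mem_singleton.1 ht'
          simp
  · have happ' := happ
    rw [Trans.App, hi, ← hok, ← hsrc] at happ
    have e1 : t.relax.exec τ = τ := by
      refine Program.exec_branch_of_not ?_
      simpa only [BExp.eval, NExp.eval, NExp.reg, hiτ] using happ
    rw [e1]
    refine ⟨?_, ?_, ?_⟩ <;> rw [hi]
    · exact hf
    · intro c hcc
      obtain ⟨t', ht', h'⟩ := hs c hcc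
      exact ⟨t', by simp [ht'], h'⟩
    · intro t' ht' ha'
      rcases List.mem_append.1 ht' with ht' | ht'
      · exact hc t' ht' ha'
      · obtain rfl := List.mem_singleton.1 ht'
        exact absurd ha' happ'

/-- The program that makes all the transitions of a list. -/
def layerProg (L : List Trans) : Program := .seq (L.map Trans.relax)

theorem loopFree_layerProg {L : List Trans} (hL : ∀ t ∈ L, t.Valid) : (layerProg L).LoopFree :=
  Program.LoopFree.seq fun P hP => by
    obtain ⟨t, ht, rfl⟩ := List.mem_map.1 hP
    exact Trans.loopFree_relax (hL t ht)

/-- The row to be filled must be blank at the start; then the claim for the empty list of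
transitions is trivial, and each relaxation extends it by one transition. -/
theorem exec_layerProg {L : List Trans} (hL : ∀ t ∈ L, t.Valid) {σ : Store}
    (h0 : ∀ c, σ.nat 9 (σ.nat 15 0 0 + 1) c = 0) : LayerDone σ L ((layerProg L).exec σ) := by
  suffices H : ∀ (L L₁ : List Trans) (τ : Store), (∀ t ∈ L, t.Valid) → LayerDone σ L₁ τ →
      LayerDone σ (L₁ ++ L) ((layerProg L).exec τ) by
    refine H L [] σ hL ⟨.refl _ _, fun c hc => ?_, by simp⟩
    simp [h0] at hc
  intro L
  induction L with
  | nil => intro L₁ τ _ h; simpa [layerProg] using h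
  | cons t L ih =>
    intro L₁ τ hL h
    have := ih (L₁ ++ [t]) _ (fun t' ht' => hL t' (by simp [ht']))
      (Trans.exec_relax (hL t (by simp)) h)
    simpa [layerProg] using this

end LadderTrees

namespace LadderTrees

/-! ## Partial spanning trees with a frontier of two vertices -/

section SpansBetween

variable {V : Type} {G : SimpleGraph V}

/-- The edge set `T` is a spanning tree on the vertex set `A` (if `conn` is true), or becomes one
when `u` and `v` are identified (if `conn` is false). -/
def SpansBetween (conn : Bool) (A : Finset V) (T : Finset G.edgeSet) (u v : V) : Prop :=
  (∀ P : V → Prop, (∀ e ∈ T, ∀ x ∈ (e : Sym2 V), ∀ y ∈ (e : Sym2 V), P x → P y) →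
    (conn = false → (P u ↔ P v)) → ∀ x ∈ A, ∀ y ∈ A, P x → P y) ∧
  T.card + (if conn then 1 else 2) = A.card

theorem SpansBetween.swap {conn : Bool} {A : Finset V} {T : Finset G.edgeSet} {u v : V}
    (h : SpansBetween conn A T u v) : SpansBetween conn A T v u :=
  ⟨fun P hP hc => h.1 P hP fun h' => (hc h').symm, h.2⟩

/-- Each edge merges at most two classes, so `T` leaves at least `A.card - T.card` of them in `A`,
whereas connectedness leaves at most one. -/
theorem card_le_of_connected {A : Finset V} {T : Finset G.edgeSet}
    (h : ∀ P : V → Prop, (∀ e ∈ T, ∀ x ∈ (e : Sym2 V), ∀ y ∈ (e : Sym2 V), P x → P y) →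
      ∀ x ∈ A, ∀ y ∈ A, P x → P y) : A.card ≤ T.card + 1 := by
  classical
  -- `f` labels the classes: it starts as the identity, and for each new edge the label of one end
  -- is replaced everywhere by that of the other, which removes at most one label.
  obtain ⟨f, hf, hc⟩ : ∃ f : V → V, (∀ e ∈ T, ∀ x ∈ (e : Sym2 V), ∀ y ∈ (e : Sym2 V), f x = f y) ∧
      A.card ≤ (A.image f).card + T.card := by
    clear h
    induction T using Finset.induction_on with
    | empty => exact ⟨id, by simp, by simp⟩
    | insert e T he ih =>
      obtain ⟨f, hf, hc⟩ := ih
      obtain ⟨⟨a, b⟩, hab⟩ := e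
      refine ⟨fun x => if f x = f a then f b else f x, ?_, ?_⟩
      · intro e' he' x hx y hy
        rcases Finset.mem_insert.1 he' with rfl | he'
        · have hx' : x = a ∨ x = b := Sym2.mem_iff.1 hx
          have hy' : y = a ∨ y = b := Sym2.mem_iff.1 hy
          rcases hx' with rfl | rfl <;> rcases hy' with rfl | rfl <;> simp
        · simp only [hf e' he' x hx y hy]
      · have : A.image f ⊆ insert (f a)
            (A.image fun x => if f x = f a then f b else f x) := by
          intro z hz
          obtain ⟨x, hx, rfl⟩ := Finset.mem_image.1 hz
          by_cases hxa : f x = f a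
          · simp [hxa]
          · exact Finset.mem_insert_of_mem (Finset.mem_image.2 ⟨x, hx, by simp [hxa]⟩)
        have h1 := (Finset.card_le_card this).trans (Finset.card_insert_le _ _)
        rw [Finset.card_insert_of_notMem he]
        omega
  have : (A.image f).card ≤ 1 := by
    refine Finset.card_le_one.2 fun z hz z' hz' => ?_
    obtain ⟨x, hx, rfl⟩ := Finset.mem_image.1 hz
    obtain ⟨y, hy, rfl⟩ := Finset.mem_image.1 hz'
    exact (h (fun t => f t = f x) (fun e he s hs t ht hst => (hf e he t ht s hs).trans hst)
      x hx y hy rfl).symm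
  omega

variable {A : Finset V} {T : Finset G.edgeSet} {u v w : V} {e : G.edgeSet}

/-- The new vertex `w` is a leaf attached to `u`, so a predicate closed under `T` extends uniquely
to `w` by its value at `u`, and `w` takes over the role of `u`. -/
theorem spansBetween_advance_used [DecidableEq G.edgeSet] [DecidableEq V] (c : Bool)
    (hw : w ∉ A) (hu : u ∈ A) (hv : v ∈ A) (he : (e : Sym2 V) = s(u, w)) (heT : e ∉ T)
    (hT : ∀ f ∈ T, ∀ x ∈ (f : Sym2 V), x ∈ A) :
    SpansBetween c (insert w A) (insert e T) w v ↔ SpansBetween c A T u v := by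
  have huw : u ≠ w := by rintro rfl; exact hw hu
  have hvw : v ≠ w := by rintro rfl; exact hw hv
  unfold SpansBetween
  rw [Finset.card_insert_of_notMem hw, Finset.card_insert_of_notMem heT]
  refine and_congr ⟨fun h P hP hc x hx y hy => ?_, fun h P hP hc => ?_⟩ (by omega)
  · have := h (Function.update P w (P u)) ?_ ?_ x (by simp [hx]) y (by simp [hy])
    · have hxw : x ≠ w := by rintro rfl; exact hw hx
      have hyw : y ≠ w := by rintro rfl; exact hw hy
      simpa [hxw, hyw] using this
    · intro f hf a ha b hb
      rcases Finset.mem_insert.1 hf with rfl | hf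
      · rw [he] at ha hb
        rcases Sym2.mem_iff.1 ha with rfl | rfl <;> rcases Sym2.mem_iff.1 hb with rfl | rfl <;>
          simp [huw]
      · have haw : a ≠ w := by rintro rfl; exact hw (hT f hf a ha)
        have hbw : b ≠ w := by rintro rfl; exact hw (hT f hf b hb)
        simpa [haw, hbw] using hP f hf a ha b hb
    · intro hcf
      simpa [hvw] using hc hcf
  · have huw' : P u ↔ P w := by
      have h1 : u ∈ (e : Sym2 V) := by simp [he]
      have h2 : w ∈ (e : Sym2 V) := by simp [he]
      exact ⟨hP e (by simp) u h1 w h2, hP e (by simp) w h2 u h1⟩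
    have key := h P (fun f hf => hP f (by simp [hf])) fun hcf => huw'.trans (hc hcf)
    intro x hx y hy
    rcases Finset.mem_insert.1 hx with rfl | hx' <;> rcases Finset.mem_insert.1 hy with rfl | hy'
    · exact id
    · exact fun hp => key u hu y hy' (huw'.2 hp)
    · exact fun hp => huw'.1 (key x hx' u hu hp)
    · exact key x hx' y hy'

/-- Here `w` is isolated and forms a component of its own, which is allowed only if `A` was
connected before. Identifying `w` with `v` corresponds to giving a predicate at `w` its value at
`v`. -/
theorem spansBetween_advance_unused [DecidableEq V] (hw : w ∉ A) (hv : v ∈ A)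
    (hT : ∀ f ∈ T, ∀ x ∈ (f : Sym2 V), x ∈ A) :
    SpansBetween false (insert w A) T w v ↔ SpansBetween true A T u v := by
  have hvw : v ≠ w := by rintro rfl; exact hw hv
  unfold SpansBetween
  rw [Finset.card_insert_of_notMem hw]
  refine and_congr ⟨fun h P hP _ x hx y hy => ?_, fun h P hP hc => ?_⟩
    (by simp only [Bool.false_eq_true, if_false, if_true]; omega)
  · have := h (Function.update P w (P v)) ?_ ?_ x (by simp [hx]) y (by simp [hy])
    · have hxw : x ≠ w := by rintro rfl; exact hw hx
      have hyw : y ≠ w := by rintro rfl; exact hw hy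
      simpa [hxw, hyw] using this
    · intro f hf a ha b hb
      have haw : a ≠ w := by rintro rfl; exact hw (hT f hf a ha)
      have hbw : b ≠ w := by rintro rfl; exact hw (hT f hf b hb)
      simpa [haw, hbw] using hP f hf a ha b hb
    · intro
      simp [hvw]
  · have hc := hc rfl
    have key := h P hP (by simp)
    intro x hx y hy
    rcases Finset.mem_insert.1 hx with rfl | hx' <;> rcases Finset.mem_insert.1 hy with rfl | hy'
    · exact id
    · exact fun hp => key v hv y hy' (hc.1 hp)
    · exact fun hp => hc.2 (key x hx' v hv hp)
    · exact key x hx' y hy'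

theorem not_spansBetween_advance_unused [DecidableEq V] (hw : w ∉ A) (hv : v ∈ A)
    (hT : ∀ f ∈ T, ∀ x ∈ (f : Sym2 V), x ∈ A) :
    ¬ SpansBetween true (insert w A) T w v := by
  intro h
  have := h.1 (fun x => x = w) ?_ (by simp) w (by simp) v (by simp [hv]) rfl
  · exact hw (this ▸ hv)
  · rintro f hf a ha b hb rfl
    exact absurd (hT f hf a ha) hw

/-- Adding the edge `uv` has the same effect as identifying `u` and `v`. -/
theorem spansBetween_rung_used [DecidableEq G.edgeSet] (he : (e : Sym2 V) = s(u, v))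
    (heT : e ∉ T) : SpansBetween true A (insert e T) u v ↔ SpansBetween false A T u v := by
  unfold SpansBetween
  rw [Finset.card_insert_of_notMem heT]
  refine and_congr ⟨fun h P hP hc => h P ?_ (by simp), fun h P hP _ => ?_⟩
    (by simp only [Bool.false_eq_true, if_false, if_true])
  · intro f hf a ha b hb
    rcases Finset.mem_insert.1 hf with rfl | hf
    · rw [he] at ha hb
      have hc := hc rfl
      rcases Sym2.mem_iff.1 ha with rfl | rfl <;> rcases Sym2.mem_iff.1 hb with rfl | rfl <;>
        simp [hc]
    · exact hP f hf a ha b hb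
  · have h1 : u ∈ (e : Sym2 V) := by simp [he]
    have h2 : v ∈ (e : Sym2 V) := by simp [he]
    exact h P (fun f hf => hP f (by simp [hf])) fun _ =>
      ⟨hP e (by simp) u h1 v h2, hP e (by simp) v h2 u h1⟩

/-- If the edge `uv` belongs to the set, the identification of `u` and `v` adds nothing, so the set
already connects `A` and has at least `A.card - 1` edges, one more than is allowed. -/
theorem not_spansBetween_rung_used [DecidableEq G.edgeSet] (he : (e : Sym2 V) = s(u, v)) :
    ¬ SpansBetween false A (insert e T) u v := by
  intro h
  have h1 : u ∈ (e : Sym2 V) := by simp [he]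
  have h2 : v ∈ (e : Sym2 V) := by simp [he]
  have hc := card_le_of_connected (A := A) (T := insert e T) fun P hP => h.1 P hP fun _ =>
    ⟨hP e (by simp) u h1 v h2, hP e (by simp) v h2 u h1⟩
  have := h.2
  simp only [Bool.false_eq_true, if_false] at this
  omega

/-- A tree is a connected graph with one edge fewer than vertices; connectedness is expressed by
predicates that are constant along edges. For connected sets `u` and `v` play no role. -/
theorem isSpanningTree_iff [Fintype V] [Nonempty V] (T : Finset G.edgeSet) (u v : V) :
    IsSpanningTree G T ↔ SpansBetween true Finset.univ T u v := by
  classical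
  unfold IsSpanningTree SpansBetween
  rw [SimpleGraph.isTree_iff_connected_and_card]
  have hE : (SimpleGraph.fromEdgeSet ((fun e : G.edgeSet => (e : Sym2 V)) '' (T : Set G.edgeSet))).edgeSet =
      (fun e : G.edgeSet => (e : Sym2 V)) '' (T : Set G.edgeSet) := by
    rw [SimpleGraph.edgeSet_fromEdgeSet, sdiff_eq_left, Set.disjoint_left]
    rintro _ ⟨e, -, rfl⟩
    exact G.not_isDiag_of_mem_edgeSet e.2
  have hcard : Nat.card (SimpleGraph.fromEdgeSet
      ((fun e : G.edgeSet => (e : Sym2 V)) '' (T : Set G.edgeSet))).edgeSet = T.card := by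
    rw [hE, Nat.card_image_of_injective Subtype.val_injective]
    simp
  rw [hcard, Nat.card_eq_fintype_card, Finset.card_univ]
  refine and_congr ⟨fun h P hP _ x hx y hy => ?_, fun h => ?_⟩ (by simp)
  · clear hx hy
    obtain ⟨p⟩ := h.preconnected x y
    induction p with
    | nil => exact id
    | cons hadj p ih =>
      intro hx
      refine ih ?_
      rw [SimpleGraph.fromEdgeSet_adj] at hadj
      obtain ⟨⟨e, he, hee⟩, -⟩ := hadj
      refine hP e he _ ?_ _ ?_ hx <;> simp [hee]
  · refine (SimpleGraph.connected_iff _).2 ⟨fun x y => ?_, inferInstance⟩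
    refine h (fun z => SimpleGraph.Reachable _ x z) ?_ (by simp) x (by simp) y (by simp)
      (SimpleGraph.Reachable.refl _)
    intro e he a ha b hb hxa
    by_cases hab : a = b
    · exact hab ▸ hxa
    · refine hxa.trans (SimpleGraph.Adj.reachable ?_)
      rw [SimpleGraph.fromEdgeSet_adj]
      exact ⟨⟨e, he, ((Sym2.mem_and_mem_iff hab).1 ⟨ha, hb⟩)⟩, hab⟩

end SpansBetween

end LadderTrees

namespace LadderTrees

/-! ## States of the dynamic program -/

/-- What has to be known about a set `T` of processed edges at the frontier `u`, `v`: whether `u`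
and `v` are connected, whether there is an edge in `T` that avoids `u`, `v`, or both, and which
positions of the incidence lists of `u` and `v` hold edges of `T`. -/
@[ext] structure St where
  conn : Bool
  bu : Bool
  bv : Bool
  buv : Bool
  x : Fin 3 → Bool
  y : Fin 3 → Bool

noncomputable instance : Fintype St :=
  Fintype.ofInjective
    (fun s : St => (s.conn, s.bu, s.bv, s.buv, s.x, s.y)) fun s t h => by
      simp only [Prod.mk.injEq] at h
      obtain ⟨h1, h2, h3, h4, h5, h6⟩ := h
      exact St.ext h1 h2 h3 h4 h5 h6

/-- A number for each state. -/
noncomputable def St.code (s : St) : ℕ := Fintype.equivFin St s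

theorem St.code_injective : Function.Injective St.code := fun _ _ h =>
  (Fintype.equivFin St).injective (Fin.ext h)

/-- The state after `u` and `v` change places. -/
def St.swap (s : St) : St := ⟨s.conn, s.bv, s.bu, s.buv, s.y, s.x⟩

/-- There is an edge in `T`. -/
def St.any (s : St) : Bool := s.bu || decide (∃ j, s.x j = true)

/-- The state after processing an edge between `u` and `v`. -/
def St.rung (s : St) (j j' : Fin 3) : Bool → Option St
  | false => some s
  | true => if s.conn then none else
      some ⟨true, s.bu, s.bv, s.buv, Function.update s.x j true, Function.update s.y j' true⟩

/-- The state after processing the last edge at `u`, whose other end is a new vertex. -/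
def St.advance (s : St) (j' : Fin 3) : Bool → Option St
  -- An edge of the old `T` never contains the new vertex `w`. So an edge avoiding `w` exists as
  -- soon as `T` is nonempty, and avoiding both `w` and `v` means avoiding `v`. If `u` and `v` are
  -- not connected, the edge must be used, as `w` would be a third component.
  | false => if s.conn then some ⟨false, s.any, s.bv, s.bv, fun _ => false, s.y⟩ else none
  | true => some ⟨s.conn, s.any, true, s.bv, fun i => decide (i = j'), s.y⟩

section Rep

variable {V : Type} {G : SimpleGraph V}

/-- `At v j e` says that the edge `e` is at position `j` of the incidence list of `v`. -/
structure IsIncidence (At : V → Fin 3 → G.edgeSet → Prop) : Prop where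
  mem : ∀ {v j e}, At v j e → v ∈ (e : Sym2 V)
  exists_of_mem : ∀ {v} {e : G.edgeSet}, v ∈ (e : Sym2 V) → ∃ j, At v j e
  pos_unique : ∀ {v j j' e}, At v j e → At v j' e → j = j'
  edge_unique : ∀ {v j e e'}, At v j e → At v j e' → e = e'

/-- The edges in `D` have been processed, they lie in the vertex set `A`, and only at the vertices
`u` and `v` of `A` there may be unprocessed edges. -/
structure Frontier (A : Finset V) (D : Finset G.edgeSet) (u v : V) : Prop where
  ne : u ≠ v
  left_mem : u ∈ A
  right_mem : v ∈ A
  ends_mem : ∀ e ∈ D, ∀ x ∈ (e : Sym2 V), x ∈ A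
  inner : ∀ x ∈ A, x ≠ u → x ≠ v → ∀ e : G.edgeSet, x ∈ (e : Sym2 V) → e ∈ D

theorem Frontier.swap {A : Finset V} {D : Finset G.edgeSet} {u v : V} (h : Frontier A D u v) :
    Frontier A D v u :=
  ⟨h.ne.symm, h.right_mem, h.left_mem, h.ends_mem, fun x hx h1 h2 => h.inner x hx h2 h1⟩

/-- The state `s` describes the set `T` of processed edges, which is conflict-free and can
possibly be extended to a spanning tree. -/
structure Rep (At : V → Fin 3 → G.edgeSet → Prop) (S : Finset (Sym2 G.edgeSet)) (A : Finset V)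
    (D : Finset G.edgeSet) (u v : V) (s : St) (T : Finset G.edgeSet) : Prop where
  sub : T ⊆ D
  spans : SpansBetween s.conn A T u v
  bu : s.bu = true ↔ ∃ f ∈ T, u ∉ (f : Sym2 V)
  bv : s.bv = true ↔ ∃ f ∈ T, v ∉ (f : Sym2 V)
  buv : s.buv = true ↔ ∃ f ∈ T, u ∉ (f : Sym2 V) ∧ v ∉ (f : Sym2 V)
  x : ∀ j, s.x j = true ↔ ∃ f ∈ T, At u j f
  y : ∀ j, s.y j = true ↔ ∃ f ∈ T, At v j f
  free : ∀ e ∈ T, ∀ f ∈ T, s(e, f) ∉ S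

variable {At : V → Fin 3 → G.edgeSet → Prop} {S : Finset (Sym2 G.edgeSet)} {A : Finset V}
  {D T : Finset G.edgeSet} {u v w : V} {s s' : St} {e : G.edgeSet} {j j' : Fin 3}

theorem Rep.swap (h : Rep At S A D u v s T) : Rep At S A D v u s.swap T :=
  ⟨h.sub, h.spans.swap, h.bv, h.bu, by simp [St.swap, h.buv, and_comm], h.y, h.x, h.free⟩

/-- All components of a state other than `conn` are determined by `T`. This identifies a given state
with the one computed by a transition. -/
theorem Rep.eq (h : Rep At S A D u v s T) (h' : Rep At S A D u v s' T)
    (hc : s.conn = s'.conn) : s = s' := by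
  refine St.ext hc ?_ ?_ ?_ (funext fun j => ?_) (funext fun j => ?_) <;> rw [Bool.eq_iff_iff]
  · rw [h.bu, h'.bu]
  · rw [h.bv, h'.bv]
  · rw [h.buv, h'.buv]
  · rw [h.x, h'.x]
  · rw [h.y, h'.y]

theorem exists_rep (hsub : T ⊆ D) (c : Bool) (h : SpansBetween c A T u v)
    (hf : ∀ e ∈ T, ∀ f ∈ T, s(e, f) ∉ S) : ∃ s, s.conn = c ∧ Rep At S A D u v s T := by
  classical
  exact ⟨⟨c, decide (∃ f ∈ T, u ∉ (f : Sym2 V)), decide (∃ f ∈ T, v ∉ (f : Sym2 V)),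
    decide (∃ f ∈ T, u ∉ (f : Sym2 V) ∧ v ∉ (f : Sym2 V)), fun j => decide (∃ f ∈ T, At u j f),
    fun j => decide (∃ f ∈ T, At v j f)⟩, rfl, hsub, h, by simp, by simp, by simp, by simp,
    by simp, hf⟩

theorem Rep.any (hAt : IsIncidence At) (h : Rep At S A D u v s T) :
    s.any = true ↔ T.Nonempty := by
  simp only [St.any, Bool.or_eq_true, decide_eq_true_eq, h.bu, h.x]
  constructor
  · rintro (⟨f, hf, -⟩ | ⟨j, f, hf, -⟩) <;> exact ⟨f, hf⟩
  · rintro ⟨f, hf⟩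
    by_cases hu : u ∈ (f : Sym2 V)
    · obtain ⟨j, hj⟩ := hAt.exists_of_mem hu
      exact .inr ⟨j, f, hf, hj⟩
    · exact .inl ⟨f, hf, hu⟩

/-- A vertex of `A` off the frontier has no unprocessed edges, so an unprocessed edge at `u` that
does not end in `v` leaves `A`. -/
theorem Frontier.new_notMem (hF : Frontier A D u v) (heD : e ∉ D) (he : (e : Sym2 V) = s(u, w))
    (hwv : w ≠ v) : w ∉ A := by
  intro hw
  have hwu : w ≠ u := by
    rintro rfl
    exact G.not_isDiag_of_mem_edgeSet e.2 (by rw [he]; exact Sym2.mk_isDiag_iff.2 rfl)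
  exact heD (hF.inner w hw hwu hwv e (by simp [he]))

variable [DecidableEq G.edgeSet]

/-- `T` with or without the edge `e`. -/
def addIf (b : Bool) (e : G.edgeSet) (T : Finset G.edgeSet) : Finset G.edgeSet :=
  if b then insert e T else T

theorem Frontier.rung (hF : Frontier A D u v) (he : (e : Sym2 V) = s(u, v)) :
    Frontier A (insert e D) u v := by
  refine ⟨hF.ne, hF.left_mem, hF.right_mem, fun f hf x hx => ?_, fun x hx h1 h2 f hf =>
    Finset.mem_insert_of_mem (hF.inner x hx h1 h2 f hf)⟩
  rcases Finset.mem_insert.1 hf with rfl | hf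
  · rw [he] at hx
    rcases Sym2.mem_iff.1 hx with rfl | rfl
    exacts [hF.left_mem, hF.right_mem]
  · exact hF.ends_mem f hf x hx

theorem Frontier.advance [DecidableEq V] (hF : Frontier A D u v) (he : (e : Sym2 V) = s(u, w))
    (hwv : w ≠ v) (hlast : ∀ f : G.edgeSet, u ∈ (f : Sym2 V) → f ≠ e → f ∈ D) :
    Frontier (insert w A) (insert e D) w v := by
  refine ⟨hwv, by simp, by simp [hF.right_mem], fun f hf x hx => ?_, fun x hx h1 h2 f hf => ?_⟩
  · rcases Finset.mem_insert.1 hf with rfl | hf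
    · rw [he] at hx
      rcases Sym2.mem_iff.1 hx with rfl | rfl
      · simp [hF.left_mem]
      · simp
    · simp [hF.ends_mem f hf x hx]
  · by_cases hxu : x = u
    · subst hxu
      by_cases hfe : f = e
      · simp [hfe]
      · simp [hlast f hf hfe]
    · refine Finset.mem_insert_of_mem (hF.inner x ?_ hxu h2 f hf)
      simpa [h1] using hx

theorem free_insert (hS : AdjacentConflicts G S) (h : ∀ e ∈ T, ∀ f ∈ T, s(e, f) ∉ S)
    (he : ∀ f ∈ T, s(e, f) ∉ S) : ∀ f ∈ insert e T, ∀ g ∈ insert e T, s(f, g) ∉ S := by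
  intro f hf g hg
  rcases Finset.mem_insert.1 hf with rfl | hf' <;> rcases Finset.mem_insert.1 hg with rfl | hg'
  · exact fun h => (hS _ _ h).1 rfl
  · exact he g hg'
  · rw [Sym2.eq_swap]; exact he f hf'
  · exact h f hf' g hg'

theorem Rep.rung (hAt : IsIncidence At) (hS : AdjacentConflicts G S)
    (heD : e ∉ D) (he : (e : Sym2 V) = s(u, v)) (hj : At u j e) (hj' : At v j' e)
    (h : Rep At S A D u v s T) {b : Bool} (hs : s.rung j j' b = some s')
    (hb : b = true → ∀ f ∈ T, s(e, f) ∉ S) :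
    Rep At S A (insert e D) u v s' (addIf b e T) := by
  have heT : e ∉ T := fun h' => heD (h.sub h')
  cases b with
  | false =>
    obtain rfl : s = s' := by simpa [St.rung] using hs
    exact ⟨h.sub.trans (Finset.subset_insert _ _), h.spans, h.bu, h.bv, h.buv, h.x, h.y, h.free⟩
  | true =>
    have hc : s.conn = false := by
      cases hc : s.conn with
      | false => rfl
      | true => simp [St.rung, hc] at hs
    obtain rfl : _ = s' := by simpa [St.rung, hc] using hs
    have hu : u ∈ (e : Sym2 V) := by simp [he]
    have hv : v ∈ (e : Sym2 V) := by simp [he]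
    refine ⟨Finset.insert_subset_insert _ h.sub, ?_, ?_, ?_, ?_, fun i => ?_, fun i => ?_,
      free_insert hS h.free (hb rfl)⟩
    · refine (spansBetween_rung_used he heT).2 ?_
      rw [← hc]
      exact h.spans
    · simpa [addIf, hu] using h.bu
    · simpa [addIf, hv] using h.bv
    · simpa [addIf, hu] using h.buv
    · by_cases hi : i = j
      · subst hi; simp [addIf, hj]
      · have : ¬ At u i e := fun h' => hi (hAt.pos_unique h' hj)
        simpa [addIf, hi, this] using h.x i
    · by_cases hi : i = j'
      · subst hi; simp [addIf, hj']
      · have : ¬ At v i e := fun h' => hi (hAt.pos_unique h' hj')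
        simpa [addIf, hi, this] using h.y i

/-- The converse of `Rep.rung`. Deleting `e` from `T'` gives a set that is described by some state;
the transition from it yields a state of `T'`, which is `s'` by `Rep.eq`. A set containing the edge
`uv` can only be connected, so before that `conn` was false. -/
theorem Rep.exists_of_rung (hAt : IsIncidence At) (hS : AdjacentConflicts G S)
    (heD : e ∉ D) (he : (e : Sym2 V) = s(u, v)) (hj : At u j e) (hj' : At v j' e)
    {T' : Finset G.edgeSet} (h : Rep At S A (insert e D) u v s' T') :
    ∃ s b T, Rep At S A D u v s T ∧ s.rung j j' b = some s' ∧ T' = addIf b e T ∧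
      (b = true → ∀ f ∈ T, s(e, f) ∉ S) := by
  by_cases heT : e ∈ T'
  · have hT : T' = addIf true e (T'.erase e) := by simp [addIf, Finset.insert_erase heT]
    have hc : s'.conn = true := by
      cases hc : s'.conn with
      | true => rfl
      | false =>
        have := h.spans
        rw [hc, hT] at this
        exact absurd this (not_spansBetween_rung_used he)
    have hsp := h.spans
    rw [hc, hT] at hsp
    replace hsp := (spansBetween_rung_used he (Finset.notMem_erase e T')).1 hsp
    have hfree : ∀ f ∈ T'.erase e, s(e, f) ∉ S := fun f hf =>
      h.free e heT f (Finset.mem_of_mem_erase hf)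
    obtain ⟨s, hsc, hs⟩ := exists_rep (At := At) (S := S) (D := D)
      (Finset.subset_insert_iff.1 h.sub) false hsp
      fun f hf g hg => h.free f (Finset.mem_of_mem_erase hf) g (Finset.mem_of_mem_erase hg)
    obtain ⟨s'', hs'', hc''⟩ : ∃ s'', s.rung j j' true = some s'' ∧ s''.conn = true := by
      simp [St.rung, hsc]
    have hr := hs.rung hAt hS heD he hj hj' hs'' fun _ => hfree
    rw [← hT] at hr
    refine ⟨s, true, _, hs, ?_, hT, fun _ => hfree⟩
    rw [hs'', hr.eq h (hc''.trans hc.symm)]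
  · refine ⟨s', false, T', ⟨(Finset.subset_insert_iff_of_notMem heT).1 h.sub, h.spans, h.bu, h.bv,
      h.buv, h.x, h.y, h.free⟩, rfl, rfl, by simp⟩

theorem Rep.advance [DecidableEq V] (hAt : IsIncidence At) (hS : AdjacentConflicts G S)
    (hF : Frontier A D u v) (heD : e ∉ D) (he : (e : Sym2 V) = s(u, w)) (hwv : w ≠ v)
    (hj' : At w j' e)
    (h : Rep At S A D u v s T) {b : Bool} (hs : s.advance j' b = some s')
    (hb : b = true → ∀ f ∈ T, s(e, f) ∉ S) :
    Rep At S (insert w A) (insert e D) w v s' (addIf b e T) := by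
  have heT : e ∉ T := fun h' => heD (h.sub h')
  have hw := hF.new_notMem heD he hwv
  have hTA : ∀ f ∈ T, ∀ x ∈ (f : Sym2 V), x ∈ A := fun f hf => hF.ends_mem f (h.sub hf)
  have hwT : ∀ f ∈ T, w ∉ (f : Sym2 V) := fun f hf hwf => hw (hTA f hf w hwf)
  have hwAt : ∀ i, ∀ f ∈ T, ¬ At w i f := fun i f hf hi => hwT f hf (hAt.mem hi)
  have hve : v ∉ (e : Sym2 V) := by simp [he, hwv.symm, hF.ne.symm]
  have hwe : w ∈ (e : Sym2 V) := by simp [he]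
  have hbv : (∃ f ∈ T, w ∉ (f : Sym2 V) ∧ v ∉ (f : Sym2 V)) ↔ ∃ f ∈ T, v ∉ (f : Sym2 V) :=
    exists_congr fun f => and_congr_right fun hf => by simp [hwT f hf]
  have hbu : (∃ f ∈ T, w ∉ (f : Sym2 V)) ↔ T.Nonempty :=
    exists_congr fun f => ⟨fun h => h.1, fun hf => ⟨hf, hwT f hf⟩⟩
  cases b with
  | false =>
    have hc : s.conn = true := by
      cases hc : s.conn with
      | true => rfl
      | false => simp [St.advance, hc] at hs
    obtain rfl : _ = s' := by simpa [St.advance, hc] using hs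
    refine ⟨h.sub.trans (Finset.subset_insert _ _), ?_, ?_, ?_, ?_, fun i => ?_, fun i => ?_,
      h.free⟩
    · refine (spansBetween_advance_unused (u := u) hw hF.right_mem hTA).2 ?_
      rw [← hc]
      exact h.spans
    · rw [h.any hAt]; exact hbu.symm
    · exact h.bv
    · rw [h.bv]; exact hbv.symm
    · simpa [addIf] using hwAt i
    · exact h.y i
  | true =>
    obtain rfl : _ = s' := by simpa [St.advance] using hs
    refine ⟨Finset.insert_subset_insert _ h.sub, ?_, ?_, ?_, ?_, fun i => ?_, fun i => ?_,
      free_insert hS h.free (hb rfl)⟩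
    · exact (spansBetween_advance_used _ hw hF.left_mem hF.right_mem he heT hTA).2 h.spans
    · rw [h.any hAt, ← hbu]; simp [addIf, hwe]
    · simp [addIf, hve]
    · rw [h.bv, ← hbv]; simp [addIf, hwe]
    · have h1 : (∃ f ∈ T, At w i f) ↔ False := by simpa using hwAt i
      have h2 : At w i e ↔ i = j' := ⟨fun h' => hAt.pos_unique h' hj', fun h' => h' ▸ hj'⟩
      simp [addIf, h1, h2]
    · have : ¬ At v i e := fun h' => hve (hAt.mem h')
      simpa [addIf, this] using h.y i

/-- The converse of `Rep.advance`, by the same argument. If `e` is not used, then `w` is isolated,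
which forces `conn` to be false afterwards and true before. -/
theorem Rep.exists_of_advance [DecidableEq V] (hAt : IsIncidence At) (hS : AdjacentConflicts G S)
    (hF : Frontier A D u v) (heD : e ∉ D) (he : (e : Sym2 V) = s(u, w)) (hwv : w ≠ v)
    (hj' : At w j' e) {T' : Finset G.edgeSet}
    (h : Rep At S (insert w A) (insert e D) w v s' T') :
    ∃ s b T, Rep At S A D u v s T ∧ s.advance j' b = some s' ∧ T' = addIf b e T ∧
      (b = true → ∀ f ∈ T, s(e, f) ∉ S) := by
  have hw := hF.new_notMem heD he hwv
  by_cases heT : e ∈ T'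
  · have hT : T' = addIf true e (T'.erase e) := by simp [addIf, Finset.insert_erase heT]
    have hsub : T'.erase e ⊆ D := Finset.subset_insert_iff.1 h.sub
    have hsp := h.spans
    rw [hT] at hsp
    replace hsp := (spansBetween_advance_used _ hw hF.left_mem hF.right_mem he
      (Finset.notMem_erase e T') fun f hf => hF.ends_mem f (hsub hf)).1 hsp
    have hfree : ∀ f ∈ T'.erase e, s(e, f) ∉ S := fun f hf =>
      h.free e heT f (Finset.mem_of_mem_erase hf)
    obtain ⟨s, hsc, hs⟩ := exists_rep (At := At) (S := S) hsub _ hsp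
      fun f hf g hg => h.free f (Finset.mem_of_mem_erase hf) g (Finset.mem_of_mem_erase hg)
    obtain ⟨s'', hs'', hc''⟩ : ∃ s'', s.advance j' true = some s'' ∧ s''.conn = s'.conn := by
      simp [St.advance, hsc]
    have hr := hs.advance hAt hS hF heD he hwv hj' hs'' fun _ => hfree
    rw [← hT] at hr
    refine ⟨s, true, _, hs, ?_, hT, fun _ => hfree⟩
    rw [hs'', hr.eq h hc'']
  · have hsub := (Finset.subset_insert_iff_of_notMem heT).1 h.sub
    have hTA : ∀ f ∈ T', ∀ x ∈ (f : Sym2 V), x ∈ A := fun f hf => hF.ends_mem f (hsub hf)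
    have hsp := h.spans
    have hc : s'.conn = false := by
      cases hc : s'.conn with
      | false => rfl
      | true =>
        rw [hc] at hsp
        exact absurd hsp (not_spansBetween_advance_unused hw hF.right_mem hTA)
    rw [hc] at hsp
    replace hsp := (spansBetween_advance_unused (u := u) hw hF.right_mem hTA).1 hsp
    obtain ⟨s, hsc, hs⟩ := exists_rep (At := At) (S := S) hsub _ hsp h.free
    obtain ⟨s'', hs'', hc''⟩ : ∃ s'', s.advance j' false = some s'' ∧ s''.conn = false := by
      simp [St.advance, hsc]
    have hr := hs.advance hAt hS hF heD he hwv hj' hs'' (by simp)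
    refine ⟨s, false, T', hs, ?_, rfl, by simp⟩
    rw [hs'', hr.eq h (hc''.trans hc.symm)]

end Rep

end LadderTrees

namespace LadderTrees

/-! ## Operations of the sweep -/

/-- An operation of the sweep: first `u` and `v` change places if `sw` holds, and then an edge
between `u` and `v` (if `rung` holds) or the last unprocessed edge at `u` (otherwise) is processed.
This edge is at position `j` in the incidence list of `u`, at position `j'` in the list of its
other end, and `d` tells which end of the edge is `u`. -/
@[ext] structure Op where
  sw : Bool
  rung : Bool
  d : Bool
  j : Fin 3
  j' : Fin 3

noncomputable instance : Fintype Op :=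
  Fintype.ofInjective (fun o : Op => (o.sw, o.rung, o.d, o.j, o.j')) fun s t h => by
    simp only [Prod.mk.injEq] at h
    obtain ⟨h1, h2, h3, h4, h5⟩ := h
    exact Op.ext h1 h2 h3 h4 h5

/-- The state after the exchange of `u` and `v`, if there is one. -/
def Op.pre (o : Op) (s : St) : St := if o.sw then s.swap else s

@[simp] theorem Op.pre_pre (o : Op) (s : St) : o.pre (o.pre s) = s := by
  unfold Op.pre; split_ifs <;> rfl

/-- The state after an operation. -/
def Op.next (o : Op) (s : St) (b : Bool) : Option St :=
  if o.rung then (o.pre s).rung o.j o.j' b else (o.pre s).advance o.j' b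

/-- The positions of the edges in `T` that are adjacent to the processed edge; `(false, i)` stands
for position `i` at `u`, and `(true, i)` for position `i` at `v`. -/
def Op.near (o : Op) (s : St) : List (Bool × Fin 3) :=
  ((List.finRange 3).filter fun i => (o.pre s).x i).map (Prod.mk false) ++
    if o.rung then ((List.finRange 3).filter fun i => (o.pre s).y i).map (Prod.mk true) else []

/-- There is an edge in `T` that is not adjacent to the processed edge. -/
def Op.far (o : Op) (s : St) : Bool := if o.rung then (o.pre s).buv else (o.pre s).bu

section Fits

variable {V : Type} {G : SimpleGraph V}

/-- The operation `o` can be made at the frontier `u`, `v` (after the exchange); the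
processed edge is `e` with ends `u` and `w`. -/
structure Op.Fits (o : Op) (At : V → Fin 3 → G.edgeSet → Prop) (D : Finset G.edgeSet) (u v : V)
    (e : G.edgeSet) (w : V) : Prop where
  new : e ∉ D
  ends : (e : Sym2 V) = s(u, w)
  left : At u o.j e
  right : At w o.j' e
  rung : o.rung = true → w = v
  advance : o.rung = false → w ≠ v ∧ ∀ f : G.edgeSet, u ∈ (f : Sym2 V) → f ≠ e → f ∈ D

variable {At : V → Fin 3 → G.edgeSet → Prop} {S : Finset (Sym2 G.edgeSet)} {A : Finset V}
  {D T : Finset G.edgeSet} {u v w : V} {s : St} {e : G.edgeSet} {o : Op}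

/-- Soundness and completeness of the transitions for both kinds of operation. Here `u`, `v` are the
frontier after the exchange, while `s` is the state before it, which is why `o.pre s` appears. -/
theorem Op.Fits.step [DecidableEq V] [DecidableEq G.edgeSet] (hAt : IsIncidence At)
    (hS : AdjacentConflicts G S) (hF : Frontier A D u v)
    (ho : o.Fits At D u v e w) : ∃ A', Frontier A' (insert e D) (if o.rung then u else w) v ∧
      (∀ s T b s', Rep At S A D u v (o.pre s) T → o.next s b = some s' →
        (b = true → ∀ f ∈ T, s(e, f) ∉ S) →
        Rep At S A' (insert e D) (if o.rung then u else w) v s' (addIf b e T)) ∧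
      ∀ s' T', Rep At S A' (insert e D) (if o.rung then u else w) v s' T' →
        ∃ s b T, Rep At S A D u v (o.pre s) T ∧ o.next s b = some s' ∧ T' = addIf b e T ∧
          (b = true → ∀ f ∈ T, s(e, f) ∉ S) := by
  cases hr : o.rung with
  | true =>
    obtain rfl := ho.rung hr
    refine ⟨A, hF.rung ho.ends, fun s T b s' h hn hb => ?_, fun s' T' h => ?_⟩
    · simp only [Op.next, hr, if_true] at hn
      exact h.rung hAt hS ho.new ho.ends ho.left ho.right hn hb
    · obtain ⟨s, b, T, h1, h2, h3⟩ :=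
        Rep.exists_of_rung hAt hS ho.new ho.ends ho.left ho.right h
      exact ⟨o.pre s, b, T, by simpa using h1, by simpa [Op.next, hr] using h2, h3⟩
  | false =>
    obtain ⟨hwv, hlast⟩ := ho.advance hr
    refine ⟨insert w A, hF.advance ho.ends hwv hlast, fun s T b s' h hn hb => ?_,
      fun s' T' h => ?_⟩
    · simp only [Op.next, hr, Bool.false_eq_true, if_false] at hn
      exact h.advance hAt hS hF ho.new ho.ends hwv ho.right hn hb
    · obtain ⟨s, b, T, h1, h2, h3⟩ :=
        Rep.exists_of_advance hAt hS hF ho.new ho.ends hwv ho.right h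
      exact ⟨o.pre s, b, T, by simpa using h1, by simpa [Op.next, hr] using h2, h3⟩

/-- In an advance the other end of `e` is new and meets no processed edge, so only `u` matters; for
a rung both frontier vertices do. Thus the adjacent edges of `T` are all recorded in the state. -/
theorem Op.Fits.edgeAdj_iff (hF : Frontier A D u v) (ho : o.Fits At D u v e w) {f : G.edgeSet}
    (hf : f ∈ D) :
    EdgeAdj G e f ↔ u ∈ (f : Sym2 V) ∨ o.rung = true ∧ v ∈ (f : Sym2 V) := by
  have hne : e ≠ f := by rintro rfl; exact ho.new hf
  have h1 : EdgeAdj G e f ↔ u ∈ (f : Sym2 V) ∨ w ∈ (f : Sym2 V) := by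
    simp [EdgeAdj, hne, ho.ends, or_and_right, exists_or]
  rw [h1]
  cases hr : o.rung with
  | true => simp [ho.rung hr]
  | false =>
    have hw := hF.new_notMem ho.new ho.ends (ho.advance hr).1
    have : w ∉ (f : Sym2 V) := fun h => hw (hF.ends_mem f hf w h)
    simp [this]

theorem Op.Fits.near_iff (hAt : IsIncidence At) (hF : Frontier A D u v)
    (ho : o.Fits At D u v e w) (h : Rep At S A D u v (o.pre s) T) (f : G.edgeSet) :
    (∃ p ∈ o.near s, At (if p.1 then v else u) p.2 f) ↔ f ∈ T ∧ EdgeAdj G e f := by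
  have key : ∀ (z : V) (t : Fin 3 → Bool), (∀ j, t j = true ↔ ∃ f ∈ T, At z j f) →
      ((∃ i, t i = true ∧ At z i f) ↔ f ∈ T ∧ z ∈ (f : Sym2 V)) := by
    intro z t ht
    constructor
    · rintro ⟨i, hi, hz⟩
      obtain ⟨f', hf', hz'⟩ := (ht i).1 hi
      obtain rfl := hAt.edge_unique hz hz'
      exact ⟨hf', hAt.mem hz⟩
    · rintro ⟨hfT, hz⟩
      obtain ⟨i, hi⟩ := hAt.exists_of_mem hz
      exact ⟨i, (ht i).2 ⟨f, hfT, hi⟩, hi⟩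
  have h1 : (∃ p ∈ o.near s, At (if p.1 then v else u) p.2 f) ↔
      (∃ i, (o.pre s).x i = true ∧ At u i f) ∨
        o.rung = true ∧ ∃ i, (o.pre s).y i = true ∧ At v i f := by
    cases hr : o.rung <;> simp [Op.near, hr, or_and_right, exists_or]
  rw [h1, key u _ h.x, key v _ h.y]
  constructor
  · rintro (⟨h1, h2⟩ | ⟨h1, h2, h3⟩)
    · exact ⟨h1, (ho.edgeAdj_iff hF (h.sub h1)).2 (.inl h2)⟩
    · exact ⟨h2, (ho.edgeAdj_iff hF (h.sub h2)).2 (.inr ⟨h1, h3⟩)⟩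
  · rintro ⟨h1, h2⟩
    rcases (ho.edgeAdj_iff hF (h.sub h1)).1 h2 with h2 | ⟨h2, h3⟩
    · exact .inl ⟨h1, h2⟩
    · exact .inr ⟨h2, h1, h3⟩

theorem Op.Fits.far_iff (hF : Frontier A D u v)
    (ho : o.Fits At D u v e w) (h : Rep At S A D u v (o.pre s) T) :
    o.far s = true ↔ ∃ f ∈ T, ¬ EdgeAdj G e f := by
  have h1 : (∃ f ∈ T, ¬ EdgeAdj G e f) ↔
      ∃ f ∈ T, u ∉ (f : Sym2 V) ∧ (o.rung = true → v ∉ (f : Sym2 V)) :=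
    exists_congr fun f => and_congr_right fun hf => by
      rw [ho.edgeAdj_iff hF (h.sub hf)]; tauto
  rw [h1, Op.far]
  cases hr : o.rung
  · simp [h.bu]
  · simp [h.buv]

/-- It suffices to look for conflicts at the positions in `o.near s`. -/
theorem Op.Fits.free_iff (hS : AdjacentConflicts G S) (hAt : IsIncidence At)
    (hF : Frontier A D u v) (ho : o.Fits At D u v e w) (h : Rep At S A D u v (o.pre s) T) :
    (∀ p ∈ o.near s, ∀ f, At (if p.1 then v else u) p.2 f → s(e, f) ∉ S) ↔
      ∀ f ∈ T, s(e, f) ∉ S := by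
  constructor
  · intro h' f hf hfS
    obtain ⟨p, hp, hpf⟩ := (ho.near_iff hAt hF h f).2 ⟨hf, hS e f hfS⟩
    exact h' p hp f hpf hfS
  · intro h' p hp f hpf
    exact h' f ((ho.near_iff hAt hF h f).1 ⟨p, hp, hpf⟩).1

/-- Positions in `o.near s` are not empty. -/
theorem Rep.exists_of_near (h : Rep At S A D u v (o.pre s) T)
    {p : Bool × Fin 3} (hp : p ∈ o.near s) : ∃ f ∈ T, At (if p.1 then v else u) p.2 f := by
  obtain ⟨c, i⟩ := p
  cases c with
  | false =>
    have : (o.pre s).x i = true := by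
      cases hr : o.rung <;> simpa [Op.near, hr] using hp
    simpa using (h.x i).1 this
  | true =>
    have : (o.pre s).y i = true := by
      cases hr : o.rung
      · simp [Op.near, hr] at hp
      · simpa [Op.near, hr] using hp
    simpa using (h.y i).1 this

end Fits

end LadderTrees

namespace LadderTrees

/-! ## The transitions of the three problems

The scalars 13 and 14 hold `u` and `v`, the scalar 16 holds the processed edge, and array 7 marks
the conflict pairs. -/

/-- The three objective functions. -/
inductive Mode where
  | sum
  | bottleneck
  | quadratic

/-- The edge at a position. -/
def posExp (p : Bool × Fin 3) : NExp := .cell 3 (.reg (if p.1 then 14 else 13)) (.const p.2)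

/-- The cost of the processed edge. -/
def Mode.first : Mode → RExp
  | quadratic => .cell 0 (.reg 16) (.reg 16)
  | _ => .cell 0 (.reg 16) (.const 0)

/-- The other costs caused by the processed edge. -/
def Mode.rest (o : Op) (s : St) : Mode → List RExp
  | quadratic => (o.near s).flatMap (fun p =>
      [.cell 0 (.reg 16) (posExp p), .cell 0 (posExp p) (.reg 16)]) ++
      -- The machine has no real constants, so the cost 0 of the nonadjacent pairs is produced as a
      -- difference of equal numbers.
      if o.far s then [.sub (Mode.first quadratic) (Mode.first quadratic)] else []
  | _ => []

/-- The value of a state in the last complete layer. -/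
noncomputable def oldValue (s : St) : RExp := .cell 2 (.reg 15) (.const s.code)

/-- The maximum of a nonempty list of terms. -/
def maxProg (x : RExp) (l : List RExp) : Program :=
  .seq (.setReal 3 (.const 0) (.const 0) x :: l.map fun y =>
    .branch (.realLe (.cell 3 (.const 0) (.const 0)) y)
      (.setReal 3 (.const 0) (.const 0) y) .skip)

/-- The computation of a new value. -/
noncomputable def Mode.prog (M : Mode) (o : Op) (s : St) : Bool → Program
  | false => .setReal 3 (.const 0) (.const 0) (oldValue s)
  | true => match M with
    | sum => .setReal 3 (.const 0) (.const 0) (.add (oldValue s) M.first)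
    -- For empty `T` the stored value is the default `sSup ∅ = 0`; it must not enter the maximum,
    -- since the costs may all be negative.
    | _ => if (o.pre s).any then maxProg (oldValue s) (M.first :: M.rest o s)
        else maxProg M.first (M.rest o s)

/-- The new value, as a function of the old value `r`. -/
noncomputable def Mode.value (M : Mode) (o : Op) (s : St) (σ : Store) : Bool → ℝ → ℝ
  | false, r => r
  | true, r => match M with
    | sum => r + M.first.eval σ
    | _ => if (o.pre s).any then ((M.first :: M.rest o s).map (RExp.eval σ)).foldl max r
        else ((M.rest o s).map (RExp.eval σ)).foldl max (M.first.eval σ)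

/-- There is no conflict between the processed edge and the edges used before. -/
def okExp (o : Op) (s : St) : Bool → BExp
  | false => .tt
  | true => .all ((o.near s).map fun p => .natEq (.cell 7 (.reg 16) (posExp p)) (.const 0))

/-- The transition from `s` to `s'` by the operation `o`. -/
noncomputable def Mode.trans (M : Mode) (o : Op) (s s' : St) (b : Bool) : Trans where
  src := s.code
  tgt := s'.code
  used := if b then 1 else 0
  ok := okExp o s b
  prog := M.prog o s b
  value σ := M.value o s σ b (σ.real 2 (σ.nat 15 0 0) s.code)

/-- The value of the expression does not depend on the next layer. -/
def RExp.Stable (x : RExp) : Prop :=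
  ∀ σ τ : Store, LayerFrame (σ.nat 15 0 0) σ τ → x.eval τ = x.eval σ

theorem layerFrame_setReal (i : ℕ) (σ : Store) (x : ℝ) : LayerFrame i σ (σ.setReal 3 0 0 x) :=
  ⟨fun _ _ _ _ => rfl, fun a x y h3 _ => by simp [h3]⟩

theorem LayerFrame.eval_reg {i : ℕ} {σ τ : Store} (h : LayerFrame i σ τ) {a : ℕ}
    (ha : ¬ (9 ≤ a ∧ a ≤ 11)) : τ.nat a 0 0 = σ.nat a 0 0 :=
  h.nat _ _ _ fun h' => ha ⟨h'.1, h'.2.1⟩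

theorem LayerFrame.eval_posExp {i : ℕ} {σ τ : Store} (h : LayerFrame i σ τ) (p : Bool × Fin 3) :
    (posExp p).eval τ = (posExp p).eval σ := by
  have h13 := h.eval_reg (a := 13) (by omega)
  have h14 := h.eval_reg (a := 14) (by omega)
  obtain ⟨c, j⟩ := p
  cases c <;> simp [posExp, h13, h14, h.nat 3]

theorem stable_oldValue (s : St) : (oldValue s).Stable := fun σ τ h => by
  simp [oldValue, h.eval_reg (a := 15) (by omega), h.real 2]

theorem Mode.stable_first (M : Mode) : M.first.Stable := fun σ τ h => by
  have h16 := h.eval_reg (a := 16) (by omega)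
  cases M <;> simp [Mode.first, h16, h.real 0]

theorem Mode.stable_rest (M : Mode) (o : Op) (s : St) : ∀ x ∈ M.rest o s, x.Stable := by
  intro x hx σ τ h
  have h16 := h.eval_reg (a := 16) (by omega)
  cases M with
  | sum => simp [Mode.rest] at hx
  | bottleneck => simp [Mode.rest] at hx
  | quadratic =>
    simp only [Mode.rest, List.mem_append, List.mem_flatMap] at hx
    rcases hx with ⟨p, -, hp⟩ | hx
    · simp only [List.mem_cons, List.not_mem_nil, or_false] at hp
      rcases hp with rfl | rfl <;>
        simp only [RExp.eval, NExp.eval, NExp.reg, h.eval_posExp p, h16] <;>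
        rw [h.real 0 _ _ (by omega) (by omega)]
    · have hx' : x = .sub (Mode.first quadratic) (Mode.first quadratic) := by
        split_ifs at hx
        · simpa using hx
        · simp at hx
      simp [hx']

theorem exec_maxProg {x : RExp} {l : List RExp} (hl : ∀ y ∈ l, y.Stable) (σ : Store) :
    (maxProg x l).exec σ = σ.setReal 3 0 0 ((l.map (RExp.eval σ)).foldl max (x.eval σ)) := by
  have H : ∀ (l : List RExp), (∀ y ∈ l, y.Stable) → ∀ r : ℝ, (Program.seq (l.map fun y =>
      .branch (.realLe (.cell 3 (.const 0) (.const 0)) y)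
        (.setReal 3 (.const 0) (.const 0) y) .skip)).exec (σ.setReal 3 0 0 r) =
      σ.setReal 3 0 0 ((l.map (RExp.eval σ)).foldl max r) := by
    intro l
    induction l with
    | nil => intro _ r; simp
    | cons y l ih =>
      intro hl r
      have hy := hl y (by simp) σ (σ.setReal 3 0 0 r) (layerFrame_setReal _ _ _)
      have ih' := ih fun z hz => hl z (by simp [hz])
      by_cases hr : r ≤ y.eval σ
      · simp [hy, hr, Store.setReal_setReal, ih']
      · simp [hy, hr, ih', max_eq_left (not_le.1 hr).le]
  simpa [maxProg] using H l hl (x.eval σ)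

theorem loopFree_maxProg (x : RExp) (l : List RExp) : (maxProg x l).LoopFree := by
  refine Program.LoopFree.seq fun P hP => ?_
  rcases List.mem_cons.1 hP with rfl | hP
  · trivial
  · obtain ⟨y, -, rfl⟩ := List.mem_map.1 hP
    exact ⟨trivial, trivial⟩

theorem Mode.value_congr {M : Mode} {o : Op} {s : St} {σ τ : Store}
    (h : LayerFrame (σ.nat 15 0 0) σ τ) (b : Bool) (r : ℝ) :
    M.value o s τ b r = M.value o s σ b r := by
  have h1 := M.stable_first σ τ h
  have h2 : (M.rest o s).map (RExp.eval τ) = (M.rest o s).map (RExp.eval σ) :=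
    List.map_congr_left fun x hx => M.stable_rest o s x hx σ τ h
  cases b with
  | false => rfl
  | true => cases M <;> simp only [Mode.value, List.map_cons, h1, h2]

theorem foldl_max_mono (l : List ℝ) {r r' : ℝ} (h : r ≤ r') : l.foldl max r ≤ l.foldl max r' := by
  induction l generalizing r r' with
  | nil => exact h
  | cons x l ih => exact ih (max_le_max_right x h)

/-- Characterizing the running maximum as the greatest element of a union lets the objective values
be compared by an equality of sets of costs. -/
theorem isGreatest_foldl_max {A : Set ℝ} {r : ℝ} (h : IsGreatest A r) (l : List ℝ) :
    IsGreatest (A ∪ {z | z ∈ l}) (l.foldl max r) := by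
  induction l generalizing A r with
  | nil => simpa using h
  | cons x l ih =>
    have := ih (h.union (isGreatest_singleton (a := x)))
    have hs : {z | z ∈ x :: l} = {x} ∪ {z | z ∈ l} := by ext z; simp
    rwa [Set.union_assoc, ← hs] at this

/-- Bellman's principle: among the sets with a given state, one of smallest value remains best after
any common extension. -/
theorem Mode.value_mono (M : Mode) (o : Op) (s : St) (σ : Store) (b : Bool) :
    Monotone (M.value o s σ b) := by
  intro r r' h
  cases b with
  | false => exact h
  | true =>
    cases M with
    | sum => simpa [Mode.value] using h
    | bottleneck | quadratic =>
      simp only [Mode.value]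
      split_ifs
      · exact foldl_max_mono _ h
      · exact le_rfl

theorem Mode.valid_trans (M : Mode) (o : Op) (s s' : St) (b : Bool) :
    (M.trans o s s' b).Valid := by
  have hst : ∀ x ∈ M.first :: M.rest o s, x.Stable := by
    intro x hx
    rcases List.mem_cons.1 hx with rfl | hx
    · exact M.stable_first
    · exact M.stable_rest o s x hx
  refine ⟨?_, fun σ => ?_, fun σ τ h => ?_, fun σ τ h => ?_⟩
  · simp only [Mode.trans]
    cases b with
    | false => trivial
    | true =>
      cases M with
      | sum => trivial
      | bottleneck | quadratic =>
        simp only [Mode.prog]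
        split_ifs <;> exact loopFree_maxProg _ _
  · simp only [Mode.trans]
    cases b with
    | false => simp [Mode.prog, Mode.value, oldValue]
    | true =>
      cases M with
      | sum => simp [Mode.prog, Mode.value, oldValue]
      | bottleneck | quadratic =>
        simp only [Mode.prog, Mode.value]
        split_ifs
        · rw [exec_maxProg hst]; simp [oldValue]
        · rw [exec_maxProg fun x hx => hst x (by simp [hx])]
  · simp only [Mode.trans]
    cases b with
    | false => simp [okExp, BExp.tt]
    | true =>
      simp only [okExp, BExp.eval_all, List.forall_mem_map]
      refine forall₂_congr fun p _ => ?_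
      simp only [BExp.eval, NExp.eval, NExp.reg, h.eval_posExp p,
        h.eval_reg (a := 16) (by omega)]
      rw [h.nat 7 _ _ (by omega)]
  · simp only [Mode.trans]
    rw [M.value_congr h, h.eval_reg (a := 15) (by omega), h.real 2 _ _ (by omega) (by omega)]

/-- All the transitions of the operation `o`. -/
noncomputable def Mode.transitions (M : Mode) (o : Op) : List Trans :=
  (Finset.univ : Finset (St × Bool)).toList.filterMap fun p =>
    (o.next p.1 p.2).map fun s' => M.trans o p.1 s' p.2

theorem Mode.mem_transitions {M : Mode} {o : Op} {t : Trans} :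
    t ∈ M.transitions o ↔ ∃ s b s', o.next s b = some s' ∧ t = M.trans o s s' b := by
  simp only [Mode.transitions, List.mem_filterMap, Finset.mem_toList, Finset.mem_univ, true_and,
    Prod.exists, Option.map_eq_some_iff]
  constructor
  · rintro ⟨s, b, s', h, rfl⟩; exact ⟨s, b, s', h, rfl⟩
  · rintro ⟨s, b, s', h, rfl⟩; exact ⟨s, b, s', h, rfl⟩

end LadderTrees

namespace LadderTrees

/-! ## The values computed are the objective values -/

theorem isGreatest_maxCost {E : Type} (c : E → ℝ) {T : Finset E} (hT : T.Nonempty) :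
    IsGreatest {z | ∃ e ∈ T, z = c e} (maxCost c T) := by
  have hs : {z | ∃ e ∈ T, z = c e} = c '' (T : Set E) := by
    ext z; simp [eq_comm]
  unfold maxCost
  rw [hs]
  exact (T.finite_toSet.image c).isCompact.isGreatest_sSup (hT.to_set.image c)

theorem isGreatest_maxPairCost {E : Type} (q : E → E → ℝ) {T : Finset E} (hT : T.Nonempty) :
    IsGreatest {z | ∃ e ∈ T, ∃ f ∈ T, z = q e f} (maxPairCost q T) := by
  have hs : {z | ∃ e ∈ T, ∃ f ∈ T, z = q e f} =
      (fun p : E × E => q p.1 p.2) '' ((T : Set E) ×ˢ (T : Set E)) := by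
    ext z
    simp only [Set.mem_ofPred_eq, Set.mem_image, Set.mem_prod, Finset.mem_coe, Prod.exists]
    constructor
    · rintro ⟨e, he, f, hf, rfl⟩; exact ⟨e, f, ⟨he, hf⟩, rfl⟩
    · rintro ⟨e, f, ⟨he, hf⟩, rfl⟩; exact ⟨e, he, f, hf, rfl⟩
  unfold maxPairCost
  rw [hs]
  exact ((T.finite_toSet.prod T.finite_toSet).image _).isCompact.isGreatest_sSup
    ((hT.to_set.prod hT.to_set).image _)

section Correct

variable {N m : ℕ} {G : SimpleGraph (Fin N)}

/-- The scalars hold the frontier and the processed edge, and array 3 holds the incidence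
lists. -/
structure Loaded (edge : Fin m ≃ G.edgeSet) (At : Fin N → Fin 3 → G.edgeSet → Prop) (u v : Fin N)
    (e : G.edgeSet) (σ : Store) : Prop where
  left : σ.nat 13 0 0 = u
  right : σ.nat 14 0 0 = v
  edge_eq : σ.nat 16 0 0 = edge.symm e
  pos : ∀ x j f, At x j f → σ.nat 3 x j = edge.symm f

theorem Loaded.eval_posExp {edge : Fin m ≃ G.edgeSet} {At : Fin N → Fin 3 → G.edgeSet → Prop}
    {u v : Fin N} {e f : G.edgeSet} {σ : Store} (h : Loaded edge At u v e σ) {p : Bool × Fin 3}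
    (hp : At (if p.1 then v else u) p.2 f) : (posExp p).eval σ = edge.symm f := by
  obtain ⟨c, i⟩ := p
  cases c with
  | false => simpa [posExp, h.left] using h.pos _ _ _ hp
  | true => simpa [posExp, h.right] using h.pos _ _ _ hp

/-- The mode `M` computes the objective function `obj`. -/
structure Mode.Correct (M : Mode) (edge : Fin m ≃ G.edgeSet) (obj : Finset G.edgeSet → ℝ)
    (ρ : ℕ → ℕ → ℝ) : Prop where
  -- The value of the initial entry of the table is a blank real cell, hence 0. For the two maxima
  -- this is the default value of the supremum of the empty set.
  empty : obj ∅ = 0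
  insert : ∀ [DecidableEq G.edgeSet] {At : Fin N → Fin 3 → G.edgeSet → Prop}
    {S : Finset (Sym2 G.edgeSet)} {A : Finset (Fin N)} {D T : Finset G.edgeSet} {u v w : Fin N}
    {s : St} {e : G.edgeSet} {o : Op} {σ : Store}, IsIncidence At → Frontier A D u v →
    o.Fits At D u v e w → Rep At S A D u v (o.pre s) T → Loaded edge At u v e σ →
    σ.real 0 = ρ → M.value o s σ true (obj T) = obj (insert e T)

theorem Mode.correct_sum {edge : Fin m ≃ G.edgeSet} {c : G.edgeSet → ℝ} {ρ : ℕ → ℕ → ℝ}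
    (hρ : ∀ e : Fin m, ρ e 0 = c (edge e)) : Mode.sum.Correct edge (sumCost c) ρ := by
  refine ⟨by simp [sumCost], ?_⟩
  intro _ At S A D T u v w s e o σ hAt hF ho h hl hσ
  have heT : e ∉ T := fun he => ho.new (h.sub he)
  have := hρ (edge.symm e)
  simp only [Equiv.apply_symm_apply] at this
  simp [Mode.value, Mode.first, sumCost, Finset.sum_insert heT, hl.edge_eq, hσ, this, add_comm]

theorem Mode.correct_bottleneck {edge : Fin m ≃ G.edgeSet} {c : G.edgeSet → ℝ} {ρ : ℕ → ℕ → ℝ}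
    (hρ : ∀ e : Fin m, ρ e 0 = c (edge e)) : Mode.bottleneck.Correct edge (maxCost c) ρ := by
  refine ⟨by simp [maxCost], ?_⟩
  intro _ At S A D T u v w s e o σ hAt hF ho h hl hσ
  have hfirst : Mode.bottleneck.first.eval σ = c e := by
    have := hρ (edge.symm e)
    simp only [Equiv.apply_symm_apply] at this
    simp [Mode.first, hl.edge_eq, hσ, this]
  have hset : {z | ∃ f ∈ insert e T, z = c f} = {z | ∃ f ∈ T, z = c f} ∪ {z | z ∈ [c e]} := by
    ext z; simp [or_comm]
  refine IsGreatest.unique ?_ (isGreatest_maxCost c (Finset.insert_nonempty e T))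
  rw [hset]
  by_cases hT : T.Nonempty
  · have := isGreatest_foldl_max (isGreatest_maxCost c hT) [c e]
    simpa [Mode.value, Mode.rest, (h.any hAt).2 hT, hfirst] using this
  · have hany : (o.pre s).any = false := by
      rw [← Bool.not_eq_true]; exact fun h' => hT ((h.any hAt).1 h')
    rw [Finset.not_nonempty_iff_eq_empty] at hT
    subst hT
    simp [Mode.value, Mode.rest, hany, hfirst]

/-- The pairs that become relevant with `e` are the pair `e`, `e` and the pairs, in both orders, of
`e` with an edge of `T`. Those that are adjacent are found at the positions in `o.near s`; the
others all cost 0, and `o.far s` tells whether there are any. -/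
theorem Mode.correct_quadratic {edge : Fin m ≃ G.edgeSet} {q : G.edgeSet → G.edgeSet → ℝ}
    {ρ : ℕ → ℕ → ℝ} (hq : ∀ e f : G.edgeSet, e ≠ f → ¬ EdgeAdj G e f → q e f = 0)
    (hρ : ∀ e f : Fin m, ρ e f = q (edge e) (edge f)) :
    Mode.quadratic.Correct edge (maxPairCost q) ρ := by
  refine ⟨by simp [maxPairCost], ?_⟩
  intro _ At S A D T u v w s e o σ hAt hF ho h hl hσ
  have hρ' : ∀ e f : G.edgeSet, ρ (edge.symm e) (edge.symm f) = q e f := fun e f => by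
    simp [hρ]
  have hfirst : Mode.quadratic.first.eval σ = q e e := by
    simp [Mode.first, hl.edge_eq, hσ, hρ']
  have hadj : ∀ f, EdgeAdj G f e ↔ EdgeAdj G e f := fun f =>
    ⟨fun ⟨h1, x, h2, h3⟩ => ⟨h1.symm, x, h3, h2⟩, fun ⟨h1, x, h2, h3⟩ => ⟨h1.symm, x, h3, h2⟩⟩
  have hrest : ∀ z, z ∈ (Mode.quadratic.rest o s).map (RExp.eval σ) ↔
      ∃ f ∈ T, z = q e f ∨ z = q f e := by
    intro z
    have h1 : z ∈ (Mode.quadratic.rest o s).map (RExp.eval σ) ↔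
        (∃ p ∈ o.near s, z = ρ (edge.symm e) ((posExp p).eval σ) ∨
          z = ρ ((posExp p).eval σ) (edge.symm e)) ∨ (o.far s = true ∧ z = 0) := by
      rw [Mode.rest, List.map_append, List.mem_append, List.map_flatMap]
      refine or_congr ?_ ?_
      · simp [hl.edge_eq, hσ]
      · cases o.far s <;> simp
    rw [h1, ho.far_iff hF h]
    constructor
    · rintro (⟨p, hp, hz⟩ | ⟨⟨f, hf, hfe⟩, rfl⟩)
      · obtain ⟨f, hf, hpf⟩ := h.exists_of_near hp
        rw [hl.eval_posExp hpf, hρ', hρ'] at hz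
        exact ⟨f, hf, hz⟩
      · have hne : e ≠ f := by rintro rfl; exact ho.new (h.sub hf)
        exact ⟨f, hf, .inl (hq e f hne hfe).symm⟩
    · rintro ⟨f, hf, hz⟩
      by_cases hfe : EdgeAdj G e f
      · obtain ⟨p, hp, hpf⟩ := (ho.near_iff hAt hF h f).2 ⟨hf, hfe⟩
        refine .inl ⟨p, hp, ?_⟩
        rwa [hl.eval_posExp hpf, hρ', hρ']
      · have hne : e ≠ f := by rintro rfl; exact ho.new (h.sub hf)
        refine .inr ⟨⟨f, hf, hfe⟩, ?_⟩
        rwa [hq e f hne hfe, hq f e hne.symm (by rwa [hadj]), or_self] at hz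
  have hset : {z | ∃ f ∈ insert e T, ∃ g ∈ insert e T, z = q f g} =
      {z | ∃ f ∈ T, ∃ g ∈ T, z = q f g} ∪
        ({q e e} ∪ {z | z ∈ (Mode.quadratic.rest o s).map (RExp.eval σ)}) := by
    ext z
    simp only [Set.mem_ofPred_eq, Set.mem_union, Set.mem_singleton_iff, hrest]
    constructor
    · rintro ⟨f, hf, g, hg, rfl⟩
      rcases Finset.mem_insert.1 hf with rfl | hf' <;> rcases Finset.mem_insert.1 hg with rfl | hg'
      · exact .inr (.inl rfl)
      · exact .inr (.inr ⟨g, hg', .inl rfl⟩)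
      · exact .inr (.inr ⟨f, hf', .inr rfl⟩)
      · exact .inl ⟨f, hf', g, hg', rfl⟩
    · rintro (⟨f, hf, g, hg, rfl⟩ | rfl | ⟨f, hf, rfl | rfl⟩)
      · exact ⟨f, by simp [hf], g, by simp [hg], rfl⟩
      · exact ⟨e, by simp, e, by simp, rfl⟩
      · exact ⟨e, by simp, f, by simp [hf], rfl⟩
      · exact ⟨f, by simp [hf], e, by simp, rfl⟩
  refine IsGreatest.unique ?_ (isGreatest_maxPairCost q (Finset.insert_nonempty e T))
  rw [hset]
  by_cases hT : T.Nonempty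
  · have := isGreatest_foldl_max (isGreatest_maxPairCost q hT)
      ((Mode.quadratic.first :: Mode.quadratic.rest o s).map (RExp.eval σ))
    have hs : {z | z ∈ (Mode.quadratic.first :: Mode.quadratic.rest o s).map (RExp.eval σ)} =
        {q e e} ∪ {z | z ∈ (Mode.quadratic.rest o s).map (RExp.eval σ)} := by
      ext z
      rw [List.map_cons, hfirst]
      simp only [Set.mem_ofPred_eq, List.mem_cons, Set.mem_union, Set.mem_singleton_iff]
    rw [hs] at this
    simpa only [Mode.value, (h.any hAt).2 hT, if_true] using this
  · have hany : (o.pre s).any = false := by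
      rw [← Bool.not_eq_true]; exact fun h' => hT ((h.any hAt).1 h')
    rw [Finset.not_nonempty_iff_eq_empty] at hT
    have := isGreatest_foldl_max (isGreatest_singleton (a := q e e))
      ((Mode.quadratic.rest o s).map (RExp.eval σ))
    have h0 : {z | ∃ f ∈ T, ∃ g ∈ T, z = q f g} = ∅ := by simp [hT]
    rw [h0, Set.empty_union]
    simpa only [Mode.value, hany, Bool.false_eq_true, if_false, hfirst] using this

end Correct

end LadderTrees

namespace LadderTrees

/-! ## The sweep -/

/-- The edges found by following the previous states back from layer `i`; array 12 lists
the edges in the order in which they were processed. -/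
def trace (σ : Store) : ℕ → ℕ → Set ℕ
  | 0, _ => ∅
  | i + 1, c => {x | σ.nat 11 (i + 1) c = 1 ∧ x = σ.nat 12 (i + 1) 0} ∪
      trace σ i (σ.nat 10 (i + 1) c)

theorem trace_congr {σ τ : Store} {i : ℕ}
    (h : ∀ a i' c, 10 ≤ a → a ≤ 12 → i' ≤ i → τ.nat a i' c = σ.nat a i' c) (c : ℕ) :
    trace τ i c = trace σ i c := by
  induction i generalizing c with
  | zero => rfl
  | succ i ih =>
    rw [trace, trace, h 11 _ _ (by omega) (by omega) le_rfl, h 12 _ _ (by omega) (by omega) le_rfl,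
      h 10 _ _ (by omega) (by omega) le_rfl,
      ih fun a i' c h1 h2 h3 => h a i' c h1 h2 (by omega)]

/-- The vertex that plays the role of `u` in the operation. -/
def Op.near_reg (o : Op) : NExp := .reg (if o.sw then 14 else 13)

/-- The vertex that plays the role of `v` in the operation. -/
def Op.far_reg (o : Op) : NExp := .reg (if o.sw then 13 else 14)

/-- The edge processed by the operation. -/
def Op.edgeExp (o : Op) : NExp := .cell 3 o.near_reg (.const o.j)

/-- The other end of the edge processed by the operation. -/
def Op.endExp (o : Op) : NExp := .cell 1 o.edgeExp (.const (if o.d then 0 else 1))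

/-- The test whether the operation can be made.  Array 8 marks the processed edges. -/
def Op.test (o : Op) : BExp := .all
  ([.natLe (.const (o.j + 1)) (.cell 2 o.near_reg (.const 0)),
    .natEq (.cell 8 o.edgeExp (.const 0)) (.const 0),
    .natEq (.cell 1 o.edgeExp (.const (if o.d then 1 else 0))) o.near_reg,
    .natLe (.const (o.j' + 1)) (.cell 2 o.endExp (.const 0)),
    .natEq (.cell 3 o.endExp (.const o.j')) o.edgeExp] ++
  if o.rung then [.natEq o.endExp o.far_reg]
  else .neg (.natEq o.endExp o.far_reg) ::
    ((List.finRange 3).filter fun i => i ≠ o.j).map fun i =>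
      .neg (.conj (.natLe (.const (i + 1)) (.cell 2 o.near_reg (.const 0)))
        (.natEq (.cell 8 (.cell 3 o.near_reg (.const i)) (.const 0)) (.const 0))))

/-- Exchange `u` and `v` if necessary, and load the edge. -/
def Op.load (o : Op) : Program :=
  .seq [if o.sw then .seq [.setReg 18 (.reg 13), .setReg 13 (.reg 14), .setReg 14 (.reg 18)]
      else .skip,
    .setReg 16 (.cell 3 (.reg 13) (.const o.j)),
    .setReg 17 (.cell 1 (.reg 16) (.const (if o.d then 0 else 1)))]

/-- Record that the edge has been processed, and move the frontier. -/
def Op.finish (o : Op) : Program :=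
  .seq [.setNat 8 (.reg 16) (.const 0) (.const 1),
    .setNat 12 (.succ (.reg 15)) (.const 0) (.reg 16),
    if o.rung then .skip else .setReg 13 (.reg 17),
    .setReg 15 (.succ (.reg 15))]

/-- The program of an operation. -/
noncomputable def Mode.opProg (M : Mode) (o : Op) : Program :=
  .seq [o.load, layerProg (M.transitions o), o.finish]

/-- The operations, those without an exchange first. -/
noncomputable def allOps : List Op :=
  (Finset.univ : Finset Op).toList.filter (fun o => !o.sw) ++
    (Finset.univ : Finset Op).toList.filter (fun o => o.sw)

/-- The sweep processes all the edges of the graph. -/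
noncomputable def Mode.sweepProg (M : Mode) : Program :=
  .loop (.neg (.natEq (.reg 15) (.cell 0 (.const 0) (.const 1))))
    (.firstMatch Op.test M.opProg allOps)

theorem Mode.loopFree_opProg (M : Mode) (o : Op) : (M.opProg o).LoopFree := by
  refine Program.LoopFree.seq fun P hP => ?_
  simp only [List.mem_cons, List.not_mem_nil, or_false] at hP
  rcases hP with rfl | rfl | rfl
  · cases h : o.sw <;> simp [Op.load, h, Program.seq]
  · refine loopFree_layerProg fun t ht => ?_
    obtain ⟨s, b, s', -, rfl⟩ := Mode.mem_transitions.1 ht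
    exact M.valid_trans _ _ _ _
  · cases h : o.rung <;> simp [Op.finish, h, Program.seq]

/-! ### Invariants of the sweep and the meaning of the tests. -/

section Sweep

variable {N m : ℕ} {G : SimpleGraph (Fin N)}

/-- The edge `e` is at position `j` of the incidence list of `v`. -/
def atOf (edge : Fin m ≃ G.edgeSet) (σ : Store) (v : Fin N) (j : Fin 3) (e : G.edgeSet) : Prop :=
  (j : ℕ) < σ.nat 2 v 0 ∧ σ.nat 3 v j = (edge.symm e : ℕ)

/-- The store holds the graph, all of whose degrees are at most three, and the conflict pairs. -/
structure Prepared (edge : Fin m ≃ G.edgeSet) (S : Finset (Sym2 G.edgeSet)) (σ : Store) :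
    Prop where
  numEdges : σ.nat 0 0 1 = m
  ends : ∀ e : G.edgeSet, ∃ u v : Fin N, (e : Sym2 (Fin N)) = s(u, v) ∧
    σ.nat 1 (edge.symm e) 0 = u ∧ σ.nat 1 (edge.symm e) 1 = v
  incidence : IsIncidence (atOf edge σ)
  pos : ∀ (v : Fin N) (j : Fin 3), (j : ℕ) < σ.nat 2 v 0 → ∃ e, atOf edge σ v j e
  conflict : ∀ e f : G.edgeSet, σ.nat 7 (edge.symm e) (edge.symm f) = 0 ↔ s(e, f) ∉ S

/-- The configuration of the sweep in the store `σ`, reached from the store `σ₀`. -/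
structure SweepState (edge : Fin m ≃ G.edgeSet) (σ₀ : Store) (D : Finset G.edgeSet)
    (u v : Fin N) (σ : Store) : Prop where
  nat : ∀ a, a ≤ 7 → σ.nat a = σ₀.nat a
  real : ∀ a, a ≤ 1 → σ.real a = σ₀.real a
  left : σ.nat 13 0 0 = u
  right : σ.nat 14 0 0 = v
  count : σ.nat 15 0 0 = D.card
  done : ∀ e ∈ D, σ.nat 8 (edge.symm e) 0 = 1
  todo : ∀ e ∉ D, σ.nat 8 (edge.symm e) 0 = 0
  empty : ∀ i c, D.card < i → σ.nat 9 i c = 0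

/-- The last complete layer of the table is correct. -/
structure TableCorrect (edge : Fin m ≃ G.edgeSet) (obj : Finset G.edgeSet → ℝ) (i : ℕ)
    (R : St → Finset G.edgeSet → Prop) (σ : Store) : Prop where
  sound : ∀ c, σ.nat 9 i c = 1 → ∃ s T, c = St.code s ∧ R s T ∧ σ.real 2 i c = obj T ∧
    ∀ e, e ∈ T ↔ (edge.symm e : ℕ) ∈ trace σ i c
  complete : ∀ s T, R s T → σ.nat 9 i s.code = 1 ∧ σ.real 2 i s.code ≤ obj T

variable {edge : Fin m ≃ G.edgeSet} {S : Finset (Sym2 G.edgeSet)} {σ₀ σ : Store}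
  {D : Finset G.edgeSet} {u v : Fin N} {o : Op}

theorem Prepared.end_eq (hp : Prepared edge S σ₀) {e : G.edgeSet} {d : Bool} {x : Fin N}
    (hx : σ₀.nat 1 (edge.symm e) (if d then 1 else 0) = x) :
    ∃ w : Fin N, σ₀.nat 1 (edge.symm e) (if d then 0 else 1) = w ∧ (e : Sym2 (Fin N)) = s(x, w) := by
  obtain ⟨a, b, hab, ha, hb⟩ := hp.ends e
  cases d with
  | true =>
    simp only [if_true] at hx ⊢
    obtain rfl : b = x := Fin.ext (by omega)
    exact ⟨a, ha, by rw [hab, Sym2.eq_swap]⟩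
  | false =>
    simp only [Bool.false_eq_true, if_false] at hx ⊢
    obtain rfl : a = x := Fin.ext (by omega)
    exact ⟨b, hb, hab⟩

theorem Prepared.exists_dir (hp : Prepared edge S σ₀) {e : G.edgeSet} {x w : Fin N}
    (he : (e : Sym2 (Fin N)) = s(x, w)) :
    ∃ d : Bool, σ₀.nat 1 (edge.symm e) (if d then 1 else 0) = x ∧
      σ₀.nat 1 (edge.symm e) (if d then 0 else 1) = w := by
  obtain ⟨a, b, hab, ha, hb⟩ := hp.ends e
  rw [he] at hab
  rcases Sym2.eq_iff.1 hab with ⟨rfl, rfl⟩ | ⟨rfl, rfl⟩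
  · exact ⟨false, by simpa using ha, by simpa using hb⟩
  · exact ⟨true, by simpa using hb, by simpa using ha⟩

/-- The meaning of the test of an operation. -/
theorem SweepState.test_iff (h : SweepState edge σ₀ D u v σ) (hp : Prepared edge S σ₀) :
    o.test.eval σ ↔ ∃ e w, o.Fits (atOf edge σ₀) D (if o.sw then v else u) (if o.sw then u else v)
      e w ∧ σ₀.nat 1 (edge.symm e) (if o.d then 1 else 0) = ((if o.sw then v else u : Fin N) : ℕ) ∧
      σ₀.nat 1 (edge.symm e) (if o.d then 0 else 1) = w := by
  obtain ⟨x, hx⟩ : ∃ x, (if o.sw then v else u) = x := ⟨_, rfl⟩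
  obtain ⟨y, hy⟩ : ∃ y, (if o.sw then u else v) = y := ⟨_, rfl⟩
  rw [hx, hy]
  have ex : o.near_reg.eval σ = x := by
    rw [← hx]; cases hs : o.sw <;> simp [Op.near_reg, hs, h.left, h.right]
  have ey : o.far_reg.eval σ = y := by
    rw [← hy]; cases hs : o.sw <;> simp [Op.far_reg, hs, h.left, h.right]
  have h1 := h.nat 1 (by omega)
  have h2 := h.nat 2 (by omega)
  have h3 := h.nat 3 (by omega)
  have hdone : ∀ e : G.edgeSet, σ.nat 8 (edge.symm e) 0 = 0 ↔ e ∉ D := fun e =>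
    ⟨fun h0 hD => by simp [h.done e hD] at h0, h.todo e⟩
  -- The test inspects only positions other than `o.j`. This is enough because the incidence list
  -- shows every edge at `x` exactly once.
  have hlast : ∀ e, atOf edge σ₀ x o.j e → ((∀ i : Fin 3, i ≠ o.j →
      ¬ ((i : ℕ) + 1 ≤ σ₀.nat 2 x 0 ∧ σ.nat 8 (σ₀.nat 3 x i) 0 = 0)) ↔
      ∀ f : G.edgeSet, x ∈ (f : Sym2 (Fin N)) → f ≠ e → f ∈ D) := by
    intro e he
    constructor
    · intro hi f hf hfe
      by_contra hfD
      obtain ⟨i, hif⟩ := hp.incidence.exists_of_mem hf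
      refine hi i ?_ ⟨hif.1, by rw [hif.2]; exact h.todo f hfD⟩
      rintro rfl
      exact hfe (hp.incidence.edge_unique hif he)
    · rintro hf i hi ⟨hi1, hi2⟩
      obtain ⟨f, hif⟩ := hp.pos x i hi1
      rw [hif.2, hdone] at hi2
      refine hi2 (hf f (hp.incidence.mem hif) ?_)
      rintro rfl
      exact hi (hp.incidence.pos_unique hif he)
  have etest : o.test.eval σ ↔ ((o.j : ℕ) + 1 ≤ σ₀.nat 2 x 0 ∧
      σ.nat 8 (σ₀.nat 3 x o.j) 0 = 0 ∧
      σ₀.nat 1 (σ₀.nat 3 x o.j) (if o.d then 1 else 0) = x ∧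
      (o.j' : ℕ) + 1 ≤ σ₀.nat 2 (σ₀.nat 1 (σ₀.nat 3 x o.j) (if o.d then 0 else 1)) 0 ∧
      σ₀.nat 3 (σ₀.nat 1 (σ₀.nat 3 x o.j) (if o.d then 0 else 1)) o.j' = σ₀.nat 3 x o.j) ∧
      (if o.rung then σ₀.nat 1 (σ₀.nat 3 x o.j) (if o.d then 0 else 1) = (y : ℕ) else
        σ₀.nat 1 (σ₀.nat 3 x o.j) (if o.d then 0 else 1) ≠ (y : ℕ) ∧ ∀ i : Fin 3, i ≠ o.j →
          ¬ ((i : ℕ) + 1 ≤ σ₀.nat 2 x 0 ∧ σ.nat 8 (σ₀.nat 3 x i) 0 = 0)) := by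
    rw [Op.test, BExp.eval_all, List.forall_mem_append]
    refine and_congr ?_ ?_
    · simp only [List.forall_mem_cons, BExp.eval, NExp.eval, ex, Op.edgeExp, Op.endExp,
        h1, h2, h3, List.not_mem_nil, false_imp_iff, implies_true, and_true]
    · cases o.rung
      · simp only [Bool.false_eq_true, if_false, List.forall_mem_cons, BExp.eval, NExp.eval, ex, ey,
          Op.edgeExp, Op.endExp, h1, h2, h3, List.forall_mem_map, List.mem_filter,
          List.mem_finRange, true_and, decide_eq_true_eq, ne_eq]
      · simp only [if_true, List.forall_mem_cons, BExp.eval, NExp.eval, ex, ey,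
          Op.edgeExp, Op.endExp, h1, h3, List.not_mem_nil, false_imp_iff, implies_true,
          and_true]
  rw [etest]
  constructor
  · rintro ⟨⟨t1, t2, t3, t4, t5⟩, t6⟩
    obtain ⟨e, he⟩ := hp.pos x o.j t1
    rw [he.2] at t2 t3 t4 t5 t6
    obtain ⟨w, hw, hew⟩ := hp.end_eq t3
    rw [hw] at t4 t5 t6
    refine ⟨e, w, ⟨(hdone e).1 t2, hew, he, ⟨t4, t5⟩, fun hr => ?_, fun hr => ?_⟩, t3, hw⟩
    · rw [hr, if_pos rfl] at t6
      exact Fin.ext t6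
    · rw [hr] at t6
      simp only [Bool.false_eq_true, if_false] at t6
      exact ⟨fun hwy => t6.1 (by rw [hwy]), (hlast e he).1 t6.2⟩
  · rintro ⟨e, w, ⟨hnew, hends, hleft, hright, hrung, hadv⟩, hd1, hd2⟩
    rw [hleft.2, hd2]
    refine ⟨⟨hleft.1, (hdone e).2 hnew, hd1, hright.1, hright.2⟩, ?_⟩
    cases hr : o.rung with
    | true => simpa using congrArg Fin.val (hrung hr)
    | false =>
      obtain ⟨hwy, hl⟩ := hadv hr
      simp only [Bool.false_eq_true, if_false]
      exact ⟨fun hh => hwy (Fin.ext hh), (hlast e hleft).2 hl⟩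

end Sweep

end LadderTrees

namespace LadderTrees

/-! ### One operation of the sweep, executed on the machine. -/

section OpStep

variable {N m : ℕ} {G : SimpleGraph (Fin N)} {edge : Fin m ≃ G.edgeSet}
  {S : Finset (Sym2 G.edgeSet)} {σ₀ σ : Store} {D : Finset G.edgeSet} {u v w : Fin N} {o : Op}
  {e : G.edgeSet}

theorem Op.exec_load (o : Op) (σ : Store) (a : ℕ) (ha : a ∉ [13, 14, 16, 17, 18]) :
    (o.load.exec σ).nat a = σ.nat a := by
  simp only [List.mem_cons, List.not_mem_nil, or_false, not_or] at ha
  funext i j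
  cases h : o.sw <;> simp [Op.load, h, ha]

theorem Op.exec_load_real (o : Op) (σ : Store) : (o.load.exec σ).real = σ.real := by
  cases h : o.sw <;> simp [Op.load, h]

theorem SweepState.exec_load (h : SweepState edge σ₀ D u v σ)
    (ho : o.Fits (atOf edge σ₀) D (if o.sw then v else u) (if o.sw then u else v) e w)
    (hw : σ₀.nat 1 (edge.symm e) (if o.d then 0 else 1) = w) :
    SweepState edge σ₀ D (if o.sw then v else u) (if o.sw then u else v) (o.load.exec σ) ∧
      Loaded edge (atOf edge σ₀) (if o.sw then v else u) (if o.sw then u else v) e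
        (o.load.exec σ) ∧ (o.load.exec σ).nat 17 0 0 = w := by
  have hn := o.exec_load σ
  have h3 := h.nat 3 (by omega)
  have h1 := h.nat 1 (by omega)
  have hl := ho.left.2
  have e13 : (o.load.exec σ).nat 13 0 0 = ((if o.sw then v else u : Fin N) : ℕ) := by
    cases hs : o.sw <;> simp [Op.load, hs, h.left, h.right]
  have e14 : (o.load.exec σ).nat 14 0 0 = ((if o.sw then u else v : Fin N) : ℕ) := by
    cases hs : o.sw <;> simp [Op.load, hs, h.left, h.right]
  have e16 : (o.load.exec σ).nat 16 0 0 = edge.symm e := by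
    rw [← hl]
    cases hs : o.sw <;> simp [Op.load, hs, h.left, h.right, h3]
  have e17 : (o.load.exec σ).nat 17 0 0 = w := by
    rw [← hw, ← hl]
    cases hs : o.sw <;> simp [Op.load, hs, h.left, h.right, h3, h1]
  refine ⟨⟨fun a ha => ?_, fun a ha => ?_, e13, e14, ?_, fun f hf => ?_, fun f hf => ?_,
    fun i c hi => ?_⟩, ⟨e13, e14, e16, fun x j f hf => ?_⟩, e17⟩
  · rw [hn a (by simp; omega), h.nat a ha]
  · rw [o.exec_load_real, h.real a ha]
  · rw [hn 15 (by simp), h.count]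
  · rw [hn 8 (by simp), h.done f hf]
  · rw [hn 8 (by simp), h.todo f hf]
  · rw [hn 9 (by simp), h.empty i c hi]
  · rw [hn 3 (by simp), h3]; exact hf.2

/-- Every position in `o.near s` holds an edge of `T`, so the program looks up genuine edge numbers
in the conflict table; and every edge of `T` that could conflict with `e` is at such a position. -/
theorem okExp_eval (hp : Prepared edge S σ₀) (hS : AdjacentConflicts G S) {A : Finset (Fin N)}
    {T : Finset G.edgeSet} {s : St} (hF : Frontier A D u v)
    (ho : o.Fits (atOf edge σ₀) D u v e w) (hR : Rep (atOf edge σ₀) S A D u v (o.pre s) T)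
    (hl : Loaded edge (atOf edge σ₀) u v e σ) (h7 : σ.nat 7 = σ₀.nat 7) (b : Bool) :
    (okExp o s b).eval σ ↔ (b = true → ∀ f ∈ T, s(e, f) ∉ S) := by
  cases b with
  | false => simp [okExp, BExp.tt]
  | true =>
    simp only [true_imp_iff]
    rw [← ho.free_iff hS hp.incidence hF hR]
    simp only [okExp, BExp.eval_all, List.forall_mem_map, BExp.eval, NExp.eval, NExp.reg,
      hl.edge_eq, h7]
    refine forall₂_congr fun p hpn => ⟨fun h f hf => ?_, fun h => ?_⟩
    · rwa [hl.eval_posExp hf, hp.conflict] at h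
    · obtain ⟨f, -, hf⟩ := hR.exists_of_near hpn
      rw [hl.eval_posExp hf, hp.conflict]
      exact h f hf

theorem Mode.value_addIf [DecidableEq G.edgeSet] {M : Mode} {obj : Finset G.edgeSet → ℝ}
    (hM : M.Correct edge obj (σ₀.real 0)) (hp : Prepared edge S σ₀) {A : Finset (Fin N)}
    {T : Finset G.edgeSet} {s : St} (hF : Frontier A D u v)
    (ho : o.Fits (atOf edge σ₀) D u v e w) (hR : Rep (atOf edge σ₀) S A D u v (o.pre s) T)
    (hl : Loaded edge (atOf edge σ₀) u v e σ) (h0 : σ.real 0 = σ₀.real 0) (b : Bool) :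
    M.value o s σ b (obj T) = obj (addIf b e T) := by
  cases b with
  | false => rfl
  | true => exact hM.insert hp.incidence hF ho hR hl h0

/-- An operation takes the sweep to its next configuration. -/
theorem SweepState.exec_opProg [DecidableEq G.edgeSet] {M : Mode} {obj : Finset G.edgeSet → ℝ}
    (hM : M.Correct edge obj (σ₀.real 0)) (hp : Prepared edge S σ₀) (hS : AdjacentConflicts G S)
    {A : Finset (Fin N)} (h : SweepState edge σ₀ D u v σ) (hF : Frontier A D u v)
    (hT : TableCorrect edge obj D.card (Rep (atOf edge σ₀) S A D u v) σ)
    (ho : o.Fits (atOf edge σ₀) D (if o.sw then v else u) (if o.sw then u else v) e w)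
    (hw : σ₀.nat 1 (edge.symm e) (if o.d then 0 else 1) = w) :
    ∃ (A' : Finset (Fin N)) (u' v' : Fin N), u' = (if o.rung then if o.sw then v else u else w) ∧
      v' = (if o.sw then u else v) ∧ Frontier A' (insert e D) u' v' ∧
      SweepState edge σ₀ (insert e D) u' v' ((M.opProg o).exec σ) ∧
      TableCorrect edge obj (insert e D).card (Rep (atOf edge σ₀) S A' (insert e D) u' v')
        ((M.opProg o).exec σ) := by
  obtain ⟨h1, hl, h17⟩ := h.exec_load ho hw
  have hcard : (insert e D).card = D.card + 1 := Finset.card_insert_of_notMem ho.new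
  have hn := o.exec_load σ
  have hreal := o.exec_load_real σ
  obtain ⟨x, hx⟩ : ∃ x, (if o.sw then v else u) = x := ⟨_, rfl⟩
  obtain ⟨y, hy⟩ : ∃ y, (if o.sw then u else v) = y := ⟨_, rfl⟩
  rw [hx, hy] at ho h1 hl
  have hF' : Frontier A D x y := by
    rw [← hx, ← hy]
    cases o.sw
    · exact hF
    · exact hF.swap
  have hRep : ∀ s T, Rep (atOf edge σ₀) S A D u v s T ↔
      Rep (atOf edge σ₀) S A D x y (o.pre s) T := by
    intro s T
    rw [← hx, ← hy]
    cases hs : o.sw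
    · simp [Op.pre, hs]
    · simp only [Op.pre, hs, if_true]
      exact ⟨fun h => h.swap, fun h => h.swap⟩
  obtain ⟨A', hA', hsound, hcomplete⟩ := ho.step hp.incidence hS hF'
  rw [hx, hy]
  refine ⟨A', _, _, rfl, rfl, hA', ?_⟩
  set σ₁ := o.load.exec σ with hσ₁
  set σ₂ := (layerProg (M.transitions o)).exec σ₁ with hσ₂
  have hexec : (M.opProg o).exec σ = o.finish.exec σ₂ := rfl
  have hcnt : σ₁.nat 15 0 0 = D.card := h1.count
  have hLD : LayerDone σ₁ (M.transitions o) σ₂ := by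
    refine exec_layerProg (fun t ht => ?_) fun c => h1.empty _ c (by omega)
    obtain ⟨s, b, s', -, rfl⟩ := Mode.mem_transitions.1 ht
    exact M.valid_trans _ _ _ _
  obtain ⟨hfr, hds, hdc⟩ := hLD
  rw [hcnt] at hfr hds hdc
  have e16 : σ₂.nat 16 0 0 = edge.symm e := by rw [hfr.nat _ _ _ (by omega), hl.edge_eq]
  have e15 : σ₂.nat 15 0 0 = D.card := by rw [hfr.nat _ _ _ (by omega), hcnt]
  have e17 : σ₂.nat 17 0 0 = w := by rw [hfr.nat _ _ _ (by omega), h17]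
  have e13 : σ₂.nat 13 0 0 = x := by rw [hfr.nat _ _ _ (by omega), h1.left]
  have e14 : σ₂.nat 14 0 0 = y := by rw [hfr.nat _ _ _ (by omega), h1.right]
  rw [hexec]
  have hfin : ∀ a i j, a ∉ [8, 12, 13, 15] → (o.finish.exec σ₂).nat a i j = σ₂.nat a i j := by
    intro a i j ha
    simp only [List.mem_cons, List.not_mem_nil, or_false, not_or] at ha
    cases hr : o.rung <;> simp [Op.finish, hr, ha]
  have hfr' : ∀ a i j, (o.finish.exec σ₂).real a i j = σ₂.real a i j := by
    intro a i j
    cases hr : o.rung <;> simp [Op.finish, hr]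
  have hf8 : ∀ i, (o.finish.exec σ₂).nat 8 i 0 =
      if i = edge.symm e then 1 else σ₂.nat 8 i 0 := by
    intro i
    cases hr : o.rung <;> simp [Op.finish, hr, e16]
  have hf12 : ∀ i j, (o.finish.exec σ₂).nat 12 i j =
      if i = D.card + 1 ∧ j = 0 then (edge.symm e : ℕ) else σ₂.nat 12 i j := by
    intro i j
    cases hr : o.rung <;> simp [Op.finish, hr, e15, e16]
  refine ⟨⟨fun a ha => ?_, fun a ha => ?_, ?_, ?_, ?_, fun f hf => ?_, fun f hf => ?_,
    fun i c hi => ?_⟩, ⟨fun c hc => ?_, fun s' T' hR' => ?_⟩⟩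
  · funext i j
    rw [hfin a i j (by simp; omega), hfr.nat a i j (by omega), h1.nat a ha]
  · funext i j
    rw [hfr', hfr.real a i j (by omega) (by omega), h1.real a ha]
  · cases hr : o.rung <;> simp [Op.finish, hr, e13, e17]
  · rw [hfin _ _ _ (by simp), e14]
  · rw [hcard]
    cases hr : o.rung <;> simp [Op.finish, hr, e15]
  · rw [hf8]
    by_cases hfe : f = e
    · simp [hfe]
    · rw [if_neg fun h' => hfe (edge.symm.injective (Fin.ext h')), hfr.nat _ _ _ (by omega)]
      exact h1.done f (by simpa [hfe] using hf)
  · rw [Finset.mem_insert, not_or] at hf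
    rw [hf8, if_neg fun h' => hf.1 (edge.symm.injective (Fin.ext h')), hfr.nat _ _ _ (by omega)]
    exact h1.todo f hf.2
  · rw [hfin _ _ _ (by simp), hfr.nat _ _ _ (by omega)]
    exact h1.empty i c (by omega)
  -- Soundness: an entry of the new layer comes from a transition out of an entry of the old one,
  -- and the set `T` behind that entry, with or without `e`, lies behind the new entry.
  · rw [hcard] at hc ⊢
    rw [hfin _ _ _ (by simp)] at hc
    obtain ⟨t, ht, htc, ⟨happ, hok⟩, hval, hpb, hub⟩ := hds c hc
    obtain ⟨s, b, s', hnext, rfl⟩ := Mode.mem_transitions.1 ht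
    simp only [Mode.trans] at htc happ hok hval hpb hub
    rw [hcnt, hn 9 (by simp)] at happ
    obtain ⟨s₁, T, hs₁, hR, hv, htr⟩ := hT.sound _ happ
    obtain rfl := St.code_injective hs₁
    rw [hRep] at hR
    have hfree := (okExp_eval hp hS hF' ho hR hl (h1.nat 7 le_rfl) b).1 hok
    refine ⟨s', addIf b e T, htc.symm, hsound s T b s' hR hnext hfree, ?_, fun f => ?_⟩
    · rw [hfr', hval, hcnt, hreal, hv]
      exact Mode.value_addIf hM hp hF' ho hR hl (h1.real 0 (by omega)) b
    -- In the arrays read by `trace` the operation writes only row `D.card + 1`, so the trace of the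
    -- previous state is unchanged.
    · have htr' : trace (o.finish.exec σ₂) D.card s.code = trace σ D.card s.code := by
        refine trace_congr (fun a i' c' ha1 ha2 hi' => ?_) _
        by_cases ha : a = 12
        · subst ha
          rw [hf12, if_neg (by omega), hfr.nat _ _ _ (by omega), hn 12 (by simp)]
        · rw [hfin _ _ _ (by simp; omega), hfr.nat _ _ _ (by omega), hn a (by simp; omega)]
      rw [trace, hfin 11 _ _ (by simp), hfin 10 _ _ (by simp), hf12, hpb, hub, htr']
      cases b with
      | false => simp [addIf, htr]
      | true =>
        have hfe : f = e ↔ (edge.symm f : ℕ) = edge.symm e :=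
          ⟨fun h' => by rw [h'], fun h' => edge.symm.injective (Fin.ext h')⟩
        simp [addIf, htr, hfe]
  -- Completeness: the old entry is at most the value of the set `T` from which `T'` arises, and
  -- monotonicity carries this inequality through the transition.
  · rw [hcard]
    obtain ⟨s, b, T, hR, hnext, rfl, hfree⟩ := hcomplete s' T' hR'
    obtain ⟨hf1, hf2⟩ := hT.complete s T ((hRep s T).2 hR)
    have hok := (okExp_eval hp hS hF' ho hR hl (h1.nat 7 le_rfl) b).2 hfree
    have := hdc (M.trans o s s' b) (Mode.mem_transitions.2 ⟨s, b, s', hnext, rfl⟩)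
      ⟨by rw [hcnt, hn 9 (by simp)]; exact hf1, hok⟩
    simp only [Mode.trans] at this
    rw [hfin _ _ _ (by simp), hfr']
    refine ⟨this.1, this.2.trans ?_⟩
    rw [← Mode.value_addIf hM hp hF' ho hR hl (h1.real 0 (by omega)) b]
    refine M.value_mono o s σ₁ b ?_
    rw [hcnt, hreal]
    exact hf2

end OpStep

end LadderTrees

namespace LadderTrees

/-! ## The sweep as a process on graphs -/

section SweepStep

variable {V : Type}

/-- In the set `U` of unprocessed edges there is only one at `u`, and its other end is `w ≠ v`. -/
def CanAdvance (u v w : V) (U : Set (Sym2 V)) : Prop :=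
  w ≠ v ∧ s(u, w) ∈ U ∧ ∀ x, s(u, x) ∈ U → x = w

/-- One step of the sweep with frontier `u`, `v` and set `U` of unprocessed edges. -/
inductive SweepStep : V × V × Set (Sym2 V) → V × V × Set (Sym2 V) → Prop
  | rung {u v : V} {U : Set (Sym2 V)} (h : s(u, v) ∈ U) :
      SweepStep (u, v, U) (u, v, U \ {s(u, v)})
  | advance {u v w : V} {U : Set (Sym2 V)} (h : CanAdvance u v w U) :
      SweepStep (u, v, U) (w, v, U \ {s(u, w)})
  | swap {u v w : V} {U : Set (Sym2 V)} (h₀ : s(u, v) ∉ U) (h₁ : ∀ w, ¬ CanAdvance u v w U)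
      (h : CanAdvance v u w U) : SweepStep (u, v, U) (w, u, U \ {s(v, w)})

theorem CanAdvance.notMem {u v w : V} {U : Set (Sym2 V)} (h : CanAdvance u v w U) :
    s(u, v) ∉ U := fun h' => h.1 (h.2.2 v h').symm

theorem CanAdvance.eq {u v w w' : V} {U : Set (Sym2 V)} (h : CanAdvance u v w U)
    (h' : CanAdvance u v w' U) : w = w' := h'.2.2 w h.2.1

/-- A rung excludes an advance of `u`, and an exchange requires that neither is possible. By
uniqueness the program cannot stray from a sweep that is known to process all edges. -/
theorem SweepStep.unique {X Y Z : V × V × Set (Sym2 V)} (h : SweepStep X Y)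
    (h' : SweepStep X Z) : Y = Z := by
  cases h with
  | rung h =>
    cases h' with
    | rung h' => rfl
    | advance h' => exact absurd h h'.notMem
    | swap h₀ h₁ h' => exact absurd h h₀
  | advance h =>
    cases h' with
    | rung h' => exact absurd h' h.notMem
    | advance h' => obtain rfl := h.eq h'; rfl
    | swap h₀ h₁ h' => exact absurd h (h₁ _)
  | swap h₀ h₁ h =>
    cases h' with
    | rung h' => exact absurd h' h₀
    | advance h' => exact absurd h' (h₁ _)
    | swap _ _ h' => obtain rfl := h.eq h'; rfl

/-- The sweep processes all the edges. -/
def Completes (X : V × V × Set (Sym2 V)) : Prop :=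
  ∃ Y, Relation.ReflTransGen SweepStep X Y ∧ Y.2.2 = ∅

theorem Completes.of_reaches {X Y : V × V × Set (Sym2 V)}
    (h : Relation.ReflTransGen SweepStep X Y) (hY : Completes Y) : Completes X :=
  ⟨hY.choose, h.trans hY.choose_spec.1, hY.choose_spec.2⟩

theorem Completes.exists_step {X : V × V × Set (Sym2 V)} (h : Completes X) (hX : X.2.2 ≠ ∅) :
    ∃ Y, SweepStep X Y := by
  obtain ⟨Y, hXY, hY⟩ := h
  rcases Relation.ReflTransGen.cases_head hXY with rfl | ⟨Z, hZ, -⟩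
  · exact absurd hY hX
  · exact ⟨Z, hZ⟩

theorem Completes.of_step {X Z : V × V × Set (Sym2 V)} (h : Completes X) (hZ : SweepStep X Z) :
    Completes Z := by
  obtain ⟨Y, hXY, hY⟩ := h
  rcases Relation.ReflTransGen.cases_head hXY with rfl | ⟨Z', hZ', hZY⟩
  · exfalso
    cases hZ with
    | rung h => simp only at hY; simp [hY] at h
    | advance h => simp only at hY; simpa [hY] using h.2.1
    | swap _ _ h => simp only at hY; simpa [hY] using h.2.1
  · obtain rfl := hZ.unique hZ'
    exact ⟨Y, hZY, hY⟩

/-- The edges outside `D`. -/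
def remaining {G : SimpleGraph V} (D : Finset G.edgeSet) : Set (Sym2 V) :=
  {x | ∃ e : G.edgeSet, e ∉ D ∧ (e : Sym2 V) = x}

theorem remaining_empty (G : SimpleGraph V) : remaining (∅ : Finset G.edgeSet) = G.edgeSet := by
  ext x
  simp only [remaining, Finset.notMem_empty, not_false_eq_true, true_and, Set.mem_ofPred_eq]
  exact ⟨fun ⟨e, he⟩ => he ▸ e.2, fun h => ⟨⟨x, h⟩, rfl⟩⟩

theorem remaining_insert {G : SimpleGraph V} [DecidableEq G.edgeSet] (D : Finset G.edgeSet)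
    (e : G.edgeSet) : remaining (insert e D) = remaining D \ {(e : Sym2 V)} := by
  ext x
  simp only [remaining, Finset.mem_insert, not_or, Set.mem_ofPred_eq, Set.mem_sdiff,
    Set.mem_singleton_iff]
  constructor
  · rintro ⟨f, ⟨h1, h2⟩, rfl⟩
    exact ⟨⟨f, h2, rfl⟩, fun h => h1 (Subtype.ext h)⟩
  · rintro ⟨⟨f, h2, rfl⟩, h1⟩
    exact ⟨f, ⟨fun h => h1 (congrArg _ h), h2⟩, rfl⟩

end SweepStep

/-! ### The loop of the program follows the sweep on the graph. -/

section SweepLoop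

variable {N m : ℕ} {G : SimpleGraph (Fin N)} {edge : Fin m ≃ G.edgeSet}
  {S : Finset (Sym2 G.edgeSet)} {σ₀ σ : Store} {D : Finset G.edgeSet} {u v w : Fin N} {o : Op}
  {e : G.edgeSet}

theorem Op.Fits.rung_mem {At : Fin N → Fin 3 → G.edgeSet → Prop} (ho : o.Fits At D u v e w)
    (hr : o.rung = true) : s(u, v) ∈ remaining D :=
  ⟨e, ho.new, by rw [ho.ends, ho.rung hr]⟩

theorem Op.Fits.canAdvance {At : Fin N → Fin 3 → G.edgeSet → Prop} (ho : o.Fits At D u v e w)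
    (hr : o.rung = false) : CanAdvance u v w (remaining D) := by
  obtain ⟨h1, h2⟩ := ho.advance hr
  refine ⟨h1, ⟨e, ho.new, ho.ends⟩, ?_⟩
  rintro x ⟨f, hf, hfx⟩
  by_contra hxw
  refine hf (h2 f (by rw [hfx]; simp) ?_)
  rintro rfl
  rw [ho.ends] at hfx
  exact hxw (Sym2.congr_right.1 hfx).symm

theorem SweepState.exists_test_of_rung (h : SweepState edge σ₀ D u v σ) (hp : Prepared edge S σ₀)
    (hr : s(u, v) ∈ remaining D) : ∃ o : Op, o.sw = false ∧ o.test.eval σ := by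
  obtain ⟨e, he, hee⟩ := hr
  obtain ⟨j, hj⟩ := hp.incidence.exists_of_mem (v := u) (e := e) (by simp [hee])
  obtain ⟨j', hj'⟩ := hp.incidence.exists_of_mem (v := v) (e := e) (by simp [hee])
  obtain ⟨d, hd1, hd2⟩ := hp.exists_dir hee
  exact ⟨⟨false, true, d, j, j'⟩, rfl, (h.test_iff hp).2 ⟨e, v,
    ⟨he, hee, hj, hj', fun _ => rfl, by simp⟩, hd1, hd2⟩⟩

theorem SweepState.exists_test_of_canAdvance (h : SweepState edge σ₀ D u v σ)
    (hp : Prepared edge S σ₀) (b : Bool)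
    (ha : CanAdvance (if b then v else u) (if b then u else v) w (remaining D)) :
    ∃ o : Op, o.sw = b ∧ o.test.eval σ := by
  obtain ⟨hwv, ⟨e, he, hee⟩, hlast⟩ := ha
  obtain ⟨j, hj⟩ := hp.incidence.exists_of_mem (v := if b then v else u) (e := e) (by simp [hee])
  obtain ⟨j', hj'⟩ := hp.incidence.exists_of_mem (v := w) (e := e) (by simp [hee])
  obtain ⟨d, hd1, hd2⟩ := hp.exists_dir hee
  refine ⟨⟨b, false, d, j, j'⟩, rfl, (h.test_iff hp).2 ⟨e, w,
    ⟨he, hee, hj, hj', by simp, fun _ => ⟨hwv, fun f hf hfe => ?_⟩⟩, hd1, hd2⟩⟩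
  by_contra hfD
  obtain ⟨x, hx⟩ := Sym2.mem_iff_exists.1 hf
  have := hlast x ⟨f, hfD, hx⟩
  rw [this, ← hee] at hx
  exact hfe (Subtype.ext hx)

theorem mem_allOps (o : Op) : o ∈ allOps := by
  cases h : o.sw <;> simp [allOps, h]

/-- This is the purpose of the order in `allOps`: if the first successful test belongs to an
operation with an exchange, then all operations without one have been tested and have failed. -/
theorem mem_of_allOps_eq {l₁ l₂ : List Op} (h : allOps = l₁ ++ o :: l₂) (ho : o.sw = true)
    {o' : Op} (ho' : o'.sw = false) : o' ∈ l₁ := by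
  have hmem : o' ∈ (Finset.univ : Finset Op).toList.filter (fun o => !o.sw) := by simp [ho']
  rcases List.append_eq_append_iff.1 h with ⟨c, hc, -⟩ | ⟨c, hc, hc'⟩
  · rw [hc]; simp [ho']
  · rcases c with _ | ⟨o₁, c⟩
    · rw [hc] at hmem; simpa using hmem
    · obtain ⟨rfl, -⟩ := List.cons_eq_cons.1 hc'
      have : o ∈ (Finset.univ : Finset Op).toList.filter (fun o => !o.sw) := by rw [hc]; simp
      simp [ho] at this

/-- The body of the loop makes one step of the sweep. -/
theorem SweepState.exec_body [DecidableEq G.edgeSet] {M : Mode} {obj : Finset G.edgeSet → ℝ}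
    (hM : M.Correct edge obj (σ₀.real 0)) (hp : Prepared edge S σ₀) (hS : AdjacentConflicts G S)
    {A : Finset (Fin N)} (h : SweepState edge σ₀ D u v σ) (hF : Frontier A D u v)
    (hT : TableCorrect edge obj D.card (Rep (atOf edge σ₀) S A D u v) σ)
    (hstep : ∃ Y, SweepStep (u, v, remaining D) Y) :
    ∃ (A' : Finset (Fin N)) (e : G.edgeSet) (u' v' : Fin N), e ∉ D ∧
      SweepStep (u, v, remaining D) (u', v', remaining (insert e D)) ∧
      Frontier A' (insert e D) u' v' ∧
      SweepState edge σ₀ (insert e D) u' v'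
        ((Program.firstMatch Op.test M.opProg allOps).exec σ) ∧
      TableCorrect edge obj (insert e D).card (Rep (atOf edge σ₀) S A' (insert e D) u' v')
        ((Program.firstMatch Op.test M.opProg allOps).exec σ) := by
  have hex : ∃ o ∈ allOps, o.test.eval σ := by
    obtain ⟨Y, hY⟩ := hstep
    cases hY with
    | rung h' =>
      obtain ⟨o, -, ho⟩ := h.exists_test_of_rung hp h'
      exact ⟨o, mem_allOps o, ho⟩
    | advance h' =>
      obtain ⟨o, -, ho⟩ := h.exists_test_of_canAdvance hp false h'
      exact ⟨o, mem_allOps o, ho⟩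
    | swap _ _ h' =>
      obtain ⟨o, -, ho⟩ := h.exists_test_of_canAdvance hp true h'
      exact ⟨o, mem_allOps o, ho⟩
  obtain ⟨o, l₁, l₂, hl, hotest, hno, hexec⟩ := Program.exec_firstMatch (f := M.opProg) hex
  obtain ⟨e, w, ho, hd1, hd2⟩ := (h.test_iff hp).1 hotest
  obtain ⟨A', u', v', hu', hv', h1, h2, h3⟩ := h.exec_opProg hM hp hS hF hT ho hd2
  rw [hexec]
  refine ⟨A', e, u', v', ho.new, ?_, h1, h2, h3⟩
  rw [remaining_insert, ho.ends, hu', hv']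
  cases hsw : o.sw with
  | false =>
    simp only [hsw, Bool.false_eq_true, if_false] at ho ⊢
    cases hr : o.rung with
    | true =>
      obtain rfl := ho.rung hr
      exact .rung (ho.rung_mem hr)
    | false => exact .advance (ho.canAdvance hr)
  | true =>
    simp only [hsw, if_true] at ho ⊢
    have hnr : s(u, v) ∉ remaining D := fun h' => by
      obtain ⟨o', hs', ht'⟩ := h.exists_test_of_rung hp h'
      exact hno o' (mem_of_allOps_eq hl hsw hs') ht'
    have hna : ∀ w, ¬ CanAdvance u v w (remaining D) := fun w h' => by
      obtain ⟨o', hs', ht'⟩ := h.exists_test_of_canAdvance hp false h'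
      exact hno o' (mem_of_allOps_eq hl hsw hs') ht'
    cases hr : o.rung with
    | true =>
      have := ho.rung_mem hr
      rw [Sym2.eq_swap] at this
      exact absurd this hnr
    | false => exact .swap hnr hna (ho.canAdvance hr)

/-- The sweep, started in a configuration from which all edges can be processed, processes
them and computes the whole table. -/
theorem SweepState.ensures [DecidableEq G.edgeSet] {M : Mode} {obj : Finset G.edgeSet → ℝ}
    (hM : M.Correct edge obj (σ₀.real 0)) (hp : Prepared edge S σ₀) (hS : AdjacentConflicts G S)
    {A : Finset (Fin N)} (h : SweepState edge σ₀ D u v σ) (hF : Frontier A D u v)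
    (hT : TableCorrect edge obj D.card (Rep (atOf edge σ₀) S A D u v) σ)
    (hC : Completes (u, v, remaining D)) :
    M.sweepProg.Ensures σ
      ((m - D.card) * ((Program.firstMatch Op.test M.opProg allOps).cost + 8 + 1) + 8 + 1)
      fun τ => ∃ A D u v, (∀ e : G.edgeSet, e ∈ D) ∧ D.card = m ∧ Frontier A D u v ∧
        SweepState edge σ₀ D u v τ ∧
        TableCorrect edge obj D.card (Rep (atOf edge σ₀) S A D u v) τ := by
  let _ : Fintype G.edgeSet := Fintype.ofEquiv _ edge
  have hcardE : Fintype.card G.edgeSet = m := by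
    rw [← Fintype.card_congr edge, Fintype.card_fin]
  have hle : ∀ D : Finset G.edgeSet, D.card ≤ m := fun D => by
    rw [← hcardE]; exact Finset.card_le_univ D
  refine (Program.Ensures.loop_count (Program.firstMatch Op.test M.opProg allOps).cost
    (fun i σ => ∃ A D u v, i = m - D.card ∧ Frontier A D u v ∧ SweepState edge σ₀ D u v σ ∧
      TableCorrect edge obj D.card (Rep (atOf edge σ₀) S A D u v) σ ∧
      Completes (u, v, remaining D)) ?_ ⟨A, D, u, v, rfl, hF, h, hT, hC⟩).mono (by rfl) ?_
  · rintro i σ ⟨A, D, u, v, rfl, hF, h, hT, hC⟩ hb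
    have hlt : D.card ≠ m := by
      simpa [h.count, h.nat 0, hp.numEdges] using hb
    have hne : remaining D ≠ ∅ := by
      intro h0
      refine hlt (le_antisymm (hle D) ?_)
      rw [← hcardE, ← Finset.card_univ]
      refine Finset.card_le_card fun e _ => ?_
      by_contra he
      have : (e : Sym2 (Fin N)) ∈ remaining D := ⟨e, he, rfl⟩
      simp [h0] at this
    obtain ⟨A', e, u', v', he, hst, h1, h2, h3⟩ :=
      h.exec_body hM hp hS hF hT (hC.exists_step hne)
    have hc := Finset.card_insert_of_notMem he
    have := hle D
    refine ⟨m - (insert e D).card, by omega,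
      (Program.LoopFree.firstMatch fun o _ => M.loopFree_opProg o).ensures
      ⟨A', _, u', v', rfl, h1, h2, h3, hC.of_step hst⟩⟩
  · rintro τ ⟨_, ⟨A, D, u, v, rfl, hF, h, hT, hC⟩, hb⟩
    have heq : D.card = m := by
      simpa [h.count, h.nat 0, hp.numEdges] using hb
    refine ⟨A, D, u, v, fun e => ?_, heq, hF, h, hT⟩
    have : D = Finset.univ := Finset.eq_univ_of_card D (by rw [heq, hcardE])
    simp [this]

end SweepLoop

end LadderTrees

namespace LadderTrees

/-! ## The output -/

/-- The entry of a connected state is a candidate for the solution. -/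
noncomputable def finalTrans (s : St) : Trans where
  src := s.code
  -- All connected states compete for the single cell 0 of one additional layer, so that the
  -- relaxation procedure also finds the minimum over them.
  tgt := 0
  used := 0
  ok := .tt
  prog := .setReal 3 (.const 0) (.const 0) (oldValue s)
  value := (oldValue s).eval

theorem valid_finalTrans (s : St) : (finalTrans s).Valid :=
  ⟨trivial, fun _ => rfl, fun _ _ _ => by simp [finalTrans, BExp.tt], stable_oldValue s⟩

/-- All the connected states. -/
noncomputable def finalTransitions : List Trans :=
  ((Finset.univ : Finset St).toList.filter fun s => s.conn).map finalTrans

theorem mem_finalTransitions {t : Trans} :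
    t ∈ finalTransitions ↔ ∃ s : St, s.conn = true ∧ t = finalTrans s := by
  simp only [finalTransitions, List.mem_map, List.mem_filter, Finset.mem_toList, Finset.mem_univ,
    true_and]
  exact exists_congr fun s => and_congr_right fun _ => eq_comm

/-- One step back through the layers; the scalar 18 holds the code of the state. -/
def backStep : Program :=
  .seq [.branch (.natEq (.cell 11 (.reg 15) (.reg 18)) (.const 1))
      (.setNat 6 (.cell 12 (.reg 15) (.const 0)) (.const 0) (.const 1)) .skip,
    .setReg 18 (.cell 10 (.reg 15) (.reg 18)),
    .setReg 15 (.pred (.reg 15))]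

/-- Write the optimal value, and start the way back. -/
def announce : Program :=
  .seq [.setReg 5 (.const 1),
    .setReal 1 (.const 0) (.const 0) (.cell 2 (.succ (.reg 15)) (.const 0)),
    .setReg 18 (.cell 10 (.succ (.reg 15)) (.const 0))]

/-- Find the best connected state and write the solution. -/
noncomputable def outputProg : Program :=
  .comp (layerProg finalTransitions)
    (.branch (.natEq (.cell 9 (.succ (.reg 15)) (.const 0)) (.const 1))
      (.comp announce (.loop (.neg (.natEq (.reg 15) (.const 0))) backStep)) .skip)

theorem exec_backStep (σ : Store) : backStep.exec σ =
    ((if σ.nat 11 (σ.nat 15 0 0) (σ.nat 18 0 0) = 1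
      then σ.setNat 6 (σ.nat 12 (σ.nat 15 0 0) 0) 0 1 else σ).setNat 18 0 0
        (σ.nat 10 (σ.nat 15 0 0) (σ.nat 18 0 0))).setNat 15 0 0 (σ.nat 15 0 0 - 1) := by
  by_cases h : σ.nat 11 (σ.nat 15 0 0) (σ.nat 18 0 0) = 1 <;> simp [backStep, h]

/-- The way back through the layers marks the edges of the trace. -/
theorem ensures_backtrack {σ : Store} (h6 : ∀ x, σ.nat 6 x 0 = 0) :
    (Program.loop (.neg (.natEq (.reg 15) (.const 0))) backStep).Ensures σ
      (σ.nat 15 0 0 * (backStep.cost + 6 + 1) + 6 + 1) fun τ =>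
        τ.nat 5 0 0 = σ.nat 5 0 0 ∧ τ.real = σ.real ∧ ∀ x,
          (x ∈ trace σ (σ.nat 15 0 0) (σ.nat 18 0 0) → τ.nat 6 x 0 = 1) ∧
          (x ∉ trace σ (σ.nat 15 0 0) (σ.nat 18 0 0) → τ.nat 6 x 0 = 0) := by
  refine (Program.Ensures.loop_count backStep.cost
    (fun i τ => τ.nat 15 0 0 = i ∧ τ.nat 5 0 0 = σ.nat 5 0 0 ∧ τ.real = σ.real ∧
      (∀ a, 10 ≤ a → a ≤ 12 → τ.nat a = σ.nat a) ∧
      (∀ x, τ.nat 6 x 0 = 0 ∨ τ.nat 6 x 0 = 1) ∧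
      ∀ x, x ∈ trace σ (σ.nat 15 0 0) (σ.nat 18 0 0) ↔
        τ.nat 6 x 0 = 1 ∨ x ∈ trace σ i (τ.nat 18 0 0))
    ?_ ⟨rfl, rfl, rfl, fun _ _ _ => rfl, fun x => .inl (h6 x), fun x => by simp [h6]⟩).mono
    le_rfl ?_
  · rintro i τ ⟨hi, h5, hr, hf, h01, ht⟩ hb
    have hpos : i ≠ 0 := by simpa [hi] using hb
    obtain ⟨i, rfl⟩ := Nat.exists_eq_succ_of_ne_zero hpos
    have hlf : backStep.LoopFree := by simp [backStep, Program.seq]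
    refine ⟨i, by omega, hlf.ensures ?_⟩
    rw [exec_backStep, hi, hf 10 (by omega) (by omega), hf 11 (by omega) (by omega),
      hf 12 (by omega) (by omega)]
    rw [trace] at ht
    split_ifs with h11
    · refine ⟨by simp, by simp [h5], by simp [hr], fun a ha1 ha2 => ?_, fun x => ?_, fun x => ?_⟩
      · funext b c
        have h1 : a ≠ 6 := by omega
        have h2 : a ≠ 15 := by omega
        have h3 : a ≠ 18 := by omega
        simp [h1, h2, h3, hf a ha1 ha2]
      · by_cases hx : x = σ.nat 12 (i + 1) 0
        · simp [hx]
        · simpa [hx] using h01 x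
      · rw [ht]
        by_cases hx : x = σ.nat 12 (i + 1) 0
        · simp [hx, h11]
        · simp [hx]
    · refine ⟨by simp, by simp [h5], by simp [hr], fun a ha1 ha2 => ?_, fun x => ?_, fun x => ?_⟩
      · funext b c
        have h2 : a ≠ 15 := by omega
        have h3 : a ≠ 18 := by omega
        simp [h2, h3, hf a ha1 ha2]
      · simpa using h01 x
      · rw [ht]
        simp [h11]
  · rintro τ ⟨i, ⟨hi, h5, hr, hf, h01, ht⟩, hb⟩
    have hzero : i = 0 := by simpa [hi] using hb
    subst hzero
    refine ⟨h5, hr, fun x => ⟨fun hx => ?_, fun hx => ?_⟩⟩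
    · simpa [trace] using (ht x).1 hx
    · rcases h01 x with h | h
      · exact h
      · exact absurd ((ht x).2 (.inl h)) hx

section Output

variable {N m : ℕ} {G : SimpleGraph (Fin N)} {edge : Fin m ≃ G.edgeSet}
  {S : Finset (Sym2 G.edgeSet)} {σ₀ σ : Store} {D : Finset G.edgeSet} {u v : Fin N}

/-- Once all edges are processed and all vertices reached, the sets described by connected states
are exactly the feasible trees. -/
theorem isConflictFreeTree_iff {At : Fin N → Fin 3 → G.edgeSet → Prop}
    (hD : ∀ e : G.edgeSet, e ∈ D) (T : Finset G.edgeSet) :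
    IsConflictFreeTree G S T ↔ ∃ s : St, s.conn = true ∧ Rep At S Finset.univ D u v s T := by
  have : Nonempty (Fin N) := ⟨u⟩
  unfold IsConflictFreeTree
  rw [isSpanningTree_iff T u v]
  constructor
  · rintro ⟨h1, h2⟩
    exact exists_rep (fun e _ => hD e) true h1 fun e he f hf h => h2 e f h ⟨he, hf⟩
  · rintro ⟨s, hs, hR⟩
    refine ⟨?_, fun e f h hef => hR.free e hef.1 f hef.2 h⟩
    have := hR.spans
    rwa [hs] at this

/-- Every vertex lies on an edge and all edges are processed, so `A` is the whole vertex set. If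
cell 0 of the additional layer is blank, no connected state has an entry and the problem is
infeasible; otherwise following the back pointers marks an optimal tree. -/
theorem SweepState.ensures_output {obj : Finset G.edgeSet → ℝ} {A : Finset (Fin N)}
    {At : Fin N → Fin 3 → G.edgeSet → Prop}
    (h : SweepState edge σ₀ D u v σ) (hF : Frontier A D u v)
    (hT : TableCorrect edge obj D.card (Rep At S A D u v) σ)
    (hD : ∀ e : G.edgeSet, e ∈ D) (hm : D.card = m)
    (hcover : ∀ x : Fin N, ∃ e : G.edgeSet, x ∈ (e : Sym2 (Fin N)))
    (h5 : σ₀.nat 5 0 0 = 0) (h6 : ∀ x, σ₀.nat 6 x 0 = 0) :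
    outputProg.Ensures σ ((layerProg finalTransitions).cost + (8 +
        (announce.cost + (m * (backStep.cost + 6 + 1) + 6 + 1)) + 1))
      (HoldsSolution edge (IsConflictFreeTree G S) obj) := by
  obtain rfl : A = Finset.univ := by
    refine Finset.eq_univ_iff_forall.2 fun x => ?_
    obtain ⟨e, he⟩ := hcover x
    exact hF.ends_mem e (hD e) x he
  have hvalid : ∀ t ∈ finalTransitions, t.Valid := fun t ht => by
    obtain ⟨s, -, rfl⟩ := mem_finalTransitions.1 ht
    exact valid_finalTrans s
  have hcnt := h.count
  refine Program.Ensures.comp ((loopFree_layerProg hvalid).ensures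
    (exec_layerProg hvalid fun c => h.empty _ c (by omega))) fun τ hτ => ?_
  obtain ⟨hfr, hs, hc⟩ := hτ
  rw [hcnt] at hfr hs hc
  have e15 : τ.nat 15 0 0 = D.card := by rw [hfr.nat _ _ _ (by omega), hcnt]
  refine Program.Ensures.branch (fun hb => ?_) (fun hb => ?_)
  · have h9 : τ.nat 9 (D.card + 1) 0 = 1 := by simpa [e15] using hb
    obtain ⟨t, ht, -, ⟨happ, -⟩, hval, hpb, -⟩ := hs 0 h9
    obtain ⟨s, hsc, rfl⟩ := mem_finalTransitions.1 ht
    simp only [finalTrans] at happ hval hpb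
    rw [hcnt] at happ
    obtain ⟨s', T, hs', hR, hv, htr⟩ := hT.sound _ happ
    obtain rfl := St.code_injective hs'
    have hopt : IsOptimal (IsConflictFreeTree G S) obj T := by
      refine ⟨(isConflictFreeTree_iff hD T).2 ⟨s, hsc, hR⟩, fun T' hT' => ?_⟩
      obtain ⟨s', hs'c, hR'⟩ := (isConflictFreeTree_iff (At := At) (u := u) (v := v) hD T').1 hT'
      obtain ⟨h1, h2⟩ := hT.complete s' T' hR'
      have := hc (finalTrans s') (mem_finalTransitions.2 ⟨s', hs'c, rfl⟩)
        ⟨by simpa [hcnt, finalTrans] using h1, by simp [finalTrans, BExp.tt]⟩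
      have h3 := this.2
      simp only [finalTrans, hval] at h3
      simp only [oldValue, RExp.eval, NExp.eval, NExp.reg, hcnt, hv] at h3
      exact h3.trans h2
    have hlf : announce.LoopFree := by simp [announce, Program.seq]
    refine Program.Ensures.comp (hlf.ensures (Q := fun τ' => τ' = announce.exec τ) rfl) ?_
    rintro _ rfl
    have e15' : (announce.exec τ).nat 15 0 0 = m := by simp [announce, e15, hm]
    have e18 : (announce.exec τ).nat 18 0 0 = s.code := by simp [announce, e15, hpb]
    have htrace : trace (announce.exec τ) m s.code = trace σ m s.code := by
      refine trace_congr (fun a i c ha1 ha2 hi => ?_) _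
      have hn : (announce.exec τ).nat a i c = τ.nat a i c := by
        have h1 : a ≠ 5 := by omega
        have h2 : a ≠ 18 := by omega
        simp [announce, h1, h2]
      rw [hn, hfr.nat _ _ _ (by omega)]
    have hb6 : ∀ x, (announce.exec τ).nat 6 x 0 = 0 := fun x => by
      have : τ.nat 6 x 0 = 0 := by rw [hfr.nat _ _ _ (by omega), h.nat 6 (by omega), h6]
      simp [announce, this]
    have hbt := ensures_backtrack hb6
    rw [e15', e18, htrace] at hbt
    refine hbt.mono le_rfl fun υ hυ => .inl ⟨T, hopt, ?_, fun e => ?_, ?_⟩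
    · rw [hυ.1]; simp [announce]
    · have := htr (edge e)
      rw [Equiv.symm_apply_apply, hm] at this
      exact ⟨fun he => (hυ.2.2 e).1 (this.1 he), fun he => (hυ.2.2 e).2 fun h' => he (this.2 h')⟩
    · rw [hυ.2.1]
      simp only [oldValue, RExp.eval, NExp.eval, NExp.reg, hcnt, hv] at hval
      simp [announce, e15, hval]
  · refine ⟨1, τ, .skip τ, by omega, .inr ⟨fun T hT' => hb ?_, ?_⟩⟩
    · obtain ⟨s', hs'c, hR'⟩ := (isConflictFreeTree_iff (At := At) (u := u) (v := v) hD T).1 hT'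
      obtain ⟨h1, h2⟩ := hT.complete s' T hR'
      have := hc (finalTrans s') (mem_finalTransitions.2 ⟨s', hs'c, rfl⟩)
        ⟨by simpa [hcnt, finalTrans] using h1, by simp [finalTrans, BExp.tt]⟩
      simpa [e15, finalTrans] using this.1
    · rw [hfr.nat _ _ _ (by omega), h.nat 5 (by omega), h5]

end Output

end LadderTrees

namespace LadderTrees

/-! ## Paths -/

section Paths

variable {V : Type}

@[simp] theorem pathEdges_singleton (a : V) : pathEdges [a] = ∅ := rfl

@[simp] theorem pathEdges_cons_cons (a b : V) (l : List V) :
    pathEdges (a :: b :: l) = insert s(a, b) (pathEdges (b :: l)) := rfl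

theorem pathEdges_append (l₁ : List V) (a : V) (l₂ : List V) :
    pathEdges (l₁ ++ a :: l₂) = pathEdges (l₁ ++ [a]) ∪ pathEdges (a :: l₂) := by
  induction l₁ with
  | nil => simp
  | cons b l₁ ih =>
    cases l₁ with
    | nil => simp
    | cons c l₁ => simp [Set.insert_union] at ih ⊢; rw [ih]

theorem pathEdges_reverse (l : List V) : pathEdges l.reverse = pathEdges l := by
  induction l with
  | nil => rfl
  | cons a l ih =>
    cases l with
    | nil => rfl
    | cons b l =>
      rw [List.reverse_cons] at ih
      rw [List.reverse_cons, List.reverse_cons, List.append_assoc, List.singleton_append,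
        pathEdges_append, ih, pathEdges_cons_cons, pathEdges_cons_cons, pathEdges_singleton,
        Set.union_comm, Sym2.eq_swap]
      ext; simp

theorem left_mem_of_pathEdges {x y : V} {l : List V} (h : s(x, y) ∈ pathEdges l) : x ∈ l := by
  induction l with
  | nil => exact h.elim
  | cons a l ih =>
    cases l with
    | nil => exact h.elim
    | cons b l =>
      rcases h with h | h
      · rcases Sym2.eq_iff.1 h with ⟨rfl, rfl⟩ | ⟨rfl, rfl⟩ <;> simp
      · exact List.mem_cons_of_mem _ (ih h)

theorem right_mem_of_pathEdges {x y : V} {l : List V} (h : s(x, y) ∈ pathEdges l) : y ∈ l :=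
  left_mem_of_pathEdges (Sym2.eq_swap ▸ h)

theorem exists_eq_of_mem_pathEdges {x y : V} {l : List V} (h : s(x, y) ∈ pathEdges l) :
    ∃ l₁ l₂, l = l₁ ++ x :: y :: l₂ ∨ l = l₁ ++ y :: x :: l₂ := by
  induction l with
  | nil => exact h.elim
  | cons a l ih =>
    cases l with
    | nil => exact h.elim
    | cons b l =>
      rcases h with h | h
      · rcases Sym2.eq_iff.1 h with ⟨rfl, rfl⟩ | ⟨rfl, rfl⟩
        exacts [⟨[], l, .inl rfl⟩, ⟨[], l, .inr rfl⟩]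
      · obtain ⟨l₁, l₂, h | h⟩ := ih h
        exacts [⟨a :: l₁, l₂, .inl (by simp [h])⟩, ⟨a :: l₁, l₂, .inr (by simp [h])⟩]

theorem mem_pathEdges_head {a b x : V} {l : List V} (h : (a :: b :: l).Nodup) :
    s(a, x) ∈ pathEdges (a :: b :: l) ↔ x = b := by
  rw [pathEdges_cons_cons, Set.mem_insert_iff, Sym2.congr_right]
  refine ⟨fun h' => h'.resolve_right fun h'' => ?_, .inl⟩
  exact (List.nodup_cons.1 h).1 (left_mem_of_pathEdges h'')

theorem mem_pathEdges_mid {a b c x : V} {l₁ l₂ : List V} (h : (l₁ ++ a :: b :: c :: l₂).Nodup) :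
    s(b, x) ∈ pathEdges (l₁ ++ a :: b :: c :: l₂) ↔ x = a ∨ x = c := by
  rw [pathEdges_append, pathEdges_cons_cons, Set.mem_union, Set.mem_insert_iff,
    mem_pathEdges_head (List.Nodup.sublist (by simp) h), Sym2.eq_swap (a := a), Sym2.congr_right]
  refine ⟨fun h' => h'.resolve_left fun h'' => ?_, .inr⟩
  have := left_mem_of_pathEdges h''
  simp only [List.nodup_append, List.nodup_cons, List.mem_cons, List.mem_append] at h this
  grind

/-- A cycle with one of its edges removed is a path. -/
theorem exists_path_of_cycle {a r s : V} {p : List V} (hnd : (a :: p).Nodup) (hp : p ≠ [])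
    (h : s(r, s) ∈ pathEdges (a :: p ++ [a])) :
    ∃ q : List V, (r :: (q ++ [s])).Nodup ∧ q.length = p.length - 1 ∧
      pathEdges (a :: p ++ [a]) = insert s(r, s) (pathEdges (r :: (q ++ [s]))) ∧
      ∀ x, x ∈ a :: p ↔ x ∈ r :: (q ++ [s]) := by
  suffices H : ∀ x y l₁ l₂, a :: p ++ [a] = l₁ ++ x :: y :: l₂ →
      ∃ q : List V, (y :: (q ++ [x])).Nodup ∧ q.length = p.length - 1 ∧
      pathEdges (a :: p ++ [a]) = insert s(x, y) (pathEdges (y :: (q ++ [x]))) ∧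
      ∀ z, z ∈ a :: p ↔ z ∈ y :: (q ++ [x]) by
    obtain ⟨l₁, l₂, h | h⟩ := exists_eq_of_mem_pathEdges h
    · obtain ⟨q, h1, h2, h3, h4⟩ := H r s l₁ l₂ h
      have hrev : r :: (q.reverse ++ [s]) = (s :: (q ++ [r])).reverse := by simp
      refine ⟨q.reverse, ?_, by simpa using h2, ?_, fun z => ?_⟩
      · rw [hrev]; exact List.nodup_reverse.2 h1
      · rw [hrev, pathEdges_reverse]; exact h3
      · rw [hrev, List.mem_reverse]; exact h4 z
    · obtain ⟨q, h1, h2, h3, h4⟩ := H s r l₁ l₂ h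
      exact ⟨q, h1, h2, by rw [Sym2.eq_swap]; exact h3, h4⟩
  intro x y l₁ l₂ hl
  have hperm : ∀ q : List V, (y :: (q ++ [x])).Perm (a :: p) →
      (y :: (q ++ [x])).Nodup ∧ q.length = p.length - 1 ∧ ∀ z, z ∈ a :: p ↔ z ∈ y :: (q ++ [x]) :=
    fun q hq => ⟨hq.nodup_iff.2 hnd, by have := hq.length_eq; simp at this; omega,
      fun z => hq.mem_iff.symm⟩
  -- The removed edge is the first edge of the closed walk, its last edge, or an edge in between; in
  -- the last case the remaining path is obtained by rotating the cycle so that it passes through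
  -- `a` in the middle.
  rcases l₁ with _ | ⟨a', l₁⟩
  · simp only [List.cons_append, List.nil_append, List.cons.injEq] at hl
    obtain ⟨rfl, hl⟩ := hl
    rcases p with _ | ⟨b, p⟩
    · exact absurd rfl hp
    simp only [List.cons_append, List.cons.injEq] at hl
    obtain ⟨rfl, rfl⟩ := hl
    obtain ⟨h1, h2, h3⟩ := hperm p (by
      simpa using (List.perm_append_comm (l₁ := b :: p) (l₂ := [a])))
    exact ⟨p, h1, h2, by simp, h3⟩
  · simp only [List.cons_append, List.cons.injEq] at hl
    obtain ⟨rfl, hl⟩ := hl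
    rcases List.eq_nil_or_concat l₂ with rfl | ⟨l₂, b, rfl⟩
    · have hl' : p ++ [a] = (l₁ ++ [x]) ++ [y] := by simpa using hl
      obtain ⟨rfl, hya⟩ := List.append_inj' hl' rfl
      obtain rfl : a = y := by simpa using hya
      obtain ⟨h1, h2, h3⟩ := hperm l₁ (List.Perm.refl _)
      refine ⟨l₁, h1, h2, ?_, h3⟩
      have : a :: (l₁ ++ [x]) ++ [a] = (a :: l₁) ++ x :: [a] := by simp
      rw [this, pathEdges_append]
      ext; simp [or_comm]
    · have hl' : p ++ [a] = (l₁ ++ x :: y :: l₂) ++ [b] := by simpa using hl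
      obtain ⟨rfl, hab⟩ := List.append_inj' hl' rfl
      obtain rfl : a = b := by simpa using hab
      obtain ⟨h1, h2, h3⟩ := hperm (l₂ ++ a :: l₁) (by
        have := List.perm_append_comm (l₁ := y :: l₂) (l₂ := a :: l₁ ++ [x])
        simpa using this)
      refine ⟨l₂ ++ a :: l₁, h1, h2, ?_, h3⟩
      have e1 : a :: (l₁ ++ x :: y :: l₂) ++ [a] = (a :: l₁) ++ x :: y :: (l₂ ++ [a]) := by simp
      have e2 : y :: (l₂ ++ a :: l₁ ++ [x]) = (y :: l₂) ++ a :: (l₁ ++ [x]) := by simp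
      rw [e1, e2, pathEdges_append, pathEdges_append (y :: l₂)]
      ext; simp; tauto

end Paths

/-! ## Sweeping along paths -/

section SweepPath

variable {V : Type}

theorem reaches_rung {u v : V} {U : Set (Sym2 V)} (h : s(u, v) ∉ U) :
    Relation.ReflTransGen SweepStep (u, v, insert s(u, v) U) (u, v, U) := by
  have := SweepStep.rung (u := u) (v := v) (U := insert s(u, v) U) (Set.mem_insert _ _)
  rw [Set.insert_sdiff_of_mem _ (Set.mem_singleton _), Set.sdiff_singleton_eq_self h] at this
  exact .single this

theorem canAdvance_path {u b v : V} {l : List V} {U : Set (Sym2 V)} (hnd : (u :: b :: l).Nodup)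
    (hv : b ≠ v) (hU : ∀ y, s(u, y) ∉ U) :
    CanAdvance u v b (U ∪ pathEdges (u :: b :: l)) ∧
      (U ∪ pathEdges (u :: b :: l)) \ {s(u, b)} = U ∪ pathEdges (b :: l) := by
  refine ⟨⟨hv, by simp, fun x hx => ?_⟩, ?_⟩
  · exact (mem_pathEdges_head hnd).1 (hx.resolve_left (hU x))
  · have h1 : s(u, b) ∉ U ∪ pathEdges (b :: l) := by
      rintro (h | h)
      · exact hU _ h
      · exact (List.nodup_cons.1 hnd).1 (left_mem_of_pathEdges h)
    rw [pathEdges_cons_cons, Set.union_insert, Set.insert_sdiff_of_mem _ (Set.mem_singleton _),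
      Set.sdiff_singleton_eq_self h1]

/-- The vertex `v` stays in place while `u` walks: outside `U` each vertex before `w` has only the
next edge of the path left. -/
theorem reaches_path {u v w : V} {q : List V} {U : Set (Sym2 V)} (hnd : (u :: (q ++ [w])).Nodup)
    (hv : v ∉ q ++ [w]) (hU : ∀ x ∈ u :: q, ∀ y, s(x, y) ∉ U) :
    Relation.ReflTransGen SweepStep (u, v, U ∪ pathEdges (u :: (q ++ [w]))) (w, v, U) := by
  induction q generalizing u with
  | nil =>
    simp only [List.nil_append] at hnd hv ⊢
    obtain ⟨h1, h2⟩ := canAdvance_path (v := v) hnd (by simp at hv; exact fun h => hv h.symm)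
      (hU u (by simp))
    have := SweepStep.advance h1
    rw [h2, pathEdges_singleton, Set.union_empty] at this
    exact .single this
  | cons b q ih =>
    simp only [List.cons_append] at hnd hv ⊢
    obtain ⟨h1, h2⟩ := canAdvance_path (v := v) hnd (by rintro rfl; simp at hv)
      (hU u (by simp))
    have := SweepStep.advance h1
    rw [h2] at this
    exact .head this (ih (List.nodup_cons.1 hnd).2 (fun h => hv (by simp at h ⊢; tauto))
      fun x hx => hU x (List.mem_cons_of_mem _ hx))

/-- The two remaining edges `ux` and `uy` block `u`, and `uv` is not available, so the sweep
exchanges the roles and walks on from `v`. After the first step no further exchange is needed. -/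
theorem reaches_path_swap {u v w x y : V} {q : List V} {U : Set (Sym2 V)}
    (hnd : (v :: (q ++ [w])).Nodup) (hu : u ∉ v :: (q ++ [w]))
    (hU : ∀ x ∈ v :: q, ∀ y, s(x, y) ∉ U) (hx : s(u, x) ∈ U) (hy : s(u, y) ∈ U) (hxy : x ≠ y) :
    Relation.ReflTransGen SweepStep (u, v, U ∪ pathEdges (v :: (q ++ [w]))) (w, u, U) := by
  have h0 : s(u, v) ∉ U ∪ pathEdges (v :: (q ++ [w])) := by
    rintro (h | h)
    · rw [Sym2.eq_swap] at h; exact hU v (by simp) _ h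
    · exact hu (left_mem_of_pathEdges h)
  have hno : ∀ z, ¬ CanAdvance u v z (U ∪ pathEdges (v :: (q ++ [w]))) := fun z hz =>
    hxy ((hz.2.2 x (.inl hx)).trans (hz.2.2 y (.inl hy)).symm)
  rcases q with _ | ⟨b, q⟩
  · rw [List.nil_append] at hnd h0 hno ⊢
    obtain ⟨h1, h2⟩ := canAdvance_path (v := u) hnd (by rintro rfl; simp at hu)
      (hU v (by simp))
    have := SweepStep.swap h0 hno h1
    rw [h2, pathEdges_singleton, Set.union_empty] at this
    exact .single this
  · rw [List.cons_append] at hnd h0 hno ⊢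
    obtain ⟨h1, h2⟩ := canAdvance_path (v := u) hnd (by rintro rfl; simp at hu)
      (hU v (by simp))
    have := SweepStep.swap h0 hno h1
    rw [h2] at this
    exact .head this (reaches_path (List.nodup_cons.1 hnd).2
      (fun h => hu (by simp at h ⊢; tauto)) fun x hx => hU x (List.mem_cons_of_mem _ hx))

/-- The sweep across a cell, from the rung `rs` to the rung `ab`. -/
theorem reaches_cell {r s a b x y : V} {q₁ q₂ : List V} {U : Set (Sym2 V)}
    (hnd : ((r :: (q₁ ++ [a])) ++ (s :: (q₂ ++ [b]))).Nodup)
    (hU : ∀ z ∈ (r :: q₁) ++ (s :: q₂), ∀ y, s(z, y) ∉ U)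
    (hx : s(a, x) ∈ U) (hy : s(a, y) ∈ U) (hxy : x ≠ y) :
    Relation.ReflTransGen SweepStep
      (r, s, insert s(r, s) (U ∪ pathEdges (r :: (q₁ ++ [a])) ∪ pathEdges (s :: (q₂ ++ [b]))))
      (b, a, U) := by
  obtain ⟨h1, h2, h3⟩ := List.nodup_append.1 hnd
  have h3' : ∀ z, z ∈ r :: (q₁ ++ [a]) → z ∉ s :: (q₂ ++ [b]) := fun z hz hz' => h3 z hz z hz' rfl
  refine (reaches_rung ?_).trans (.trans (b := (a, s, U ∪ pathEdges (s :: (q₂ ++ [b])))) ?_ ?_)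
  · rintro ((h | h) | h)
    · exact hU r (by simp) _ h
    · exact h3' s (right_mem_of_pathEdges h) (by simp)
    · exact h3' r (by simp) (left_mem_of_pathEdges h)
  · rw [Set.union_right_comm]
    refine reaches_path h1 (fun h => h3' s (List.mem_cons_of_mem _ h) (by simp)) ?_
    rintro z hz y (h | h)
    · exact hU z (List.mem_append_left _ hz) y h
    · refine h3' z ?_ (left_mem_of_pathEdges h)
      simp at hz ⊢; tauto
  · exact reaches_path_swap h2 (h3' a (by simp))
      (fun z hz => hU z (List.mem_append_right _ hz)) hx hy hxy

/-- The sweep of a cycle completes. -/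
theorem completes_cycle {r s : V} {q : List V} (hnd : (r :: (q ++ [s])).Nodup) (hq : q ≠ []) :
    Completes (r, s, insert s(r, s) (pathEdges (r :: (q ++ [s])))) := by
  -- The walk stops one vertex early, at the neighbour `x` of `s`: the closing edge `xs` joins the
  -- two frontier vertices and is processed as a rung.
  obtain ⟨q, x, rfl⟩ : ∃ q' x, q = q' ++ [x] := ⟨_, _, (List.dropLast_append_getLast hq).symm⟩
  have e1 : r :: (q ++ [x] ++ [s]) = (r :: q) ++ x :: [s] := by simp
  have hrs : s(r, s) ∉ pathEdges (r :: (q ++ [x] ++ [s])) := by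
    intro h
    rcases q with _ | ⟨y, q⟩
    · have := (mem_pathEdges_head hnd).1 h
      subst this
      simp at hnd
    · have := (mem_pathEdges_head hnd).1 h
      subst this
      simp at hnd
  refine ⟨(x, s, ∅), (reaches_rung hrs).trans ?_, rfl⟩
  rw [e1, pathEdges_append]
  have hnd' : (r :: (q ++ [x])).Nodup := hnd.sublist (by simp)
  refine .trans (b := (x, s, {s(x, s)})) ?_ ?_
  · rw [Set.union_comm]
    have : pathEdges [x, s] = {s(x, s)} := by simp
    rw [this]
    refine reaches_path hnd' ?_ ?_
    · intro h
      rw [← List.cons_append, List.nodup_append] at hnd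
      exact hnd.2.2 s (by simp at h ⊢; tauto) s (by simp) rfl
    · intro z hz y h
      have h' : s(z, y) = s(x, s) := h
      have hz' : z = x ∨ z = s := by
        rcases Sym2.eq_iff.1 h' with ⟨h, -⟩ | ⟨h, -⟩ <;> simp [h]
      simp only [List.nodup_cons, List.nodup_append, List.mem_append, List.mem_cons] at hnd hz
      grind
  · have := reaches_rung (u := x) (v := s) (U := ∅) (by simp)
    simpa using this

end SweepPath

end LadderTrees

namespace LadderTrees

/-! ## Runs of vertices of degree two -/

section Runs

variable {V : Type}

/-- The sequence `a, b, l` of vertices is a walk without turning back, all of whose vertices other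
than the first and the last have exactly two neighbours. -/
def IsRun (E : Set (Sym2 V)) : V → V → List V → Prop
  | a, b, [] => s(a, b) ∈ E
  | a, b, c :: l => s(a, b) ∈ E ∧ (∀ x, s(b, x) ∈ E ↔ x = a ∨ x = c) ∧ a ≠ c ∧ IsRun E b c l

theorem IsRun.mem {E : Set (Sym2 V)} {a b : V} {l : List V} (h : IsRun E a b l) : s(a, b) ∈ E := by
  cases l with
  | nil => exact h
  | cons c l => exact h.1

/-- The walk is forced: at each inner vertex it continues to the only neighbour other than the one
just left. -/
theorem IsRun.isPrefix {E : Set (Sym2 V)} {a b : V} {l l' : List V} (h : IsRun E a b l)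
    (h' : IsRun E a b l') (hl : l.length ≤ l'.length) : l <+: l' := by
  induction l generalizing a b l' with
  | nil => exact List.nil_prefix
  | cons c l ih =>
    cases l' with
    | nil => simp at hl
    | cons c' l' =>
      obtain ⟨-, h1, h2, h3⟩ := h
      obtain ⟨-, h1', h2', h3'⟩ := h'
      have hc : c = c' := ((h1' c).1 ((h1 c).2 (.inr rfl))).resolve_left h2.symm
      subst hc
      exact (List.prefix_cons_inj c).2 (ih h3 h3' (by simpa using hl))

theorem IsRun.two {E : Set (Sym2 V)} {a b x : V} {l : List V} (h : IsRun E a b l)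
    (hx : x ∈ (b :: l).dropLast) : ∃ y z, ∀ w, s(x, w) ∈ E → w = y ∨ w = z := by
  induction l generalizing a b with
  | nil => simp at hx
  | cons c l ih =>
    obtain ⟨-, h1, -, h3⟩ := h
    rw [List.dropLast_cons_of_ne_nil (by simp)] at hx
    rcases List.mem_cons.1 hx with rfl | hx
    · exact ⟨a, c, fun w => (h1 w).1⟩
    · exact ih h3 hx

theorem isRun_of_path {E : Set (Sym2 V)} {a b : V} {l₁ l : List V}
    (hnd : (l₁ ++ a :: b :: l).Nodup)
    (hE : ∀ x ∈ (b :: l).dropLast, ∀ y, s(x, y) ∈ E ↔ s(x, y) ∈ pathEdges (l₁ ++ a :: b :: l))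
    (hab : s(a, b) ∈ E) : IsRun E a b l := by
  induction l generalizing l₁ a b with
  | nil => exact hab
  | cons c l ih =>
    have hb := hE b (by simp)
    have hmid := fun x => mem_pathEdges_mid (x := x) hnd
    refine ⟨hab, fun x => (hb x).trans (hmid x), ?_, ih (l₁ := l₁ ++ [a]) (by simpa using hnd) ?_ ?_⟩
    · rintro rfl
      simp [List.nodup_append] at hnd
    · intro x hx y
      rw [hE x (by rw [List.dropLast_cons_of_ne_nil (by simp)]; exact List.mem_cons_of_mem _ hx) y]
      simp
    · exact (hb c).2 ((hmid c).2 (.inr rfl))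

/-- A run cannot be longer than the path that contains it. -/
theorem IsRun.blocked {E : Set (Sym2 V)} {r x c d : V} {l q : List V} (h : IsRun E r x l)
    (hnd : (c :: (q ++ [d])).Nodup)
    (hE : ∀ x ∈ q, ∀ y, s(x, y) ∈ E ↔ s(x, y) ∈ pathEdges (c :: (q ++ [d])))
    (hx : x ∈ q) (hl : q.length < l.length) :
    c ∈ (x :: l).dropLast ∨ d ∈ (x :: l).dropLast := by
  -- Up to reversing the path, the run enters it in the direction of `d`.
  suffices H : ∀ (c d : V) (q q₁ q₂ : List V), (c :: (q ++ [d])).Nodup →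
      (∀ x ∈ q, ∀ y, s(x, y) ∈ E ↔ s(x, y) ∈ pathEdges (c :: (q ++ [d]))) →
      q.length < l.length → c :: (q ++ [d]) = q₁ ++ r :: x :: q₂ → x ∈ q →
      d ∈ (x :: l).dropLast by
    have hmem := (hE x hx r).1 (Sym2.eq_swap ▸ h.mem)
    obtain ⟨q₁, q₂, h' | h'⟩ := exists_eq_of_mem_pathEdges hmem
    · left
      have hrev : d :: (q.reverse ++ [c]) = (c :: (q ++ [d])).reverse := by simp
      refine H d c q.reverse q₂.reverse q₁.reverse ?_ ?_ (by simpa using hl) ?_ (by simpa using hx)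
      · rw [hrev]; exact List.nodup_reverse.2 hnd
      · rw [hrev, pathEdges_reverse]; simpa using hE
      · rw [hrev, h']; simp
    · exact .inr (H c d q q₁ q₂ hnd hE hl h' hx)
  intro c d q q₁ q₂ hnd hE hl heq hx
  have hxd : x ≠ d := by
    rintro rfl
    simp only [List.nodup_cons, List.nodup_append] at hnd
    exact hnd.2.2.2 x hx x (by simp) rfl
  have hq₂ : q₂ ≠ [] := by
    rintro rfl
    have heq' : (c :: q) ++ [d] = (q₁ ++ [r]) ++ [x] := by simpa using heq
    exact hxd (by simpa using (List.append_inj' heq' rfl).2.symm)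
  obtain ⟨q₃, d', rfl⟩ : ∃ q' x, q₂ = q' ++ [x] := ⟨_, _, (List.dropLast_append_getLast hq₂).symm⟩
  have heq' : (c :: q) ++ [d] = (q₁ ++ r :: x :: q₃) ++ [d'] := by simpa using heq
  obtain ⟨hcq, hdd⟩ := List.append_inj' heq' rfl
  obtain rfl : d = d' := by simpa using hdd
  have hsub : ∀ z ∈ x :: q₃, z ∈ q := by
    intro z hz
    rcases q₁ with _ | ⟨c', q₁⟩
    · simp only [List.nil_append, List.cons.injEq] at hcq
      rw [hcq.2]; exact hz
    · simp only [List.cons_append, List.cons.injEq] at hcq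
      rw [hcq.2]; simp at hz ⊢; tauto
  have hlen : q₃.length < q.length := by
    have := congrArg List.length hcq
    simp at this
    omega
  -- The rest of the path up to `d` is itself a run with the same first edge. Being shorter, it is a
  -- proper prefix of the given run, which therefore passes through `d` before its end.
  have hrun : IsRun E r x (q₃ ++ [d]) := by
    refine isRun_of_path (l₁ := q₁) (heq ▸ hnd) (fun z hz y => ?_) h.mem
    rw [← heq]
    refine hE z (hsub z ?_) y
    rwa [← List.cons_append, List.dropLast_concat] at hz
  obtain ⟨t, rfl⟩ := hrun.isPrefix h (by simp; omega)
  have ht : t ≠ [] := by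
    rintro rfl
    simp at hl
    omega
  have : x :: (q₃ ++ [d] ++ t) = (x :: (q₃ ++ [d])) ++ t := by simp
  rw [this, List.dropLast_append_of_ne_nil ht]
  simp

end Runs

/-! ## The structure of ladders -/

section Ladder

variable {V : Type} {k i : ℕ} {A : Set V} {E F : Set (Sym2 V)}

theorem mem_pathEdges_of_eq {x y : V} {l₁ l₂ : List V} :
    s(x, y) ∈ pathEdges (l₁ ++ x :: y :: l₂) := by
  rw [pathEdges_append]; simp

theorem pathEdges_subset_cons_append (r s : V) (p : List V) :
    pathEdges p ⊆ pathEdges (r :: (p ++ [s])) := by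
  rintro ⟨x, y⟩ h
  obtain ⟨l₁, l₂, rfl | rfl⟩ := exists_eq_of_mem_pathEdges h
  · have := mem_pathEdges_of_eq (x := x) (y := y) (l₁ := r :: l₁) (l₂ := l₂ ++ [s])
    simpa using this
  · rw [show (Quot.mk _ (x, y) : Sym2 V) = s(y, x) from Sym2.eq_swap]
    have := mem_pathEdges_of_eq (x := y) (y := x) (l₁ := r :: l₁) (l₂ := l₂ ++ [s])
    simpa using this

theorem LadderBuild.free_subset (h : LadderBuild k i A E F) : F ⊆ E := by
  cases h with
  | init => exact subset_rfl
  | step _ _ _ _ _ r s _ p => exact fun x hx => .inr (pathEdges_subset_cons_append r s p hx)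

theorem LadderBuild.mem_of_edge (h : LadderBuild k i A E F) {x y : V} (hxy : s(x, y) ∈ E) :
    x ∈ A := by
  induction h generalizing x y with
  | init a p =>
    have := left_mem_of_pathEdges hxy
    simp at this ⊢
    tauto
  | step i A E F h r s hfree p _ _ _ ih =>
    rcases hxy with hxy | hxy
    · exact .inl (ih hxy)
    · have := left_mem_of_pathEdges hxy
      simp only [List.cons_append, List.mem_cons, List.mem_append, List.not_mem_nil,
        or_false] at this
      rcases this with rfl | hx | rfl
      · exact .inl (ih (h.free_subset hfree))
      · exact .inr hx
      · exact .inl (ih (Sym2.eq_swap ▸ h.free_subset hfree))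

theorem LadderBuild.nodup_cell (h : LadderBuild k i A E F) {r s : V} {p : List V}
    (hfree : s(r, s) ∈ F) (hrs : r ≠ s) (hnd : p.Nodup) (hnew : ∀ v ∈ p, v ∉ A) :
    (r :: (p ++ [s])).Nodup := by
  have hr : r ∉ p := fun h' => hnew r h' (h.mem_of_edge (h.free_subset hfree))
  have hs : s ∉ p := fun h' => hnew s h' (h.mem_of_edge (Sym2.eq_swap ▸ h.free_subset hfree))
  simp [List.nodup_append, hr, hrs, hnd]
  rintro a ha rfl
  exact hs ha

/-- An end of a free edge has exactly two neighbours. -/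
theorem LadderBuild.free_nbrs (hk : 3 ≤ k) (h : LadderBuild k i A E F) {r s : V}
    (hrs : s(r, s) ∈ F) : r ≠ s ∧ ∃ x, x ≠ s ∧ ∀ y, s(r, y) ∈ E ↔ y = s ∨ y = x := by
  induction h generalizing r s with
  | init a p hnd hlen =>
    obtain ⟨q, h1, h2, h3, -⟩ := exists_path_of_cycle hnd (by rintro rfl; simp at hlen; omega) hrs
    rcases q with _ | ⟨x, q⟩
    · simp at h2; omega
    rw [List.cons_append] at h1
    refine ⟨?_, x, ?_, fun y => ?_⟩
    · rintro rfl; simp at h1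
    · rintro rfl; simp at h1
    · rw [h3, Set.mem_insert_iff, List.cons_append, mem_pathEdges_head h1, Sym2.congr_right]
  | step i A E F h r' s' hfree p hnd hlen hnew ih =>
    suffices H : ∀ (r' s' : V) (p p₁ p₂ : List V), s(r', s') ∈ F → p.Nodup → (∀ v ∈ p, v ∉ A) →
        p = p₁ ++ r :: s :: p₂ → r ≠ s ∧ ∃ x, x ≠ s ∧
          ∀ y, s(r, y) ∈ E ∪ pathEdges (r' :: (p ++ [s'])) ↔ y = s ∨ y = x by
      obtain ⟨p₁, p₂, hp | hp⟩ := exists_eq_of_mem_pathEdges hrs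
      · exact H r' s' p p₁ p₂ hfree hnd hnew hp
      · have := H s' r' p.reverse p₂.reverse p₁.reverse (Sym2.eq_swap ▸ hfree)
          (List.nodup_reverse.2 hnd) (by simpa using hnew) (by simp [hp])
        have hrev : s' :: (p.reverse ++ [r']) = (r' :: (p ++ [s'])).reverse := by simp
        rw [hrev, pathEdges_reverse] at this
        exact this
    intro r' s' p p₁ p₂ hfree hnd hnew hp
    have hcell := h.nodup_cell hfree (ih hfree).1 hnd hnew
    obtain ⟨l, x, hlx⟩ : ∃ l x, r' :: p₁ = l ++ [x] :=
      ⟨_, _, (List.dropLast_append_getLast (by simp)).symm⟩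
    have heq : r' :: (p ++ [s']) = l ++ x :: r :: s :: (p₂ ++ [s']) := by
      have : r' :: (p ++ [s']) = (r' :: p₁) ++ r :: s :: (p₂ ++ [s']) := by simp [hp]
      rw [this, hlx]; simp
    rw [heq] at hcell ⊢
    refine ⟨?_, x, ?_, fun y => ?_⟩
    · rintro rfl; simp [List.nodup_append] at hcell
    · rintro rfl; simp [List.nodup_append] at hcell
    · rw [Set.mem_union, mem_pathEdges_mid hcell, or_comm (a := y = x)]
      have : s(r, y) ∉ E := fun h' => hnew r (by simp [hp]) (h.mem_of_edge h')
      simp [this]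

theorem pathEdges_cell (r s a b : V) (p₁ p₂ : List V) :
    pathEdges (r :: ((p₁ ++ a :: b :: p₂) ++ [s])) =
      insert s(a, b) (pathEdges (r :: (p₁ ++ [a])) ∪ pathEdges (b :: (p₂ ++ [s]))) := by
  have : r :: ((p₁ ++ a :: b :: p₂) ++ [s]) = (r :: p₁) ++ a :: b :: (p₂ ++ [s]) := by simp
  rw [this, pathEdges_append, pathEdges_cons_cons, Set.union_insert, List.cons_append]

/-- The sweep that starts at a free edge completes. -/
theorem LadderBuild.completes (hk : 3 ≤ k) (h : LadderBuild k i A E F) {r s : V}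
    (hrs : s(r, s) ∈ F) : Completes (r, s, E) := by
  induction h generalizing r s with
  | init a p hnd hlen =>
    obtain ⟨q, h1, h2, h3, -⟩ := exists_path_of_cycle hnd (by rintro rfl; simp at hlen; omega) hrs
    rw [h3]
    exact completes_cycle h1 (by rintro rfl; simp at h2; omega)
  | step i A E F h r' s' hfree p hnd hlen hnew ih =>
    suffices H : ∀ (r' s' : V) (p p₁ p₂ : List V), s(r', s') ∈ F → p.Nodup → (∀ v ∈ p, v ∉ A) →
        p = p₁ ++ r :: s :: p₂ → Completes (r, s, E ∪ pathEdges (r' :: (p ++ [s']))) by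
      obtain ⟨p₁, p₂, hp | hp⟩ := exists_eq_of_mem_pathEdges hrs
      · exact H r' s' p p₁ p₂ hfree hnd hnew hp
      · have := H s' r' p.reverse p₂.reverse p₁.reverse (Sym2.eq_swap ▸ hfree)
          (List.nodup_reverse.2 hnd) (by simpa using hnew) (by simp [hp])
        have hrev : s' :: (p.reverse ++ [r']) = (r' :: (p ++ [s'])).reverse := by simp
        rw [hrev, pathEdges_reverse] at this
        exact this
    intro r' s' p p₁ p₂ hfree hnd hnew hp
    obtain ⟨hne, x, hxs, hx⟩ := h.free_nbrs hk hfree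
    have hcell := h.nodup_cell hfree hne hnd hnew
    -- The last cell is swept from its edge `rs` down to the edge `r's'` shared with the smaller
    -- ladder. There `r'` is blocked, having the two neighbours `s'` and `x` in `E`, while the side
    -- towards `s'` is finished; the smaller ladder is then swept from its free edge.
    refine Completes.of_reaches ?_ (ih (r := s') (s := r') (Sym2.eq_swap ▸ hfree))
    have hrev : r :: (p₁.reverse ++ [r']) = (r' :: (p₁ ++ [r])).reverse := by simp
    have key := reaches_cell (r := r) (s := s) (a := r') (b := s') (x := s') (y := x)
      (q₁ := p₁.reverse) (q₂ := p₂) (U := E) ?_ ?_ ((hx _).2 (.inl rfl)) ((hx _).2 (.inr rfl))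
      hxs.symm
    · rw [hp, pathEdges_cell, Set.union_insert, ← pathEdges_reverse (r' :: (p₁ ++ [r])), ← hrev,
        ← Set.union_assoc]
      exact key
    · have hperm : (r' :: (p ++ [s'])).Perm (r :: (p₁.reverse ++ [r']) ++ s :: (p₂ ++ [s'])) := by
        have : r' :: (p ++ [s']) = (r' :: (p₁ ++ [r])) ++ (s :: (p₂ ++ [s'])) := by simp [hp]
        rw [this, hrev]
        exact (List.reverse_perm _).symm.append_right _
      exact hperm.nodup_iff.1 hcell
    · intro z hz y h'
      refine hnew z ?_ (h.mem_of_edge h')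
      rw [hp]; simp at hz ⊢; tauto

/-- The sweep across a cell to one of its edges. -/
theorem reaches_cell_edge {r s a b : V} {p : List V} {X : Set (Sym2 V)}
    (hnd : (r :: (p ++ [s])).Nodup) (hab : s(a, b) ∈ pathEdges p)
    (hX : ∀ z ∈ r :: (p ++ [s]), z ≠ a → z ≠ b → ∀ y, s(z, y) ∉ X)
    (ha : ∃ y, y ≠ b ∧ s(a, y) ∈ X) (hb : ∃ y, y ≠ a ∧ s(b, y) ∈ X) :
    ∃ c d, s(c, d) = s(a, b) ∧ Relation.ReflTransGen SweepStep
      (r, s, insert s(r, s) (pathEdges (r :: (p ++ [s])) ∪ X)) (c, d, insert s(a, b) X) := by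
  suffices H : ∀ a b p₁ p₂, p = p₁ ++ a :: b :: p₂ →
      (∀ z ∈ r :: (p ++ [s]), z ≠ a → z ≠ b → ∀ y, s(z, y) ∉ X) → (∃ y, y ≠ b ∧ s(a, y) ∈ X) →
      Relation.ReflTransGen SweepStep
      (r, s, insert s(r, s) (pathEdges (r :: (p ++ [s])) ∪ X)) (b, a, insert s(a, b) X) by
    obtain ⟨p₁, p₂, hp | hp⟩ := exists_eq_of_mem_pathEdges hab
    · exact ⟨b, a, Sym2.eq_swap, H a b p₁ p₂ hp hX ha⟩
    · refine ⟨a, b, rfl, ?_⟩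
      rw [Sym2.eq_swap (a := a)]
      exact H b a p₁ p₂ hp (fun z hz h1 h2 => hX z hz h2 h1) hb
  rintro a b p₁ p₂ hp hX ⟨y, hyb, hy⟩
  have hrev : s :: (p₂.reverse ++ [b]) = (b :: (p₂ ++ [s])).reverse := by simp
  have heq : r :: (p ++ [s]) = (r :: (p₁ ++ [a])) ++ (b :: (p₂ ++ [s])) := by simp [hp]
  have hperm : (r :: (p ++ [s])).Perm (r :: (p₁ ++ [a]) ++ s :: (p₂.reverse ++ [b])) := by
    rw [heq, hrev]
    exact (List.reverse_perm _).symm.append_left _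
  have hnd' := hperm.nodup_iff.1 hnd
  have key := reaches_cell (r := r) (s := s) (a := a) (b := b) (x := b) (y := y)
    (q₁ := p₁) (q₂ := p₂.reverse) (U := insert s(a, b) X) hnd' ?_ (by simp) (.inr hy) hyb.symm
  · rw [hp, pathEdges_cell, ← pathEdges_reverse (b :: (p₂ ++ [s])), ← hrev]
    convert key using 3
    ext; simp; tauto
  · intro z hz w hw
    have hza : z ≠ a := by
      rintro rfl
      simp only [List.cons_append, List.append_assoc, List.nodup_cons, List.nodup_append,
        List.mem_append, List.mem_cons] at hnd' hz
      grind
    have hzb : z ≠ b := by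
      rintro rfl
      simp only [List.cons_append, List.append_assoc, List.nodup_cons, List.nodup_append,
        List.mem_append, List.mem_cons] at hnd' hz
      grind
    rcases hw with hw | hw
    · rcases Sym2.eq_iff.1 hw with ⟨h, -⟩ | ⟨h, -⟩
      exacts [hza h, hzb h]
    · refine hX z ?_ hza hzb w hw
      rw [hperm.mem_iff]; simp at hz ⊢; tauto

end Ladder

end LadderTrees

namespace LadderTrees

/-! ### Long runs and the sweep from the first cell upwards. -/

section LadderRuns

variable {V : Type} {k i : ℕ} {A : Set V} {E F : Set (Sym2 V)}

/-- The vertex `x` has at most two neighbours. -/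
def AtMostTwo (E : Set (Sym2 V)) (x : V) : Prop := ∃ y z, ∀ w, s(x, w) ∈ E → w = y ∨ w = z

/-- An end of a free edge already has two neighbours, and fusing a cell at this edge adds a third
one among the new vertices. -/
theorem LadderBuild.not_atMostTwo (hk : 3 ≤ k) (h : LadderBuild k i A E F) {r s : V} {p : List V}
    (hfree : s(r, s) ∈ F) (hlen : p.length + 2 = k) (hnew : ∀ v ∈ p, v ∉ A) :
    ¬ AtMostTwo (E ∪ pathEdges (r :: (p ++ [s]))) r := by
  obtain ⟨hne, x, hxs, hx⟩ := h.free_nbrs hk hfree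
  rcases p with _ | ⟨c, p⟩
  · simp at hlen; omega
  rintro ⟨y, z, hyz⟩
  have h1 := hyz s (.inl ((hx s).2 (.inl rfl)))
  have h2 := hyz x (.inl ((hx x).2 (.inr rfl)))
  have h3 := hyz c (.inr (by simp))
  have hsA : s ∈ A := h.mem_of_edge (Sym2.eq_swap ▸ h.free_subset hfree)
  have hxA : x ∈ A := h.mem_of_edge (Sym2.eq_swap ▸ (hx x).2 (.inr rfl))
  have hc := hnew c (by simp)
  have h4 : c ≠ s := by rintro rfl; exact hc hsA
  have h5 : c ≠ x := by rintro rfl; exact hc hxA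
  grind

/-- The new vertices of a cell have at most two neighbours. -/
theorem LadderBuild.atMostTwo_new (h : LadderBuild k i A E F) {r s x : V} {p : List V}
    (hnd : (r :: (p ++ [s])).Nodup) (hnew : ∀ v ∈ p, v ∉ A) (hx : x ∈ p) :
    AtMostTwo (E ∪ pathEdges (r :: (p ++ [s]))) x := by
  obtain ⟨p₁, p₂, rfl⟩ := List.append_of_mem hx
  obtain ⟨l, y, hly⟩ : ∃ l y, r :: p₁ = l ++ [y] :=
    ⟨_, _, (List.dropLast_append_getLast (by simp)).symm⟩
  obtain ⟨z, l', hzl⟩ : ∃ z l', p₂ ++ [s] = z :: l' := by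
    rcases p₂ with _ | ⟨z, p₂⟩
    · exact ⟨s, [], rfl⟩
    · exact ⟨z, p₂ ++ [s], rfl⟩
  have heq : r :: ((p₁ ++ x :: p₂) ++ [s]) = l ++ y :: x :: z :: l' := by
    have : r :: ((p₁ ++ x :: p₂) ++ [s]) = (r :: p₁) ++ x :: (p₂ ++ [s]) := by simp
    rw [this, hly, hzl]; simp
  rw [heq] at hnd ⊢
  refine ⟨y, z, fun w hw => ?_⟩
  rcases hw with hw | hw
  · exact absurd (h.mem_of_edge hw) (hnew x hx)
  · exact (mem_pathEdges_mid hnd).1 hw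

/-- A run that does not enter the last cell is a run of the smaller ladder. -/
theorem LadderBuild.isRun_of_step (h : LadderBuild k i A E F) {r s a b : V} {p l : List V}
    (hrun : IsRun (E ∪ pathEdges (r :: (p ++ [s]))) a b l) (hab : s(a, b) ∈ E) (hb : b ∉ p)
    (hnew : ∀ v ∈ p, v ∉ A)
    (hr : r ∉ (b :: l).dropLast) (hs : s ∉ (b :: l).dropLast) : IsRun E a b l := by
  induction l generalizing a b with
  | nil => exact hab
  | cons c l ih =>
    obtain ⟨-, h1, h2, h3⟩ := hrun
    rw [List.dropLast_cons_of_ne_nil (by simp)] at hr hs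
    have hiff : ∀ x, s(b, x) ∈ E ∪ pathEdges (r :: (p ++ [s])) ↔ s(b, x) ∈ E := by
      refine fun x => ⟨fun h' => h'.resolve_right fun h'' => ?_, .inl⟩
      have := left_mem_of_pathEdges h''
      simp only [List.mem_cons, List.mem_append, List.not_mem_nil, or_false, not_or] at this hr hs
      rcases this with rfl | h | rfl
      · exact hr.1 rfl
      · exact hb h
      · exact hs.1 rfl
    have hbc : s(b, c) ∈ E := (hiff c).1 ((h1 c).2 (.inr rfl))
    refine ⟨hab, fun x => (hiff x).symm.trans (h1 x), h2, ih h3 hbc ?_ ?_ ?_⟩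
    · exact fun hc => hnew c hc (h.mem_of_edge (Sym2.eq_swap ▸ hbc))
    · exact fun h' => hr (List.mem_cons_of_mem _ h')
    · exact fun h' => hs (List.mem_cons_of_mem _ h')

theorem dropLast_mem_head {x : V} {l : List V} (hl : l ≠ []) : x ∈ (x :: l).dropLast := by
  rw [List.dropLast_cons_of_ne_nil hl]; simp

/-- A sweep that starts along a long run in a ladder `E`, to which `X` is attached at the free
edge `ab`, gets to `ab`. -/
theorem LadderBuild.run_reaches (hk : 3 ≤ k) (h : LadderBuild k i A E F) {r x a b : V}
    {l : List V} {X : Set (Sym2 V)} (hrun : IsRun E r x l) (hl : l.length + 2 = k)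
    (hab : s(a, b) ∈ F) (ha : a ∉ (x :: l).dropLast) (hb : b ∉ (x :: l).dropLast)
    (hr : ¬ AtMostTwo (E ∪ X) r) (hX : ∀ z ∈ A, z ≠ a → z ≠ b → ∀ y, s(z, y) ∉ X)
    (haX : ∃ y, y ∉ A ∧ s(a, y) ∈ X) (hbX : ∃ y, y ∉ A ∧ s(b, y) ∈ X) :
    ∃ c d, s(c, d) = s(a, b) ∧
      Relation.ReflTransGen SweepStep (x, r, E ∪ X) (c, d, insert s(a, b) X) := by
  have hl0 : l ≠ [] := by rintro rfl; simp at hl; omega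
  have hxa : x ≠ a := by rintro rfl; exact ha (dropLast_mem_head hl0)
  have hxb : x ≠ b := by rintro rfl; exact hb (dropLast_mem_head hl0)
  induction h generalizing a b X with
  | init a₀ p hnd hlen =>
    -- In the first cycle `r` must be an end of `ab`, because `X` is attached nowhere else and `r`
    -- has three neighbours. With `b` denoting the other end, the sweep keeps `r` fixed and goes
    -- around the cycle until it reaches `b`.
    suffices H : ∀ b, s(r, b) ∈ pathEdges (a₀ :: p ++ [a₀]) → x ≠ b →
        (∀ z ∈ {v | v ∈ a₀ :: p}, z ≠ r → z ≠ b → ∀ y, s(z, y) ∉ X) →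
        Relation.ReflTransGen SweepStep (x, r, pathEdges (a₀ :: p ++ [a₀]) ∪ X)
          (b, r, insert s(r, b) X) by
      by_cases hra : r = a
      · subst hra
        exact ⟨b, r, Sym2.eq_swap, H b hab hxb hX⟩
      by_cases hrb : r = b
      · subst hrb
        refine ⟨a, r, rfl, ?_⟩
        rw [Sym2.eq_swap (a := a)]
        exact H a (Sym2.eq_swap ▸ hab) hxa fun z hz h1 h2 => hX z hz h2 h1
      exfalso
      have hbuild := LadderBuild.init (k := k) a₀ p hnd hlen
      obtain ⟨-, y, -, hy⟩ := hbuild.free_nbrs hk hrun.mem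
      refine hr ⟨x, y, fun w hw => ?_⟩
      rcases hw with hw | hw
      · exact (hy w).1 hw
      · exact absurd hw (hX r (hbuild.mem_of_edge hrun.mem) hra hrb w)
    intro b hrb hxb hX
    obtain ⟨q, h1, h2, h3, h4⟩ :=
      exists_path_of_cycle hnd (by rintro rfl; simp at hlen; omega) hrb
    rcases q with _ | ⟨y, q⟩
    · simp at h2; omega
    have hxy : x = y := by
      have := hrun.mem
      rw [h3] at this
      rcases this with h' | h'
      · exact absurd (Sym2.congr_right.1 h') hxb
      · exact (mem_pathEdges_head h1).1 h'
    subst hxy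
    have hset : pathEdges (a₀ :: p ++ [a₀]) ∪ X =
        insert s(x, r) (insert s(r, b) X ∪ pathEdges (x :: (q ++ [b]))) := by
      rw [h3, List.cons_append, pathEdges_cons_cons, Sym2.eq_swap (a := x)]
      ext; simp; tauto
    have hnd2 := List.nodup_cons.1 h1
    have hun : ∀ z ∈ x :: q, ∀ y, s(z, y) ∉ insert s(r, b) X := by
      intro z hz y h'
      have hzr : z ≠ r := by
        rintro rfl; exact hnd2.1 (List.mem_append_left _ hz)
      have hzb : z ≠ b := by
        rintro rfl
        exact (List.nodup_append.1 hnd2.2).2.2 z hz z (by simp) rfl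
      rcases h' with h' | h'
      · rcases Sym2.eq_iff.1 h' with ⟨h', -⟩ | ⟨h', -⟩
        exacts [hzr h', hzb h']
      · refine hX z ((h4 z).2 ?_) hzr hzb y h'
        exact List.mem_cons_of_mem _ (List.mem_append_left _ hz)
    rw [hset]
    refine (reaches_rung ?_).trans (reaches_path hnd2.2 (fun h' => hnd2.1 ?_) hun)
    · rintro (h' | h')
      · exact hun x (by simp) r h'
      · exact hnd2.1 (right_mem_of_pathEdges h')
    · exact List.mem_cons_of_mem _ h'
  | step i A E F h r' s' hfree p hnd hlen hnew ih =>
    have hcell := h.nodup_cell hfree (h.free_nbrs hk hfree).1 hnd hnew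
    have hr' : r' ∉ (x :: l).dropLast := fun h' =>
      h.not_atMostTwo hk hfree hlen hnew (hrun.two h')
    have hs' : s' ∉ (x :: l).dropLast := fun h' => by
      have hrev : s' :: (p.reverse ++ [r']) = (r' :: (p ++ [s'])).reverse := by simp
      have := h.not_atMostTwo hk (Sym2.eq_swap ▸ hfree) (p := p.reverse) (by simpa using hlen)
        (by simpa using hnew)
      rw [hrev, pathEdges_reverse] at this
      exact this (hrun.two h')
    -- The run does not start inside this cell: the edge `ab`, where `X` is attached, divides the
    -- cell into two sides with fewer than `k - 2` inner vertices each. By `IsRun.blocked` the run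
    -- would pass through an end of its side, but these ends are excluded.
    have hxp : x ∉ p := by
      have H : ∀ a b p₁ p₂, p = p₁ ++ a :: b :: p₂ → a ∉ (x :: l).dropLast →
          b ∉ (x :: l).dropLast → x ≠ a → x ≠ b → x ∉ p := by
        intro a b p₁ p₂ hp ha hb hxa hxb hx
        have hxA := hnew x hx
        have heq : r' :: (p ++ [s']) = (r' :: (p₁ ++ [a])) ++ (b :: (p₂ ++ [s'])) := by simp [hp]
        have hn := hcell
        rw [heq] at hn
        obtain ⟨n1, n2, n3⟩ := List.nodup_append.1 hn
        have hE : ∀ z ∈ p, ∀ y, s(z, y) ∈ E ∪ pathEdges (r' :: (p ++ [s'])) ↔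
            s(z, y) = s(a, b) ∨ s(z, y) ∈ pathEdges (r' :: (p₁ ++ [a])) ∨
              s(z, y) ∈ pathEdges (b :: (p₂ ++ [s'])) := by
          intro z hz y
          have : s(z, y) ∉ E := fun h' => hnew z hz (h.mem_of_edge h')
          rw [Set.mem_union, or_iff_right this, hp, pathEdges_cell]
          rfl
        have hp12 : x ∈ p₁ ∨ x ∈ p₂ := by
          rw [hp] at hx; simp [hxa, hxb] at hx; exact hx
        rcases hp12 with hx1 | hx2
        · refine (hrun.blocked n1 (fun z hz y => ?_) hx1 (by simp [hp] at hlen; omega)).elim hr' ha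
          · have hz1 : z ∉ b :: (p₂ ++ [s']) := fun h' =>
              n3 z (by simp [hz]) z h' rfl
            have hza : z ≠ a := by
              rintro rfl
              exact (List.nodup_append.1 (List.nodup_cons.1 n1).2).2.2 z hz z (by simp) rfl
            have hzb : z ≠ b := by rintro rfl; exact hz1 (by simp)
            erw [hE z (by simp [hp, hz])]
            rw [or_iff_right, or_iff_left]
            · exact fun h' => hz1 (left_mem_of_pathEdges h')
            · intro h'
              rcases Sym2.eq_iff.1 h' with ⟨h', -⟩ | ⟨h', -⟩
              exacts [hza h', hzb h']
        · refine (hrun.blocked n2 (fun z hz y => ?_) hx2 (by simp [hp] at hlen; omega)).elim hb hs'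
          · have hz1 : z ∉ r' :: (p₁ ++ [a]) := fun h' =>
              n3 z h' z (by simp [hz]) rfl
            have hza : z ≠ a := by rintro rfl; exact hz1 (by simp)
            have hzb : z ≠ b := by
              rintro rfl
              exact (List.nodup_cons.1 n2).1 (by simp [hz])
            erw [hE z (by simp [hp, hz])]
            rw [or_iff_right, or_iff_right]
            · exact fun h' => hz1 (left_mem_of_pathEdges h')
            · intro h'
              rcases Sym2.eq_iff.1 h' with ⟨h', -⟩ | ⟨h', -⟩
              exacts [hza h', hzb h']
      obtain ⟨p₁, p₂, hp | hp⟩ := exists_eq_of_mem_pathEdges hab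
      · exact H a b p₁ p₂ hp ha hb hxa hxb
      · exact H b a p₁ p₂ hp hb ha hxb hxa
    have hxr' : x ≠ r' := by rintro rfl; exact hr' (dropLast_mem_head hl0)
    have hxs' : x ≠ s' := by rintro rfl; exact hs' (dropLast_mem_head hl0)
    have hrx : s(r, x) ∈ E := by
      refine hrun.mem.resolve_right fun h' => ?_
      have := right_mem_of_pathEdges h'
      simp [hxr', hxs', hxp] at this
    have hrun' := h.isRun_of_step hrun hrx hxp hnew hr' hs'
    have hapA : a ∈ p := left_mem_of_pathEdges hab
    have hbpA : b ∈ p := right_mem_of_pathEdges hab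
    have hr'A : r' ∈ A := h.mem_of_edge (h.free_subset hfree)
    have hs'A : s' ∈ A := h.mem_of_edge (Sym2.eq_swap ▸ h.free_subset hfree)
    have hp0 : p ≠ [] := by rintro rfl; simp at hapA
    -- The edges of the present cell are moved into the attached part `X`; the smaller ladder is
    -- swept first, and then this cell is crossed from `r's'` to `ab`.
    obtain ⟨c, d, hcd, hreach⟩ := ih (a := r') (b := s') (X := pathEdges (r' :: (p ++ [s'])) ∪ X)
      hrun' hfree hr' hs' (by rw [← Set.union_assoc]; exact hr) (by
        rintro z hz h1 h2 y (h' | h')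
        · have := left_mem_of_pathEdges h'
          simp only [List.mem_cons, List.mem_append, List.not_mem_nil, or_false] at this
          rcases this with h' | h' | h'
          exacts [h1 h', hnew z h' hz, h2 h']
        · refine hX z (.inl hz) ?_ ?_ y h'
          · rintro rfl; exact hnew z hapA hz
          · rintro rfl; exact hnew z hbpA hz) (by
        obtain ⟨y, p', rfl⟩ := List.exists_cons_of_ne_nil hp0
        exact ⟨y, hnew y (by simp), .inl (by simp)⟩) (by
        obtain ⟨p', y, rfl⟩ : ∃ q' x, p = q' ++ [x] :=
          ⟨_, _, (List.dropLast_append_getLast hp0).symm⟩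
        refine ⟨y, hnew y (by simp), .inl ?_⟩
        have : r' :: (p' ++ [y] ++ [s']) = (r' :: p') ++ y :: s' :: [] := by simp
        rw [this, Sym2.eq_swap]
        exact mem_pathEdges_of_eq) hxr' hxs'
    have hcross : ∀ c d p', (c :: (p' ++ [d])).Nodup → s(a, b) ∈ pathEdges p' →
        (∀ z ∈ c :: (p' ++ [d]), z ∈ A ∪ {v | v ∈ p}) →
        ∃ c' d', s(c', d') = s(a, b) ∧ Relation.ReflTransGen SweepStep
          (c, d, insert s(c, d) (pathEdges (c :: (p' ++ [d])) ∪ X))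
          (c', d', insert s(a, b) X) := by
      intro c d p' hnd' hab' hsub
      refine reaches_cell_edge hnd' hab' (fun z hz => hX z (hsub z hz)) ?_ ?_
      · obtain ⟨y, hy, hy'⟩ := haX
        exact ⟨y, by rintro rfl; exact hy (.inr hbpA), hy'⟩
      · obtain ⟨y, hy, hy'⟩ := hbX
        exact ⟨y, by rintro rfl; exact hy (.inr hapA), hy'⟩
    have hset : E ∪ pathEdges (r' :: p ++ [s']) ∪ X =
        E ∪ (pathEdges (r' :: (p ++ [s'])) ∪ X) := Set.union_assoc _ _ _
    rw [hset]
    rcases Sym2.eq_iff.1 hcd with ⟨rfl, rfl⟩ | ⟨rfl, rfl⟩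
    · obtain ⟨c', d', h1, h2⟩ := hcross c d p hcell hab (by
        intro z hz
        simp only [List.mem_cons, List.mem_append, List.not_mem_nil, or_false] at hz
        rcases hz with rfl | hz | rfl
        exacts [.inl hr'A, .inr hz, .inl hs'A])
      exact ⟨c', d', h1, hreach.trans h2⟩
    · have hrev : c :: (p.reverse ++ [d]) = (d :: (p ++ [c])).reverse := by simp
      obtain ⟨c', d', h1, h2⟩ := hcross c d p.reverse
        (by rw [hrev]; exact List.nodup_reverse.2 hcell)
        (by rw [pathEdges_reverse]; exact hab) (by
        intro z hz
        rw [hrev, List.mem_reverse] at hz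
        simp only [List.mem_cons, List.mem_append, List.not_mem_nil, or_false] at hz
        rcases hz with rfl | hz | rfl
        exacts [.inl hr'A, .inr hz, .inl hs'A])
      rw [hrev, pathEdges_reverse, hcd] at h2
      exact ⟨c', d', h1, hreach.trans h2⟩

end LadderRuns

end LadderTrees

namespace LadderTrees

/-! ### Existence and correctness of starts; degrees and sizes of ladders. -/

section LadderStart

variable {V : Type} {k i : ℕ} {A : Set V} {E F : Set (Sym2 V)}

/-- In a ladder with at least two cells, a sweep that starts along a run of length `k - 1` at
a vertex of degree three completes. -/
theorem LadderBuild.completes_run (hk : 3 ≤ k) (h : LadderBuild k i A E F) (hi : 2 ≤ i) {r x : V}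
    {l : List V} (hrun : IsRun E r x l) (hl : l.length + 2 = k) (hr : ¬ AtMostTwo E r) :
    Completes (x, r, E) := by
  cases h with
  | init => omega
  | step i A E F h r' s' hfree p hnd hlen hnew =>
  have hl0 : l ≠ [] := by rintro rfl; simp at hl; omega
  have hne := (h.free_nbrs hk hfree).1
  have hcell := h.nodup_cell hfree hne hnd hnew
  have hr'A : r' ∈ A := h.mem_of_edge (h.free_subset hfree)
  have hs'A : s' ∈ A := h.mem_of_edge (Sym2.eq_swap ▸ h.free_subset hfree)
  have hp0 : p ≠ [] := by rintro rfl; simp at hlen; omega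
  have hrev : s' :: (p.reverse ++ [r']) = (r' :: (p ++ [s'])).reverse := by simp
  -- If the run starts into the last cell, then `r` is an end of the edge shared with the smaller
  -- ladder, as the new vertices have degree two; the sweep goes around this cell and then down.
  -- Otherwise the run lies in the smaller ladder, and the sweep climbs to the last cell and
  -- finishes it as a cycle.
  by_cases hxp : x ∈ p
  · have hedge : s(r, x) ∈ pathEdges (r' :: (p ++ [s'])) :=
      hrun.mem.resolve_left fun h' => hnew x hxp (h.mem_of_edge (Sym2.eq_swap ▸ h'))
    have hrp : r ∉ p := fun h' => hr (h.atMostTwo_new hcell hnew h')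
    have H : ∀ s p, (r :: (p ++ [s])).Nodup → s(r, x) ∈ pathEdges (r :: (p ++ [s])) →
        p ≠ [] → s(r, s) ∈ F → (∀ v ∈ p, v ∉ A) →
        Completes (x, r, E ∪ pathEdges (r :: (p ++ [s]))) := by
      intro s p hnd hx hp hfree hnew
      obtain ⟨y, q, rfl⟩ := List.exists_cons_of_ne_nil hp
      obtain rfl : x = y := (mem_pathEdges_head hnd).1 hx
      refine Completes.of_reaches ?_ (h.completes hk (r := s) (s := r) (Sym2.eq_swap ▸ hfree))
      rw [List.cons_append, pathEdges_cons_cons, Set.union_insert, Sym2.eq_swap (a := r)]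
      have hnd2 := List.nodup_cons.1 hnd
      refine (reaches_rung ?_).trans (reaches_path hnd2.2 (fun h' => hnd2.1 ?_) ?_)
      · rintro (h' | h')
        · exact hnew x (by simp) (h.mem_of_edge h')
        · exact hnd2.1 (right_mem_of_pathEdges h')
      · exact List.mem_cons_of_mem _ h'
      · exact fun z hz y h' => hnew z hz (h.mem_of_edge h')
    have hrmem := left_mem_of_pathEdges hedge
    simp only [List.mem_cons, List.mem_append, List.not_mem_nil, or_false, hrp, false_or] at hrmem
    rcases hrmem with rfl | rfl
    · exact H s' p hcell hedge hp0 hfree hnew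
    · have := H r' p.reverse (by rw [hrev]; exact List.nodup_reverse.2 hcell)
        (by rw [hrev, pathEdges_reverse]; exact hedge) (by simpa using hp0)
        (Sym2.eq_swap ▸ hfree) (by simpa using hnew)
      rw [hrev, pathEdges_reverse] at this
      exact this
  · have hr' : r' ∉ (x :: l).dropLast := fun h' =>
      h.not_atMostTwo hk hfree hlen hnew (hrun.two h')
    have hs' : s' ∉ (x :: l).dropLast := fun h' => by
      have := h.not_atMostTwo hk (Sym2.eq_swap ▸ hfree) (p := p.reverse) (by simpa using hlen)
        (by simpa using hnew)
      rw [hrev, pathEdges_reverse] at this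
      exact this (hrun.two h')
    have hxr' : x ≠ r' := by rintro rfl; exact hr' (dropLast_mem_head hl0)
    have hxs' : x ≠ s' := by rintro rfl; exact hs' (dropLast_mem_head hl0)
    have hrx : s(r, x) ∈ E := by
      refine hrun.mem.resolve_right fun h' => ?_
      have := right_mem_of_pathEdges h'
      simp [hxr', hxs', hxp] at this
    obtain ⟨c, d, hcd, hreach⟩ := h.run_reaches hk
      (h.isRun_of_step hrun hrx hxp hnew hr' hs') hl hfree hr' hs' hr (by
        intro z hz h1 h2 y h'
        have := left_mem_of_pathEdges h'
        simp only [List.cons_append, List.mem_cons, List.mem_append, List.not_mem_nil,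
          or_false] at this
        rcases this with h' | h' | h'
        exacts [h1 h', hnew z h' hz, h2 h']) (by
        obtain ⟨y, p', rfl⟩ := List.exists_cons_of_ne_nil hp0
        exact ⟨y, hnew y (by simp), by simp⟩) (by
        obtain ⟨p', y, rfl⟩ : ∃ q' x, p = q' ++ [x] :=
          ⟨_, _, (List.dropLast_append_getLast hp0).symm⟩
        refine ⟨y, hnew y (by simp), ?_⟩
        have : r' :: (p' ++ [y]) ++ [s'] = (r' :: p') ++ y :: s' :: [] := by simp
        rw [this, Sym2.eq_swap]
        exact mem_pathEdges_of_eq)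
    refine Completes.of_reaches hreach ?_
    rcases Sym2.eq_iff.1 hcd with ⟨rfl, rfl⟩ | ⟨rfl, rfl⟩
    · exact completes_cycle hcell hp0
    · have := completes_cycle (r := c) (s := d) (q := p.reverse)
        (by rw [hrev]; exact List.nodup_reverse.2 hcell) (by simpa using hp0)
      rwa [hrev, pathEdges_reverse, hcd] at this

/-- In a ladder with at least two cells there is a run of length `k - 1` at a vertex of degree
three. -/
theorem LadderBuild.exists_run (hk : 3 ≤ k) (h : LadderBuild k i A E F) (hi : 2 ≤ i) :
    ∃ r x l, IsRun E r x l ∧ l.length + 2 = k ∧ ¬ AtMostTwo E r := by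
  cases h with
  | init => omega
  | step i A E F h r s hfree p hnd hlen hnew =>
  have hcell := h.nodup_cell hfree (h.free_nbrs hk hfree).1 hnd hnew
  have hr := h.not_atMostTwo hk hfree hlen hnew
  obtain ⟨x, q, rfl⟩ := List.exists_cons_of_ne_nil (l := p) (by rintro rfl; simp at hlen; omega)
  refine ⟨r, x, q ++ [s], isRun_of_path (l₁ := []) hcell (fun z hz y => ?_) (.inr (by simp)),
    by simpa using hlen, hr⟩
  rw [← List.cons_append, List.dropLast_concat] at hz
  have : s(z, y) ∉ E := fun h' => hnew z hz (h.mem_of_edge h')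
  exact or_iff_right this

/-- Every edge of a cycle is a possible start of the sweep. -/
theorem LadderBuild.completes_cycle (hk : 3 ≤ k) (h : LadderBuild k 1 A E F) {r s : V}
    (hrs : s(r, s) ∈ E) : Completes (r, s, E) := by
  refine h.completes hk ?_
  cases h with
  | init => exact hrs
  | step i A E F h =>
    exfalso
    cases h

/-- A vertex of a ladder has at most three neighbours. -/
theorem LadderBuild.nbrs (hk : 3 ≤ k) (h : LadderBuild k i A E F) (v : V) :
    ∃ a b c, ∀ w, s(v, w) ∈ E → w = a ∨ w = b ∨ w = c := by
  induction h generalizing v with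
  | init a₀ p hnd hlen =>
    by_cases hv : ∃ w, s(v, w) ∈ pathEdges (a₀ :: p ++ [a₀])
    · obtain ⟨w, hw⟩ := hv
      obtain ⟨-, x, -, hx⟩ := (LadderBuild.init a₀ p hnd hlen).free_nbrs hk hw
      exact ⟨w, x, x, fun y hy => by have := (hx y).1 hy; tauto⟩
    · exact ⟨v, v, v, fun w hw => absurd ⟨w, hw⟩ hv⟩
  | step i A E F h r s hfree p hnd hlen hnew ih =>
    have hcell := h.nodup_cell hfree (h.free_nbrs hk hfree).1 hnd hnew
    have hp0 : p ≠ [] := by rintro rfl; simp at hlen; omega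
    have H : ∀ s p, s(v, s) ∈ F → (v :: (p ++ [s])).Nodup → p ≠ [] →
        ∃ a b c, ∀ w, s(v, w) ∈ E ∪ pathEdges (v :: (p ++ [s])) → w = a ∨ w = b ∨ w = c := by
      intro s p hfree hcell hp0
      obtain ⟨-, x, -, hx⟩ := h.free_nbrs hk hfree
      obtain ⟨y, q, rfl⟩ := List.exists_cons_of_ne_nil hp0
      refine ⟨s, x, y, fun w hw => ?_⟩
      rcases hw with hw | hw
      · have := (hx w).1 hw; tauto
      · exact .inr (.inr ((mem_pathEdges_head hcell).1 hw))
    by_cases hvr : v = r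
    · subst hvr
      exact H s p hfree hcell hp0
    by_cases hvs : v = s
    · subst hvs
      have hrev : v :: (p.reverse ++ [r]) = (r :: (p ++ [v])).reverse := by simp
      have := H r p.reverse (Sym2.eq_swap ▸ hfree)
        (by rw [hrev]; exact List.nodup_reverse.2 hcell) (by simpa using hp0)
      rw [hrev, pathEdges_reverse] at this
      exact this
    by_cases hvp : v ∈ p
    · obtain ⟨y, z, hyz⟩ := h.atMostTwo_new hcell hnew hvp
      exact ⟨y, z, z, fun w hw => by have := hyz w hw; tauto⟩
    · obtain ⟨a, b, c, habc⟩ := ih v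
      refine ⟨a, b, c, fun w hw => habc w (hw.resolve_right fun h' => ?_)⟩
      have := left_mem_of_pathEdges h'
      simp [hvr, hvs, hvp] at this

/-- Every vertex of a ladder is in an edge. -/
theorem LadderBuild.exists_edge (h : LadderBuild k i A E F) {v : V} (hv : v ∈ A) :
    ∃ w, s(v, w) ∈ E := by
  have H : ∀ (r s : V) (p : List V), v ∈ r :: p → ∃ w, s(v, w) ∈ pathEdges (r :: p ++ [s]) := by
    intro r s p hv
    obtain ⟨p₁, p₂, hp⟩ := List.append_of_mem hv
    rw [hp]
    rcases p₂ with _ | ⟨b, p₂⟩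
    · exact ⟨s, by simpa using mem_pathEdges_of_eq (x := v) (y := s) (l₁ := p₁) (l₂ := [])⟩
    · exact ⟨b, by
        simpa using mem_pathEdges_of_eq (x := v) (y := b) (l₁ := p₁) (l₂ := p₂ ++ [s])⟩
  induction h with
  | init a p => exact H a a p hv
  | step i A E F h r s hfree p hnd hlen hnew ih =>
    rcases hv with hv | hv
    · obtain ⟨w, hw⟩ := ih hv
      exact ⟨w, .inl hw⟩
    · obtain ⟨w, hw⟩ := H r s p (List.mem_cons_of_mem _ hv)
      exact ⟨w, .inr hw⟩

/-- All but `2 n` vertices of a ladder have at most two neighbours. -/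
theorem LadderBuild.exists_exceptions (hk : 3 ≤ k) (h : LadderBuild k i A E F) :
    ∃ L : List V, L.length ≤ 2 * i ∧ ∀ v, v ∉ L → AtMostTwo E v := by
  induction h with
  | init a₀ p hnd hlen =>
    refine ⟨[], by simp, fun v _ => ?_⟩
    by_cases hv : ∃ w, s(v, w) ∈ pathEdges (a₀ :: p ++ [a₀])
    · obtain ⟨w, hw⟩ := hv
      obtain ⟨-, x, -, hx⟩ := (LadderBuild.init a₀ p hnd hlen).free_nbrs hk hw
      exact ⟨w, x, fun y hy => (hx y).1 hy⟩
    · exact ⟨v, v, fun w hw => absurd ⟨w, hw⟩ hv⟩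
  | step i A E F h r s hfree p hnd hlen hnew ih =>
    obtain ⟨L, hL, h2⟩ := ih
    have hcell := h.nodup_cell hfree (h.free_nbrs hk hfree).1 hnd hnew
    -- Only the ends `r`, `s` of the edge used for fusing gain a neighbour, hence two exceptions per
    -- cell.
    refine ⟨r :: s :: L, by simp; omega, fun v hv => ?_⟩
    simp only [List.mem_cons, not_or] at hv
    by_cases hvp : v ∈ p
    · exact h.atMostTwo_new hcell hnew hvp
    · obtain ⟨a, b, hab⟩ := h2 v hv.2.2
      refine ⟨a, b, fun w hw => hab w (hw.resolve_right fun h' => ?_)⟩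
      have := left_mem_of_pathEdges h'
      simp [hv.1, hv.2.1, hvp] at this

theorem exists_list_pathEdges (l : List V) :
    ∃ L : List (Sym2 V), L.length = l.length - 1 ∧ ∀ e ∈ pathEdges l, e ∈ L := by
  induction l with
  | nil => exact ⟨[], rfl, fun e he => he.elim⟩
  | cons a l ih =>
    cases l with
    | nil => exact ⟨[], rfl, fun e he => he.elim⟩
    | cons b l =>
      obtain ⟨L, hL, h⟩ := ih
      refine ⟨s(a, b) :: L, by simp at hL ⊢; omega, fun e he => ?_⟩
      rcases he with rfl | he
      · simp
      · exact List.mem_cons_of_mem _ (h e he)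

/-- A ladder has at most `k n` vertices and at most `k n` edges. -/
theorem LadderBuild.exists_lists (h : LadderBuild k i A E F) :
    (∃ L : List V, L.length ≤ k * i ∧ ∀ v ∈ A, v ∈ L) ∧
      ∃ L : List (Sym2 V), L.length ≤ k * i ∧ ∀ e ∈ E, e ∈ L := by
  induction h with
  | init a p hnd hlen =>
    obtain ⟨L, hL, h⟩ := exists_list_pathEdges (a :: p ++ [a])
    exact ⟨⟨a :: p, by simp [hlen], fun v hv => hv⟩, L, by simp at hL; omega, h⟩
  | step i A E F h r s hfree p hnd hlen hnew ih =>
    obtain ⟨⟨L₁, h1, h2⟩, L₂, h3, h4⟩ := ih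
    obtain ⟨L, hL, h5⟩ := exists_list_pathEdges (r :: p ++ [s])
    refine ⟨⟨p ++ L₁, ?_, ?_⟩, L ++ L₂, ?_, ?_⟩
    · simp only [List.length_append, mul_add, mul_one]; omega
    · rintro v (hv | hv)
      · exact List.mem_append_right _ (h2 v hv)
      · exact List.mem_append_left _ hv
    · simp only [List.length_append, mul_add, mul_one]; simp at hL; omega
    · rintro e (he | he)
      · exact List.mem_append_right _ (h4 e he)
      · exact List.mem_append_left _ (h5 e he)

end LadderStart

end LadderTrees

namespace LadderTrees

/-! ## Frames -/

/-- The program contains an assignment to array `a` of natural numbers. -/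
def Program.Writes (a : ℕ) : Program → Prop
  | setNat b _ _ _ => a = b
  | comp P Q => P.Writes a ∨ Q.Writes a
  | branch _ P Q => P.Writes a ∨ Q.Writes a
  | loop _ P => P.Writes a
  | _ => False

/-- The program contains no assignment to a real number. -/
def Program.NatOnly : Program → Prop
  | setReal _ _ _ _ => False
  | comp P Q => P.NatOnly ∧ Q.NatOnly
  | branch _ P Q => P.NatOnly ∧ Q.NatOnly
  | loop _ P => P.NatOnly
  | _ => True

attribute [simp] Program.Writes Program.NatOnly

/-- A syntactic criterion that also covers loops, so that loop invariants need not mention arrays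
the program never assigns. -/
theorem Program.Run.frame {P : Program} {σ τ : Store} {t : ℕ} (h : P.Run σ t τ) :
    (∀ a, ¬ P.Writes a → τ.nat a = σ.nat a) ∧ (P.NatOnly → τ.real = σ.real) := by
  induction h with
  | skip | loopFalse => exact ⟨fun _ _ => rfl, fun _ => rfl⟩
  | setNat σ a i j x =>
    refine ⟨fun b hb => ?_, fun _ => rfl⟩
    have : b ≠ a := hb
    funext i' j'
    simp [this]
  | setReal => exact ⟨fun _ _ => rfl, fun h => h.elim⟩
  | comp P Q σ τ υ t u _ _ ihP ihQ =>
    refine ⟨fun a ha => ?_, fun h => (ihQ.2 h.2).trans (ihP.2 h.1)⟩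
    exact (ihQ.1 a fun h => ha (.inr h)).trans (ihP.1 a fun h => ha (.inl h))
  | branchTrue b P Q σ τ t _ _ ih =>
    exact ⟨fun a ha => ih.1 a fun h => ha (.inl h), fun h => ih.2 h.1⟩
  | branchFalse b P Q σ τ t _ _ ih =>
    exact ⟨fun a ha => ih.1 a fun h => ha (.inr h), fun h => ih.2 h.2⟩
  | loopTrue b P σ τ υ t u _ _ _ ihP ihL =>
    exact ⟨fun a ha => (ihL.1 a ha).trans (ihP.1 a ha), fun h => (ihL.2 h).trans (ihP.2 h)⟩

theorem Program.Ensures.frame {P : Program} {σ : Store} {B : ℕ} {Q : Store → Prop}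
    (h : P.Ensures σ B Q) : P.Ensures σ B fun τ =>
      Q τ ∧ (∀ a, ¬ P.Writes a → τ.nat a = σ.nat a) ∧ (P.NatOnly → τ.real = σ.real) := by
  obtain ⟨t, τ, hr, ht, hq⟩ := h
  exact ⟨t, τ, hr, ht, hq, hr.frame⟩

/-! ## The table of conflicts -/

/-- Enter the conflict pair number `i` into the table, where `i` is the scalar 19. -/
def markStep : Program :=
  .seq [.setNat 7 (.cell 4 (.reg 19) (.const 0)) (.cell 4 (.reg 19) (.const 1)) (.const 1),
    .setNat 7 (.cell 4 (.reg 19) (.const 1)) (.cell 4 (.reg 19) (.const 0)) (.const 1),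
    .setReg 19 (.succ (.reg 19))]

/-- Turn the list of conflict pairs into a table. -/
def markProg : Program :=
  .loop (.neg (.natEq (.reg 19) (.cell 0 (.const 0) (.const 4)))) markStep

/-- The table is blank initially, so only the listed pairs have to be entered, in both orders; the
time is proportional to the number of pairs and not to the size of the table. -/
theorem ensures_markProg {σ : Store} (h7 : ∀ x y, σ.nat 7 x y = 0) (h19 : σ.nat 19 0 0 = 0) :
    markProg.Ensures σ (σ.nat 0 0 4 * (markStep.cost + 8 + 1) + 8 + 1) fun τ =>
      ∀ x y, τ.nat 7 x y = 0 ↔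
        ¬ ∃ i < σ.nat 0 0 4, s(σ.nat 4 i 0, σ.nat 4 i 1) = s(x, y) := by
  refine (Program.Ensures.loop_count markStep.cost
    (fun r τ => τ.nat 0 = σ.nat 0 ∧ τ.nat 4 = σ.nat 4 ∧ r + τ.nat 19 0 0 = σ.nat 0 0 4 ∧
      ∀ x y, τ.nat 7 x y = 0 ↔
        ¬ ∃ i < τ.nat 19 0 0, s(σ.nat 4 i 0, σ.nat 4 i 1) = s(x, y)) ?_
      ⟨rfl, rfl, by simp [h19], fun x y => by simp [h7, h19]⟩).mono le_rfl ?_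
  · rintro r τ ⟨h0, h4, hr, hτ⟩ hb
    have hne : τ.nat 19 0 0 ≠ σ.nat 0 0 4 := by simpa [h0] using hb
    have hlf : markStep.LoopFree := by simp [markStep, Program.seq]
    refine ⟨r - 1, by omega, hlf.ensures ⟨?_, ?_, ?_, fun x y => ?_⟩⟩
    · funext i j; simp [markStep, h0]
    · funext i j; simp [markStep, h4]
    · simp [markStep]; omega
    · have h := hτ x y
      generalize hc : τ.nat 19 0 0 = c at h
      have key : (∃ i < c + 1, s(σ.nat 4 i 0, σ.nat 4 i 1) = s(x, y)) ↔
          (∃ i < c, s(σ.nat 4 i 0, σ.nat 4 i 1) = s(x, y)) ∨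
            s(σ.nat 4 c 0, σ.nat 4 c 1) = s(x, y) := by
        constructor
        · rintro ⟨i, hi, h'⟩
          rcases Nat.lt_succ_iff_lt_or_eq.1 hi with hi | rfl
          exacts [.inl ⟨i, hi, h'⟩, .inr h']
        · rintro (⟨i, hi, h'⟩ | h')
          exacts [⟨i, by omega, h'⟩, ⟨c, by omega, h'⟩]
      have e19 : (markStep.exec τ).nat 19 0 0 = c + 1 := by simp [markStep, hc]
      have e7 : (markStep.exec τ).nat 7 x y =
          if x = σ.nat 4 c 1 ∧ y = σ.nat 4 c 0 then 1 else
          if x = σ.nat 4 c 0 ∧ y = σ.nat 4 c 1 then 1 else τ.nat 7 x y := by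
        simp [markStep, hc, h4]
      rw [e19, e7, key, Sym2.eq_iff]
      split_ifs with h1 h2
      · simp [h1]
      · simp [h2]
      · rw [h]
        have h1' : ¬ (σ.nat 4 c 0 = y ∧ σ.nat 4 c 1 = x) := fun h' => h1 ⟨h'.2.symm, h'.1.symm⟩
        have h2' : ¬ (σ.nat 4 c 0 = x ∧ σ.nat 4 c 1 = y) := fun h' => h2 ⟨h'.1.symm, h'.2.symm⟩
        simp [h1', h2']
  · rintro τ ⟨r, ⟨h0, -, hr, hτ⟩, hb⟩
    have heq : τ.nat 19 0 0 = σ.nat 0 0 4 := by simpa [h0] using hb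
    rwa [heq] at hτ

/-! ### From the encoded input to the invariants of the sweep. -/

section Encodes

variable {k n N m : ℕ} {G : SimpleGraph (Fin N)} {edge : Fin m ≃ G.edgeSet}
  {S : Finset (Sym2 G.edgeSet)} {σ : Store}

/-- Different positions of the incidence list of `v` hold different edges, whose other ends are
different vertices among the at most three neighbours. -/
theorem EncodesGraph.degree_le (h : EncodesGraph k n G edge σ)
    (hN : ∀ v, ∃ a b c, ∀ w, s(v, w) ∈ G.edgeSet → w = a ∨ w = b ∨ w = c) (v : Fin N) :
    σ.nat 2 v 0 ≤ 3 := by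
  obtain ⟨a, b, c, habc⟩ := hN v
  have hinc := h.incidence v
  have hex : ∀ i : Fin (σ.nat 2 v 0), ∃ (e : Fin m) (w : Fin N), σ.nat 3 v i = e ∧
      (edge e : Sym2 (Fin N)) = s(v, w) := fun i => by
    obtain ⟨e, hv, he⟩ := hinc.mapsTo i.2
    obtain ⟨w, hw⟩ := Sym2.mem_iff_exists.1 hv
    exact ⟨e, w, he, hw⟩
  choose e w he hw using hex
  have hinj : Function.Injective w := fun i j hij => by
    have : edge (e i) = edge (e j) := Subtype.ext (by rw [hw, hw, hij])
    have h' := edge.injective this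
    exact Fin.ext (hinc.injOn i.2 j.2 (by rw [he, he, h']))
  have hcard : (Finset.univ.image w).card = σ.nat 2 v 0 := by
    rw [Finset.card_image_of_injective _ hinj, Finset.card_fin]
  rw [← hcard]
  refine (Finset.card_le_card (t := {a, b, c}) fun x hx => ?_).trans Finset.card_le_three
  obtain ⟨i, -, rfl⟩ := Finset.mem_image.1 hx
  have := habc (w i) (hw i ▸ (edge (e i)).2)
  simpa using this

theorem EncodesGraph.exists_pos (h : EncodesGraph k n G edge σ)
    (hN : ∀ v, ∃ a b c, ∀ w, s(v, w) ∈ G.edgeSet → w = a ∨ w = b ∨ w = c) {v : Fin N}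
    {e : G.edgeSet} (he : v ∈ (e : Sym2 (Fin N))) : ∃ j, atOf edge σ v j e := by
  obtain ⟨i, hi, hie⟩ := (h.incidence v).surjOn ⟨edge.symm e, by simpa using he, rfl⟩
  have hi' : i < σ.nat 2 v 0 := hi
  exact ⟨⟨i, by have := h.degree_le hN v; omega⟩, hi', hie⟩

theorem EncodesGraph.prepared (h : EncodesGraph k n G edge σ)
    (hN : ∀ v, ∃ a b c, ∀ w, s(v, w) ∈ G.edgeSet → w = a ∨ w = b ∨ w = c) {τ : Store}
    (hτ : ∀ a, a ≤ 3 → τ.nat a = σ.nat a)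
    (hS : ∀ e f : G.edgeSet, τ.nat 7 (edge.symm e) (edge.symm f) = 0 ↔ s(e, f) ∉ S) :
    Prepared edge S τ := by
  have hat : atOf edge τ = atOf edge σ := by
    funext v j e
    rw [atOf, hτ 2 (by omega), hτ 3 (by omega), atOf]
  have hedge : ∀ {v : Fin N} {j : Fin 3}, (j : ℕ) < σ.nat 2 v 0 →
      ∃ e : G.edgeSet, v ∈ (e : Sym2 (Fin N)) ∧ atOf edge σ v j e := fun {v j} hj => by
    obtain ⟨e, hv, he⟩ := (h.incidence v).mapsTo hj
    exact ⟨edge e, hv, hj, by simpa using he⟩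
  have huniq : ∀ {v j e e'}, atOf edge σ v j e → atOf edge σ v j e' → e = e' :=
    fun h1 h2 => edge.symm.injective (Fin.ext (h1.2.symm.trans h2.2))
  refine ⟨by rw [hτ 0 (by omega), h.numEdges], fun e => ?_, hat ▸ ⟨?_, h.exists_pos hN, ?_, huniq⟩,
    fun v j hj => ?_, hS⟩
  · rw [hτ 1 (by omega)]
    simpa using h.ends (edge.symm e)
  · intro v j e he
    obtain ⟨e', hv, he'⟩ := hedge he.1
    rwa [huniq he he']
  · intro v j j' e h1 h2
    exact Fin.ext ((h.incidence v).injOn h1.1 h2.1 (h1.2.trans h2.2.symm))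
  · rw [hτ 2 (by omega)] at hj
    obtain ⟨e, -, he⟩ := hedge hj
    exact ⟨e, hat ▸ he⟩

theorem EncodesConflicts.mem_iff (h : EncodesConflicts edge S σ) (e f : G.edgeSet) :
    s(e, f) ∈ S ↔ ∃ i < σ.nat 0 0 4,
      s(σ.nat 4 i 0, σ.nat 4 i 1) = s((edge.symm e : ℕ), (edge.symm f : ℕ)) := by
  constructor
  · intro he
    exact h.surjOn ⟨s(e, f), he, rfl⟩
  · rintro ⟨i, hi, hie⟩
    obtain ⟨x, hx, hxe⟩ := h.mapsTo hi
    have hinj : Function.Injective (fun e : G.edgeSet => (edge.symm e : ℕ)) :=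
      Fin.val_injective.comp edge.symm.injective
    have : x = s(e, f) := Sym2.map.injective hinj (hxe.trans hie)
    exact this ▸ hx

/-- A conflict pair is determined by a common vertex of its edges and their two positions in the
incidence list there, which gives at most `3 * 3` pairs per vertex. -/
theorem EncodesConflicts.length_le (h : EncodesConflicts edge S σ)
    (hG : EncodesGraph k n G edge σ)
    (hN : ∀ v, ∃ a b c, ∀ w, s(v, w) ∈ G.edgeSet → w = a ∨ w = b ∨ w = c)
    (hS : AdjacentConflicts G S) : σ.nat 0 0 4 ≤ 9 * N := by
  let L : Finset (Sym2 ℕ) := (Finset.univ : Finset (Fin N × Fin 3 × Fin 3)).image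
    fun x => s(σ.nat 3 x.1 x.2.1, σ.nat 3 x.1 x.2.2)
  have hL : L.card ≤ 9 * N := Finset.card_image_le.trans (by simp [mul_comm])
  have hmaps : ∀ i ∈ Finset.range (σ.nat 0 0 4), s(σ.nat 4 i 0, σ.nat 4 i 1) ∈ L := by
    intro i hi
    obtain ⟨x, hx, hxi⟩ := h.mapsTo (Finset.mem_range.1 hi)
    induction x using Sym2.ind with
    | _ e f =>
      obtain ⟨-, v, hve, hvf⟩ := hS e f hx
      obtain ⟨j, hj⟩ := hG.exists_pos hN hve
      obtain ⟨j', hj'⟩ := hG.exists_pos hN hvf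
      refine Finset.mem_image.2 ⟨(v, j, j'), Finset.mem_univ _, ?_⟩
      rw [hj.2, hj'.2]
      exact hxi
  have := Finset.card_le_card_of_injOn _ hmaps fun i hi j hj hij =>
    h.injOn (Finset.mem_range.1 hi) (Finset.mem_range.1 hj) hij
  rw [Finset.card_range] at this
  exact this.trans hL

end Encodes

end LadderTrees

namespace LadderTrees

/-! ## Extending runs -/

section RunExtension

variable {V : Type} {E : Set (Sym2 V)} {a b c p q : V} {l l₀ : List V}

theorem IsRun.snoc (h : IsRun E a b l) (hl : a :: b :: l = l₀ ++ [p, q])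
    (hq : ∀ x, s(q, x) ∈ E ↔ x = p ∨ x = c) (hpc : p ≠ c) : IsRun E a b (l ++ [c]) := by
  induction l generalizing a b l₀ with
  | nil =>
    have : l₀ = [] := by
      have := congrArg List.length hl
      simp at this
      exact this
    subst this
    obtain ⟨rfl, rfl⟩ : a = p ∧ b = q := by simpa using hl
    exact ⟨h, hq, hpc, (hq c).2 (.inr rfl)⟩
  | cons d l ih =>
    obtain ⟨h1, h2, h3, h4⟩ := h
    rcases l₀ with _ | ⟨a', l₀⟩
    · simp at hl
    · exact ⟨h1, h2, h3, ih h4 (List.cons_eq_cons.1 hl).2⟩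

theorem IsRun.nbrs_last {t : List V} (h : IsRun E a b (l ++ c :: t))
    (hl : a :: b :: l = l₀ ++ [p, q]) : (∀ x, s(q, x) ∈ E ↔ x = p ∨ x = c) ∧ p ≠ c := by
  induction l generalizing a b l₀ with
  | nil =>
    have : l₀ = [] := by
      have := congrArg List.length hl
      simp at this
      exact this
    subst this
    obtain ⟨rfl, rfl⟩ : a = p ∧ b = q := by simpa using hl
    exact ⟨h.2.1, h.2.2.1⟩
  | cons d l ih =>
    obtain ⟨-, -, -, h4⟩ := h
    rcases l₀ with _ | ⟨a', l₀⟩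
    · simp at hl
    · exact ih h4 (List.cons_eq_cons.1 hl).2

end RunExtension

/-! ## Degrees -/

section Degrees

variable {N m : ℕ} {G : SimpleGraph (Fin N)} {edge : Fin m ≃ G.edgeSet}
  {S : Finset (Sym2 G.edgeSet)} {σ₀ : Store}

theorem Prepared.exists_end (hp : Prepared edge S σ₀) {v : Fin N} {j : Fin 3}
    (hj : (j : ℕ) < σ₀.nat 2 v 0) : ∃ (e : G.edgeSet) (w : Fin N),
      σ₀.nat 3 v j = edge.symm e ∧ (e : Sym2 (Fin N)) = s(v, w) := by
  obtain ⟨e, he⟩ := hp.pos v j hj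
  obtain ⟨w, hw⟩ := Sym2.mem_iff_exists.1 (hp.incidence.mem he)
  exact ⟨e, w, he.2, hw⟩

theorem Prepared.exists_index (hp : Prepared edge S σ₀) {v w : Fin N} (h : s(v, w) ∈ G.edgeSet) :
    ∃ j : Fin 3, (j : ℕ) < σ₀.nat 2 v 0 ∧ σ₀.nat 3 v j = edge.symm ⟨s(v, w), h⟩ :=
  hp.incidence.exists_of_mem (v := v) (e := ⟨s(v, w), h⟩) (by simp)

theorem Prepared.index_unique (hp : Prepared edge S σ₀) {v : Fin N} {i j : Fin 3}
    (hi : (i : ℕ) < σ₀.nat 2 v 0) (hj : (j : ℕ) < σ₀.nat 2 v 0)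
    (h : σ₀.nat 3 v i = σ₀.nat 3 v j) : i = j := by
  obtain ⟨e, he⟩ := hp.pos v i hi
  exact hp.incidence.pos_unique he ⟨hj, h ▸ he.2⟩

theorem Prepared.atMostTwo_iff (hp : Prepared edge S σ₀) (v : Fin N) :
    AtMostTwo G.edgeSet v ↔ ¬ 3 ≤ σ₀.nat 2 v 0 := by
  constructor
  · rintro ⟨y, z, hyz⟩ h3
    have hex : ∀ j : Fin 3, ∃ (e : G.edgeSet) (w : Fin N),
      σ₀.nat 3 v j = edge.symm e ∧ (e : Sym2 (Fin N)) = s(v, w) := fun j =>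
        hp.exists_end (by omega)
    choose e w he hw using hex
    have hinj : Function.Injective w := fun i j hij => by
      have : e i = e j := Subtype.ext (by rw [hw, hw, hij])
      exact hp.index_unique (v := v) (by omega) (by omega) (by rw [he, he, this])
    have hmem : ∀ j, w j = y ∨ w j = z := fun j => hyz _ (hw j ▸ (e j).2)
    have h01 := hinj.ne (show (0 : Fin 3) ≠ 1 by decide)
    have h02 := hinj.ne (show (0 : Fin 3) ≠ 2 by decide)
    have h12 := hinj.ne (show (1 : Fin 3) ≠ 2 by decide)
    have h0 := hmem 0
    have h1 := hmem 1
    have h2 := hmem 2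
    grind
  · intro h3
    have hex : ∀ j : Fin 3, ∃ y, ∀ w (h : s(v, w) ∈ G.edgeSet),
        σ₀.nat 3 v j = edge.symm ⟨s(v, w), h⟩ → w = y := fun j => by
      by_cases hj : ∃ w, ∃ h : s(v, w) ∈ G.edgeSet, σ₀.nat 3 v j = edge.symm ⟨s(v, w), h⟩
      · obtain ⟨y, hy, hjy⟩ := hj
        refine ⟨y, fun w hw hjw => ?_⟩
        have := edge.symm.injective (Fin.ext (hjw.symm.trans hjy))
        exact Sym2.congr_right.1 (congrArg Subtype.val this)
      · exact ⟨v, fun w hw hjw => absurd ⟨w, hw, hjw⟩ hj⟩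
    choose y hy using hex
    refine ⟨y 0, y 1, fun w hw => ?_⟩
    obtain ⟨j, hj, hjw⟩ := hp.exists_index hw
    have := hy j w hw hjw
    have hj2 : j ≠ 2 := by rintro rfl; simp at hj; omega
    rcases (show j = 0 ∨ j = 1 by omega) with rfl | rfl
    exacts [.inl this, .inr this]

theorem Prepared.degree_eq_two (hp : Prepared edge S σ₀) {p q c : Fin N}
    (hq : ∀ x, s(q, x) ∈ G.edgeSet ↔ x = p ∨ x = c) (hpc : p ≠ c) : σ₀.nat 2 q 0 = 2 := by
  have h2 := (hp.atMostTwo_iff q).1 ⟨p, c, fun w => (hq w).1⟩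
  have hqp := (hq p).2 (.inl rfl)
  have hqc := (hq c).2 (.inr rfl)
  obtain ⟨i, hi, hie⟩ := hp.exists_index hqp
  obtain ⟨j, hj, hje⟩ := hp.exists_index hqc
  have hij : i ≠ j := by
    rintro rfl
    have := edge.symm.injective (Fin.ext (hie.symm.trans hje))
    exact hpc (Sym2.congr_right.1 (congrArg Subtype.val this))
  have : (i : ℕ) ≠ j := fun h => hij (Fin.ext h)
  omega

/-- From a vertex of degree two one can go on in one way. -/
theorem Prepared.exists_next (hp : Prepared edge S σ₀) {p q : Fin N} {e : G.edgeSet}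
    (he : (e : Sym2 (Fin N)) = s(p, q)) (hq : σ₀.nat 2 q 0 = 2) :
    ∃ (e' : G.edgeSet) (c : Fin N), (e' : Sym2 (Fin N)) = s(q, c) ∧ p ≠ c ∧
      (∀ x, s(q, x) ∈ G.edgeSet ↔ x = p ∨ x = c) ∧
      (edge.symm e' : ℕ) =
        if σ₀.nat 3 q 0 = edge.symm e then σ₀.nat 3 q 1 else σ₀.nat 3 q 0 := by
  have hqp : s(q, p) ∈ G.edgeSet := Sym2.eq_swap ▸ he ▸ e.2
  have hee : (⟨s(q, p), hqp⟩ : G.edgeSet) = e := Subtype.ext (Sym2.eq_swap.trans he.symm)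
  obtain ⟨i, hi, hie⟩ := hp.exists_index hqp
  rw [hee] at hie
  have H : ∀ j : Fin 3, (j : ℕ) < 2 → j ≠ i → (∀ x : Fin 3, (x : ℕ) < 2 → x = i ∨ x = j) →
      (σ₀.nat 3 q j = if σ₀.nat 3 q 0 = edge.symm e then σ₀.nat 3 q 1 else σ₀.nat 3 q 0) →
      ∃ (e' : G.edgeSet) (c : Fin N), (e' : Sym2 (Fin N)) = s(q, c) ∧ p ≠ c ∧
      (∀ x, s(q, x) ∈ G.edgeSet ↔ x = p ∨ x = c) ∧
      (edge.symm e' : ℕ) =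
        if σ₀.nat 3 q 0 = edge.symm e then σ₀.nat 3 q 1 else σ₀.nat 3 q 0 := by
    intro j hj hji hx hjv
    obtain ⟨e', c, h1, h2⟩ := hp.exists_end (v := q) (j := j) (by omega)
    refine ⟨e', c, h2, ?_, fun x => ⟨fun hxE => ?_, ?_⟩, h1 ▸ hjv⟩
    · rintro rfl
      have : e' = e := Subtype.ext (by rw [h2, he, Sym2.eq_swap])
      exact hji (hp.index_unique (by omega) hi (by rw [h1, hie, this]))
    · obtain ⟨j', hj', hje'⟩ := hp.exists_index hxE
      rcases hx j' (by omega) with rfl | rfl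
      · have := edge.symm.injective (Fin.ext (hje'.symm.trans hie))
        rw [← hee] at this
        exact .inl (Sym2.congr_right.1 (congrArg Subtype.val this))
      · have := congrArg Subtype.val (edge.symm.injective (Fin.ext (hje'.symm.trans h1)))
        rw [h2] at this
        exact .inr (Sym2.congr_right.1 this)
    · rintro (rfl | rfl)
      exacts [hqp, h2 ▸ e'.2]
  rcases (show i = 0 ∨ i = 1 by omega) with rfl | rfl
  · exact H 1 (by decide) (by decide) (by decide) (by simpa using fun h => absurd hie h)
  · refine H 0 (by decide) (by decide) (by decide) ?_
    rw [if_neg]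
    · rfl
    · intro h
      have := hp.index_unique (v := q) (i := 0) (j := 1) (by simp; omega) hi (h.trans hie.symm)
      simp at this

theorem Prepared.other_end (hp : Prepared edge S σ₀) {e : G.edgeSet} {v w : Fin N}
    (he : (e : Sym2 (Fin N)) = s(v, w)) :
    (w : ℕ) = if σ₀.nat 1 (edge.symm e) 0 = v then σ₀.nat 1 (edge.symm e) 1
      else σ₀.nat 1 (edge.symm e) 0 := by
  obtain ⟨a, b, hab, ha, hb⟩ := hp.ends e
  rw [ha, hb]
  have hne : v ≠ w := G.ne_of_adj (G.mem_edgeSet.1 (he ▸ e.2))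
  rw [he] at hab
  rcases Sym2.eq_iff.1 hab with ⟨rfl, rfl⟩ | ⟨rfl, rfl⟩
  · simp
  · rw [if_neg fun h => hne (Fin.ext h).symm]

end Degrees

/-! ## The search for the start of the sweep -/

/-- Move from one end of the edge in scalar 22 to the other; scalar 23 holds the end. -/
def crossProg : Program :=
  .branch (.natEq (.cell 1 (.reg 22) (.const 0)) (.reg 23))
    (.setReg 23 (.cell 1 (.reg 22) (.const 1))) (.setReg 23 (.cell 1 (.reg 22) (.const 0)))

/-- One step of the walk along a run; scalar 25 counts the steps. -/
def walkStep : Program :=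
  .seq [.branch (.natEq (.cell 3 (.reg 23) (.const 0)) (.reg 22))
      (.setReg 22 (.cell 3 (.reg 23) (.const 1))) (.setReg 22 (.cell 3 (.reg 23) (.const 0))),
    crossProg, .setReg 25 (.succ (.reg 25))]

/-- Begin a walk at the vertex in scalar 20 with the edge at position `j`. -/
def walkStart (j : Fin 3) : Program :=
  .seq [.setReg 22 (.cell 3 (.reg 20) (.const j)), .setReg 23 (.reg 20), crossProg,
    .setReg 24 (.reg 23), .setReg 25 (.const 0)]

/-- The walk is long enough. -/
def walkFull : BExp := .natEq (.succ (.succ (.reg 25))) (.cell 0 (.const 0) (.const 2))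

/-- The walk along a run. -/
def walkLoop : Program :=
  .loop (.conj (.neg walkFull) (.natEq (.cell 2 (.reg 23) (.const 0)) (.const 2))) walkStep

/-- Take the first edge of the walk as the start of the sweep. -/
def walkAccept : Program := .seq [.setReg 13 (.reg 24), .setReg 14 (.reg 20)]

/-- Try the walk that begins at the vertex in scalar 20 with the edge at position `j`. -/
def walkProg (j : Fin 3) : Program :=
  .comp (walkStart j) (.comp walkLoop (.branch walkFull walkAccept .skip))

/-- Try all the walks that begin at the vertex in scalar 20. -/
def tryVertex : Program :=
  .comp (.branch (.natLe (.const 3) (.cell 2 (.reg 20) (.const 0)))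
      (.comp (walkProg 0) (.comp (walkProg 1) (walkProg 2))) .skip)
    (.setReg 20 (.succ (.reg 20)))

/-- The first candidate for the start of the sweep. -/
def searchStart : Program :=
  .seq [.setReg 13 (.cell 1 (.const 0) (.const 0)), .setReg 14 (.cell 1 (.const 0) (.const 1)),
    .setReg 20 (.const 0)]

/-- Find the start of the sweep. -/
def searchProg : Program :=
  .comp searchStart
    (.loop (.neg (.natEq (.reg 20) (.cell 0 (.const 0) (.const 0)))) tryVertex)

section Search

variable {N m : ℕ} {G : SimpleGraph (Fin N)} {edge : Fin m ≃ G.edgeSet}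
  {S : Finset (Sym2 G.edgeSet)} {σ₀ σ : Store} {k : ℕ}

theorem exec_crossProg (hp : Prepared edge S σ₀) (h1 : σ.nat 1 = σ₀.nat 1) {e : G.edgeSet}
    {v w : Fin N} (he : (e : Sym2 (Fin N)) = s(v, w)) (h22 : σ.nat 22 0 0 = edge.symm e)
    (h23 : σ.nat 23 0 0 = v) : crossProg.exec σ = σ.setNat 23 0 0 w := by
  have := hp.other_end he
  rw [this]
  by_cases h : σ₀.nat 1 (edge.symm e) 0 = v
  · rw [crossProg, Program.exec_branch_of (by simp [h1, h22, h23, h])]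
    simp [h1, h22, h]
  · rw [crossProg, Program.exec_branch_of_not (by simp [h1, h22, h23, h])]
    simp [h1, h22, h]

theorem exec_walkStep (hp : Prepared edge S σ₀) (h1 : σ.nat 1 = σ₀.nat 1)
    (h3 : σ.nat 3 = σ₀.nat 3) {e : G.edgeSet} {p q : Fin N}
    (he : (e : Sym2 (Fin N)) = s(p, q)) (h22 : σ.nat 22 0 0 = edge.symm e)
    (h23 : σ.nat 23 0 0 = q) (hq : σ₀.nat 2 q 0 = 2) :
    ∃ (e' : G.edgeSet) (c : Fin N), (e' : Sym2 (Fin N)) = s(q, c) ∧ p ≠ c ∧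
      (∀ x, s(q, x) ∈ G.edgeSet ↔ x = p ∨ x = c) ∧
      walkStep.exec σ = ((σ.setNat 22 0 0 (edge.symm e')).setNat 23 0 0 c).setNat 25 0 0
        (σ.nat 25 0 0 + 1) := by
  obtain ⟨e', c, he', hpc, hqx, hval⟩ := hp.exists_next he hq
  refine ⟨e', c, he', hpc, hqx, ?_⟩
  have hfirst : (Program.branch (.natEq (.cell 3 (.reg 23) (.const 0)) (.reg 22))
      (.setReg 22 (.cell 3 (.reg 23) (.const 1)))
      (.setReg 22 (.cell 3 (.reg 23) (.const 0)))).exec σ = σ.setNat 22 0 0 (edge.symm e') := by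
    rw [hval]
    by_cases h : σ₀.nat 3 q 0 = edge.symm e
    · rw [Program.exec_branch_of (by simp [h3, h22, h23, h])]
      simp [h3, h23, h]
    · rw [Program.exec_branch_of_not (by simp [h3, h22, h23, h])]
      simp [h3, h23, h]
  have hcross : crossProg.exec (σ.setNat 22 0 0 (edge.symm e')) =
      (σ.setNat 22 0 0 (edge.symm e')).setNat 23 0 0 c :=
    exec_crossProg hp (by funext i j; simp [h1]) he' (by simp) (by simp [h23])
  rw [walkStep, Program.exec_seq_cons, hfirst, Program.exec_seq_cons, hcross]
  simp

/-- There is a run of length `k - 1` that begins at the vertex `r` of degree three with the edge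
`rx`. -/
def IsLongRun (G : SimpleGraph (Fin N)) (k : ℕ) (r x : Fin N) : Prop :=
  ¬ AtMostTwo G.edgeSet r ∧ ∃ l, IsRun G.edgeSet r x l ∧ l.length + 2 = k

/-- The candidate for the start of the sweep after all the pairs in `Q` have been considered. -/
structure Searched (G : SimpleGraph (Fin N)) (k : ℕ) (σ₀ : Store) (Q : Fin N → Fin N → Prop)
    (σ : Store) : Prop where
  frame : ∀ a, a ≤ 12 → σ.nat a = σ₀.nat a
  found : ∃ u w : Fin N, σ.nat 13 0 0 = u ∧ σ.nat 14 0 0 = w ∧ s(u, w) ∈ G.edgeSet ∧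
    (IsLongRun G k w u ∨ ∀ r x, Q r x → ¬ IsLongRun G k r x)

/-- The walk stops when it has the full length or meets a vertex whose degree is not two. As runs
with the same first edge are prefixes of each other, a walk that stops early shows that no run of
full length begins with this edge. -/
theorem ensures_walkLoop (hp : Prepared edge S σ₀) (hf : ∀ a, a ≤ 12 → σ.nat a = σ₀.nat a)
    (hk : σ₀.nat 0 0 2 = k) (hk3 : 3 ≤ k) {v x : Fin N} {e : G.edgeSet}
    (he : (e : Sym2 (Fin N)) = s(v, x)) (h22 : σ.nat 22 0 0 = edge.symm e)
    (h23 : σ.nat 23 0 0 = x) (h25 : σ.nat 25 0 0 = 0) :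
    walkLoop.Ensures σ (k * (walkStep.cost + 18 + 1) + 18 + 1) fun τ =>
      (τ.nat 25 0 0 + 2 = k ↔ ∃ l, IsRun G.edgeSet v x l ∧ l.length + 2 = k) := by
  refine (Program.Ensures.loop_count walkStep.cost (fun r τ =>
    (∀ a, a ≤ 12 → τ.nat a = σ₀.nat a) ∧ r + τ.nat 25 0 0 + 2 = k ∧
    ∃ (l l₀ : List (Fin N)) (p q : Fin N) (e : G.edgeSet), IsRun G.edgeSet v x l ∧
      l.length = τ.nat 25 0 0 ∧ v :: x :: l = l₀ ++ [p, q] ∧ (e : Sym2 (Fin N)) = s(p, q) ∧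
      τ.nat 22 0 0 = edge.symm e ∧ τ.nat 23 0 0 = q) ?_ (i := k - 2)
    ⟨hf, by omega, [], [], v, x, e, ?_, by simp [h25], rfl, he, h22, h23⟩).mono ?_ ?_
  · rintro r τ ⟨hf, hr, l, l₀, p, q, e, hrun, hlen, hl, he, h22, h23⟩ hb
    have hb' : τ.nat 25 0 0 + 2 ≠ k ∧ σ₀.nat 2 q 0 = 2 := by
      simpa [walkFull, hf 0, hf 2, hk, h23] using hb
    obtain ⟨e', c, he', hpc, hqx, hex⟩ :=
      exec_walkStep hp (hf 1 (by omega)) (hf 3 (by omega)) he h22 h23 hb'.2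
    have hlf : walkStep.LoopFree := by simp [walkStep, crossProg, Program.seq]
    refine ⟨r - 1, by omega, hlf.ensures ?_⟩
    rw [hex]
    refine ⟨fun a ha => ?_, by simp; omega, l ++ [c], l₀ ++ [p], q, c, e', hrun.snoc hl hqx hpc,
      by simp [hlen], ?_, he', by simp, by simp⟩
    · funext i j
      have h1 : a ≠ 22 := by omega
      have h2 : a ≠ 23 := by omega
      have h3 : a ≠ 25 := by omega
      simp [h1, h2, h3, hf a ha]
    · rw [← List.cons_append, ← List.cons_append, hl]; simp
  · exact he.subst (motive := (· ∈ G.edgeSet)) e.2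
  · change (k - 2) * (walkStep.cost + 18 + 1) + 18 + 1 ≤ _
    gcongr
    omega
  · rintro τ ⟨r, ⟨hf, hr, l, l₀, p, q, e, hrun, hlen, hl, he, h22, h23⟩, hb⟩
    have hb' : τ.nat 25 0 0 + 2 ≠ k → σ₀.nat 2 q 0 ≠ 2 := by
      simpa [walkFull, hf 0, hf 2, hk, h23] using hb
    refine ⟨fun h => ⟨l, hrun, by omega⟩, ?_⟩
    rintro ⟨l', hrun', hl'⟩
    by_contra hne
    refine hb' hne ?_
    obtain ⟨t, rfl⟩ := hrun.isPrefix hrun' (by omega)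
    rcases t with _ | ⟨c, t⟩
    · simp at hl'; omega
    · obtain ⟨h1, h2⟩ := hrun'.nbrs_last hl
      exact hp.degree_eq_two h1 h2

/-- A bound for the time of a walk. -/
def walkTime (k : ℕ) : ℕ :=
  (walkStart 0).cost + (k * (walkStep.cost + 18 + 1) + 18 + 1 +
    (walkFull.time + walkAccept.cost + 1))

theorem ensures_walkProg (hp : Prepared edge S σ₀) (hk : σ₀.nat 0 0 2 = k) (hk3 : 3 ≤ k)
    {Q : Fin N → Fin N → Prop} (h : Searched G k σ₀ Q σ) {v x : Fin N} {e : G.edgeSet}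
    {j : Fin 3} (h20 : σ.nat 20 0 0 = v) (hv : ¬ AtMostTwo G.edgeSet v)
    (hj : σ₀.nat 3 v j = edge.symm e) (he : (e : Sym2 (Fin N)) = s(v, x)) :
    (walkProg j).Ensures σ (walkTime k) fun τ =>
      Searched G k σ₀ (fun r y => Q r y ∨ r = v ∧ y = x) τ ∧ τ.nat 20 0 0 = v := by
  obtain ⟨hf, u, w, h13, h14, huw, hfound⟩ := h
  have hexec : (walkStart j).exec σ = (((((σ.setNat 22 0 0 (edge.symm e)).setNat 23 0 0 v).setNat
      23 0 0 x).setNat 24 0 0 x).setNat 25 0 0 0) := by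
    have hcross := exec_crossProg (σ := (σ.setNat 22 0 0 (edge.symm e)).setNat 23 0 0 v) hp
      (by funext i j; simp [hf 1]) he (by simp) (by simp)
    have h1 : (Program.setReg 22 (.cell 3 (.reg 20) (.const j))).exec σ =
        σ.setNat 22 0 0 (edge.symm e) := by simp [h20, hf 3, hj]
    have h2 : (Program.setReg 23 (.reg 20)).exec (σ.setNat 22 0 0 (edge.symm e)) =
        (σ.setNat 22 0 0 (edge.symm e)).setNat 23 0 0 v := by simp [h20]
    rw [walkStart, Program.exec_seq_cons, h1, Program.exec_seq_cons, h2, Program.exec_seq_cons,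
      hcross]
    simp
  have hlf : (walkStart j).LoopFree := by simp [walkStart, crossProg, Program.seq]
  have hlf' : walkAccept.LoopFree := by simp [walkAccept, Program.seq]
  have hcost : (walkStart 0).cost = (walkStart j).cost := rfl
  rw [walkTime, hcost]
  refine Program.Ensures.comp (hlf.ensures (Q := fun τ => τ = _) hexec) ?_
  rintro _ rfl
  refine Program.Ensures.comp (ensures_walkLoop hp (fun a ha => ?_) hk hk3 he (by simp)
    (by simp) (by simp)).frame ?_
  · funext i j
    have h1 : a ≠ 22 := by omega
    have h2 : a ≠ 23 := by omega
    have h3 : a ≠ 24 := by omega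
    have h4 : a ≠ 25 := by omega
    simp [h1, h2, h3, h4, hf a ha]
  rintro τ ⟨hτ, hframe, -⟩
  have hfr : ∀ a, a ≤ 20 → τ.nat a = σ.nat a := fun a ha => by
    have h1 : a ≠ 22 := by omega
    have h2 : a ≠ 23 := by omega
    have h3 : a ≠ 24 := by omega
    have h4 : a ≠ 25 := by omega
    rw [hframe a (by simp [walkLoop, walkStep, crossProg, Program.seq, h1, h2, h4])]
    funext i j
    simp [h1, h2, h3, h4]
  have hfr0 : ∀ a, a ≤ 12 → τ.nat a = σ₀.nat a := fun a ha =>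
    (hfr a (by omega)).trans (hf a ha)
  have h24 : τ.nat 24 0 0 = x := by
    rw [hframe 24 (by simp [walkLoop, walkStep, crossProg, Program.seq])]
    simp
  refine Program.Ensures.branch (fun hb => hlf'.ensures ⟨⟨fun a ha => ?_, x, v, ?_, ?_, ?_, ?_⟩, ?_⟩)
    fun hb => ⟨1, τ, .skip τ, by simp [walkAccept, Program.seq, Program.cost]; omega,
      ⟨hfr0, u, w, ?_, ?_, huw, ?_⟩, ?_⟩
  · funext i j
    have h1 : a ≠ 13 := by omega
    have h2 : a ≠ 14 := by omega
    simp [walkAccept, h1, h2, hfr0 a ha]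
  · simp [walkAccept, h24]
  · simp [walkAccept, hfr 20, h20]
  · rw [Sym2.eq_swap, ← he]; exact e.2
  · have : τ.nat 25 0 0 + 2 = k := by simpa [walkFull, hfr0 0, hk] using hb
    exact .inl ⟨hv, hτ.1 this⟩
  · simp [walkAccept, hfr 20, h20]
  · rw [hfr 13 (by omega), h13]
  · rw [hfr 14 (by omega), h14]
  · have : ¬ τ.nat 25 0 0 + 2 = k := by simpa [walkFull, hfr0 0, hk] using hb
    refine hfound.imp_right fun hQ r y hy => ?_
    rcases hy with hy | ⟨rfl, rfl⟩
    · exact hQ r y hy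
    · exact fun hr => this (hτ.2 hr.2)
  · rw [hfr 20 (by omega), h20]

/-- The two time bounds are kept apart for an amortized analysis: walks are made only at vertices of
degree three, and all other vertices cost constant time. -/
theorem ensures_tryVertex (hp : Prepared edge S σ₀) (hk : σ₀.nat 0 0 2 = k) (hk3 : 3 ≤ k)
    {Q : Fin N → Fin N → Prop} (h : Searched G k σ₀ Q σ) {v : Fin N} (h20 : σ.nat 20 0 0 = v) :
    ∃ B, (3 ≤ σ₀.nat 2 v 0 → B ≤ 3 * walkTime k + 20) ∧
      (¬ 3 ≤ σ₀.nat 2 v 0 → B ≤ 20) ∧ tryVertex.Ensures σ B fun τ =>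
      Searched G k σ₀ (fun r y => Q r y ∨ r = v) τ ∧ τ.nat 20 0 0 = v + 1 := by
  have hdeg : σ.nat 2 v 0 = σ₀.nat 2 v 0 := by rw [h.frame 2 (by omega)]
  have hlast : ∀ τ : Store, Searched G k σ₀ (fun r y => Q r y ∨ r = v) τ → τ.nat 20 0 0 = v →
      (Program.setReg 20 (.succ (.reg 20))).Ensures τ 7 fun τ =>
        Searched G k σ₀ (fun r y => Q r y ∨ r = v) τ ∧ τ.nat 20 0 0 = v + 1 := by
    rintro τ ⟨hf, u, w, h13, h14, hrest⟩ h20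
    have hlf : (Program.setReg 20 (.succ (.reg 20))).LoopFree := by simp
    refine hlf.ensures ⟨⟨fun a ha => ?_, u, w, by simp [h13], by simp [h14], hrest⟩,
      by simp [h20]⟩
    funext i j
    have h1 : a ≠ 20 := by omega
    simp [h1, hf a ha]
  by_cases h3 : 3 ≤ σ₀.nat 2 v 0
  · have hv : ¬ AtMostTwo G.edgeSet v := fun h' => (hp.atMostTwo_iff v).1 h' h3
    have hex : ∀ j : Fin 3, ∃ (e : G.edgeSet) (w : Fin N),
      σ₀.nat 3 v j = edge.symm e ∧ (e : Sym2 (Fin N)) = s(v, w) := fun j =>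
        hp.exists_end (by omega)
    choose e w he hw using hex
    refine ⟨_, fun _ => ?_, fun h => absurd h3 h, Program.Ensures.comp (Program.Ensures.branch
      (fun _ => Program.Ensures.comp (ensures_walkProg hp hk hk3 h h20 hv (he 0) (hw 0))
        fun τ hτ => Program.Ensures.comp
          (ensures_walkProg hp hk hk3 hτ.1 hτ.2 hv (he 1) (hw 1))
        fun τ hτ => ensures_walkProg hp hk hk3 hτ.1 hτ.2 hv (he 2) (hw 2))
      fun hb => absurd (by simpa [h20, hdeg] using h3) hb) fun τ hτ => hlast τ ?_ hτ.2⟩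
    · simp only [BExp.time, NExp.time, NExp.reg]
      omega
    · obtain ⟨⟨hf, u, w', h13, h14, huw, hfound⟩, -⟩ := hτ
      refine ⟨hf, u, w', h13, h14, huw, hfound.imp_right fun hQ r y hy => ?_⟩
      rcases hy with hy | rfl
      · exact hQ r y (.inl (.inl (.inl hy)))
      · intro hlong
        obtain ⟨l, hl, -⟩ := hlong.2
        obtain ⟨j, hj, hje⟩ := hp.exists_index hl.mem
        have hyw : y = w j := by
          have := congrArg Subtype.val (edge.symm.injective (Fin.ext (hje.symm.trans (he j))))
          rw [hw] at this
          exact Sym2.congr_right.1 this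
        refine hQ r y ?_ hlong
        rcases (show j = 0 ∨ j = 1 ∨ j = 2 by omega) with rfl | rfl | rfl
        exacts [.inl (.inl (.inr ⟨rfl, hyw⟩)), .inl (.inr ⟨rfl, hyw⟩), .inr ⟨rfl, hyw⟩]
  · have hv : AtMostTwo G.edgeSet v := (hp.atMostTwo_iff v).2 h3
    refine ⟨_, fun h => absurd h h3, fun _ => ?_, Program.Ensures.comp (Program.Ensures.branch
      (B := 1) (fun hb => absurd (by simpa [h20, hdeg] using hb) h3)
      fun hb => ⟨1, σ, .skip σ, le_rfl, rfl⟩)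
      (Q := fun τ => τ = σ) fun τ hτ => hlast τ ?_ (by rw [hτ, h20])⟩
    · simp [BExp.time, NExp.time, NExp.reg]
    · subst hτ
      obtain ⟨hf, u, w', h13, h14, huw, hfound⟩ := h
      refine ⟨hf, u, w', h13, h14, huw, hfound.imp_right fun hQ r y hy => ?_⟩
      rcases hy with hy | rfl
      · exact hQ r y hy
      · exact fun hr => hr.1 hv

end Search

end LadderTrees

namespace LadderTrees

/-! ### The time of the whole search. -/

section SearchAll

variable {N m : ℕ} {G : SimpleGraph (Fin N)} {edge : Fin m ≃ G.edgeSet}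
  {S : Finset (Sym2 G.edgeSet)} {σ₀ : Store} {k : ℕ}

theorem ensures_searchProg (hp : Prepared edge S σ₀) (hN : σ₀.nat 0 0 0 = N)
    (hk : σ₀.nat 0 0 2 = k) (hk3 : 3 ≤ k) (hm : 0 < m) {L : List (Fin N)}
    (hL : ∀ v, v ∉ L → AtMostTwo G.edgeSet v) :
    searchProg.Ensures σ₀ (17 + (N * 29 + 3 * walkTime k * L.length + 8 + 1))
      (Searched G k σ₀ fun _ _ => True) := by
  obtain ⟨u, v, huv, hu, hv⟩ := hp.ends (edge ⟨0, hm⟩)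
  simp only [Equiv.symm_apply_apply] at hu hv
  have huvE : s(u, v) ∈ G.edgeSet := huv ▸ (edge ⟨0, hm⟩).2
  have hlf : searchStart.LoopFree := by simp [searchStart, Program.seq]
  refine Program.Ensures.comp (hlf.ensures (Q := fun τ =>
    Searched G k σ₀ (fun r _ => (r : ℕ) < 0) τ ∧ τ.nat 20 0 0 = 0) ⟨⟨fun a ha => ?_,
      u, v, by simpa [searchStart] using hu, by simpa [searchStart] using hv, huvE,
      .inr (by simp)⟩, by simp [searchStart]⟩) ?_
  · funext i j
    have h1 : a ≠ 13 := by omega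
    have h2 : a ≠ 14 := by omega
    have h3 : a ≠ 20 := by omega
    simp [searchStart, h1, h2, h3]
  rintro τ ⟨hτ, h20⟩
  have hcount : ∀ i, (L.toFinset.filter fun x : Fin N => i ≤ (x : ℕ)).card ≤ L.length := fun i =>
    (Finset.card_filter_le _ _).trans L.toFinset_card_le
  -- The remaining time is a potential: 29 for each vertex still to be visited, namely 20 for the
  -- constant part of the visit and 9 for the test of the loop, and three walks for each possible
  -- exception from `L` among them.
  refine (Program.Ensures.loop (fun B τ => ∃ i ≤ N, τ.nat 20 0 0 = i ∧
      Searched G k σ₀ (fun r _ => (r : ℕ) < i) τ ∧ B = (N - i) * 29 +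
        3 * walkTime k * (L.toFinset.filter fun x : Fin N => i ≤ (x : ℕ)).card) ?_
    ⟨0, by omega, h20, hτ, rfl⟩).mono ?_ ?_
  · rintro _ σ ⟨i, hi, h20, hσ, rfl⟩ hb
    have hne : i ≠ N := by simpa [h20, hσ.frame 0, hN] using hb
    obtain ⟨v, rfl⟩ : ∃ v : Fin N, i = v := ⟨⟨i, by omega⟩, rfl⟩
    obtain ⟨B, hB3, hB2, hens⟩ := ensures_tryVertex hp hk hk3 hσ h20
    refine ⟨B, _, ?_, hens.mono le_rfl fun τ hτ => ⟨v + 1, by omega, hτ.2, ?_, rfl⟩⟩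
    · have htime : (BExp.neg (.natEq (.reg 20) (.cell 0 (.const 0) (.const 0)))).time = 8 := rfl
      rw [htime]
      have hmul : (N - v) * 29 = (N - (v + 1)) * 29 + 29 := by
        have : N - v = N - (v + 1) + 1 := by omega
        rw [this, Nat.succ_mul]
      have hsub : (L.toFinset.filter fun x : Fin N => (v : ℕ) + 1 ≤ x) ⊆
          L.toFinset.filter fun x : Fin N => (v : ℕ) ≤ x := by
        intro x hx
        simp only [Finset.mem_filter] at hx ⊢
        exact ⟨hx.1, by omega⟩
      by_cases h3 : 3 ≤ σ₀.nat 2 v 0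
      · have hvL : v ∈ L := by
          by_contra h'
          exact (hp.atMostTwo_iff v).1 (hL v h') h3
        have hlt := Finset.card_lt_card (Finset.ssubset_iff_of_subset hsub |>.2
          ⟨v, by simp [hvL], by simp⟩)
        have := Nat.mul_le_mul_left (3 * walkTime k) hlt
        rw [Nat.mul_succ] at this
        have := hB3 h3
        omega
      · have := Nat.mul_le_mul_left (3 * walkTime k) (Finset.card_le_card hsub)
        have := hB2 h3
        omega
    · obtain ⟨⟨hf, u, w, h13, h14, huw, hfound⟩, -⟩ := hτ
      refine ⟨hf, u, w, h13, h14, huw, hfound.imp_right fun hQ r y hy => hQ r y ?_⟩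
      by_cases hrv : r = v
      · exact .inr hrv
      · have : (r : ℕ) ≠ v := fun h => hrv (Fin.ext h)
        exact .inl (by omega)
  · have htime : (BExp.neg (.natEq (.reg 20) (.cell 0 (.const 0) (.const 0)))).time = 8 := rfl
    rw [htime]
    have := Nat.mul_le_mul_left (3 * walkTime k) (hcount 0)
    omega
  · rintro τ ⟨_, ⟨i, hi, h20, hσ, -⟩, hb⟩
    have heq : i = N := by simpa [h20, hσ.frame 0, hN] using hb
    obtain ⟨hf, u, w, h13, h14, huw, hfound⟩ := hσ
    exact ⟨hf, u, w, h13, h14, huw, hfound.imp_right fun hQ r y _ => hQ r y (by omega)⟩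

end SearchAll

/-! ## The complete algorithm -/

/-- The state of the empty set of edges. -/
def St.start : St := ⟨false, false, false, false, fun _ => false, fun _ => false⟩

/-- Enter the empty set of edges into the table. -/
noncomputable def initProg : Program := .setNat 9 (.const 0) (.const St.start.code) (.const 1)

/-- The algorithm; the program `P` prepares the table of conflicts. -/
noncomputable def Mode.solveProg (M : Mode) (P : Program) : Program :=
  .comp P (.comp searchProg (.comp initProg (.comp M.sweepProg outputProg)))

section Solve

variable {k n N m : ℕ} {G : SimpleGraph (Fin N)} {edge : Fin m ≃ G.edgeSet}
  {S : Finset (Sym2 G.edgeSet)} {σ : Store}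

theorem LadderBuild.nonempty {V : Type} {i : ℕ} {A : Set V} {E F : Set (Sym2 V)}
    (h : LadderBuild k i A E F) : A.Nonempty := by
  induction h with
  | init a p => exact ⟨a, by simp⟩
  | step i A E F h r s hfree p hnd hlen hnew ih => exact ih.inl

theorem LadderBuild.card_vertices_le {E F : Set (Sym2 (Fin N))}
    (h : LadderBuild k n Set.univ E F) : N ≤ k * n := by
  obtain ⟨⟨L, hL, hmem⟩, -⟩ := h.exists_lists
  have := Finset.card_le_card (s := Finset.univ) (t := L.toFinset) fun v _ => by
    simpa using hmem v trivial
  rw [Finset.card_fin] at this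
  exact this.trans (L.toFinset_card_le.trans hL)

theorem LadderBuild.card_edges_le {A : Set (Fin N)} {F : Set (Sym2 (Fin N))}
    (h : LadderBuild k n A G.edgeSet F) (edge : Fin m ≃ G.edgeSet) : m ≤ k * n := by
  obtain ⟨-, L, hL, hmem⟩ := h.exists_lists
  have := Finset.card_le_card_of_injOn (s := Finset.univ) (t := L.toFinset)
    (fun e : Fin m => (edge e : Sym2 (Fin N))) (fun e _ => by simpa using hmem _ (edge e).2)
    (Subtype.val_injective.comp edge.injective).injOn
  rw [Finset.card_fin] at this
  exact this.trans (L.toFinset_card_le.trans hL)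

/-- The start that the search finds is good. -/
theorem Searched.completes {F : Set (Sym2 (Fin N))} (hk : 3 ≤ k) (hn : 1 ≤ n)
    (hL : LadderBuild k n Set.univ G.edgeSet F) {τ : Store}
    (h : Searched G k σ (fun _ _ => True) τ) :
    ∃ u v : Fin N, τ.nat 13 0 0 = u ∧ τ.nat 14 0 0 = v ∧ u ≠ v ∧ Completes (u, v, G.edgeSet) := by
  obtain ⟨-, u, v, h13, h14, huv, hfound⟩ := h
  refine ⟨u, v, h13, h14, G.ne_of_adj huv, ?_⟩
  rcases Nat.lt_or_ge n 2 with hn2 | hn2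
  · obtain rfl : n = 1 := by omega
    exact hL.completes_cycle hk huv
  · rcases hfound with ⟨h2, l, hrun, hl⟩ | hno
    · exact hL.completes_run hk hn2 hrun hl h2
    · obtain ⟨r, x, l, hrun, hl, h2⟩ := hL.exists_run hk hn2
      exact absurd ⟨h2, l, hrun, hl⟩ (hno r x trivial)

/-- At the start `A` consists of two isolated vertices, which become a tree when identified; so the
empty set has `conn` false and is the only set in the table. -/
theorem rep_start_iff {At : Fin N → Fin 3 → G.edgeSet → Prop} {u v : Fin N} (huv : u ≠ v)
    {s : St} {T : Finset G.edgeSet} : Rep At S {u, v} ∅ u v s T ↔ s = St.start ∧ T = ∅ := by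
  constructor
  · intro h
    obtain rfl : T = ∅ := Finset.subset_empty.1 h.sub
    have hcard := h.spans.2
    rw [Finset.card_pair huv] at hcard
    have hc : s.conn = false := by
      cases hc : s.conn with
      | false => rfl
      | true => simp [hc] at hcard
    refine ⟨St.ext hc ?_ ?_ ?_ (funext fun j => ?_) (funext fun j => ?_), rfl⟩
    · simpa [St.start] using h.bu
    · simpa [St.start] using h.bv
    · simpa [St.start] using h.buv
    · simpa [St.start] using h.x j
    · simpa [St.start] using h.y j
  · rintro ⟨rfl, rfl⟩
    refine ⟨subset_rfl, ⟨fun P _ hP x hx y hy => ?_, ?_⟩, by simp [St.start], by simp [St.start],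
      by simp [St.start], by simp [St.start], by simp [St.start], by simp⟩
    · have := hP rfl
      simp only [Finset.mem_insert, Finset.mem_singleton] at hx hy
      rcases hx with rfl | rfl <;> rcases hy with rfl | rfl <;> tauto
    · rw [Finset.card_pair huv]; rfl

theorem exec_initProg {obj : Finset G.edgeSet → ℝ} {σ₁ τ : Store}
    {At : Fin N → Fin 3 → G.edgeSet → Prop} (hobj : obj ∅ = 0) {u v : Fin N} (huv : u ≠ v)
    (h13 : τ.nat 13 0 0 = u) (h14 : τ.nat 14 0 0 = v) (h15 : τ.nat 15 0 0 = 0)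
    (hf : ∀ a, a ≤ 12 → τ.nat a = σ₁.nat a) (hr : τ.real = σ₁.real)
    (h8 : ∀ i j, σ₁.nat 8 i j = 0) (h9 : ∀ i j, σ₁.nat 9 i j = 0)
    (h2 : ∀ i j, σ₁.real 2 i j = 0) :
    Frontier (G := G) {u, v} ∅ u v ∧ SweepState edge σ₁ ∅ u v (initProg.exec τ) ∧
      TableCorrect edge obj (∅ : Finset G.edgeSet).card (Rep At S {u, v} ∅ u v)
        (initProg.exec τ) := by
  refine ⟨⟨huv, by simp, by simp, by simp, ?_⟩, ⟨fun a ha => ?_, fun a _ => by simp [initProg, hr],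
    by simp [initProg, h13], by simp [initProg, h14], by simp [initProg, h15], by simp,
    fun e _ => by simp [initProg, hf 8, h8], fun i c hi => ?_⟩, ?_, ?_⟩
  · intro x hx h1 h2
    simp [h1, h2] at hx
  · funext i j
    have h1 : a ≠ 9 := by omega
    simp [initProg, h1, hf a (by omega)]
  · have : i ≠ 0 := by rintro rfl; simp at hi
    simp [initProg, this, hf 9, h9]
  · intro c hc
    have hcs : c = St.start.code := by
      by_contra hne
      simp [initProg, hne, hf 9, h9] at hc
    refine ⟨St.start, ∅, hcs, (rep_start_iff huv).2 ⟨rfl, rfl⟩, by simp [initProg, hr, h2, hobj], ?_⟩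
    simp [trace]
  · intro s T h
    obtain ⟨rfl, rfl⟩ := (rep_start_iff huv).1 h
    simp [initProg, hr, h2, hobj]

/-- A constant for the running time of the algorithm. -/
noncomputable def Mode.timeConst (M : Mode) : ℕ :=
  100 + 6 * (walkTime 0 + (walkStep.cost + 19)) + initProg.cost +
    ((Program.firstMatch Op.test M.opProg allOps).cost + 9) +
    (layerProg finalTransitions).cost + announce.cost + (backStep.cost + 7)

theorem total_time_le {K N m w W I Q R U X : ℕ} (hK : 1 ≤ K) (hN : N ≤ K) (hm : m ≤ K)
    (hw : w ≤ W * K) :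
    17 + (N * 29 + w + 8 + 1) + (I + ((m * (Q + 8 + 1) + 8 + 1) +
      (R + (8 + (U + (m * (X + 6 + 1) + 6 + 1)) + 1)))) ≤
    (100 + W + I + (Q + 9) + R + U + (X + 7)) * K := by
  have hc : ∀ c, c ≤ c * K := fun c => Nat.le_mul_of_pos_right _ hK
  have h1 := hc I
  have h2 := hc R
  have h3 := hc U
  have h4 := Nat.mul_le_mul_right (Q + 8 + 1) hm
  have h5 := Nat.mul_le_mul_right (X + 6 + 1) hm
  rw [mul_comm K] at h4 h5
  simp only [add_mul _ _ K] at h4 h5 ⊢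
  omega

/-- The bound for a walk is affine in `k`, and the constant term is absorbed because `k` is
positive. -/
theorem walkTime_le (h : 1 ≤ k) : walkTime k ≤ (walkTime 0 + (walkStep.cost + 19)) * k := by
  have h1 : walkTime k = walkTime 0 + (walkStep.cost + 19) * k := by
    unfold walkTime; ring
  rw [h1, add_mul (walkTime 0)]
  exact Nat.add_le_add_right (Nat.le_mul_of_pos_right _ h) _

/-- All three problems are solved by the same program, up to the mode and the preparation `P` of the
conflict table. The search costs at most three walks of time linear in `k` at each of at most `2 n`
vertices, and all other parts after `P` are linear in the numbers of vertices and edges. -/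
theorem Mode.ensures_solveProg {M : Mode} {obj : Finset G.edgeSet → ℝ} (hG : IsLadder k n G)
    (hσ : EncodesGraph k n G edge σ) (hM : M.Correct edge obj (σ.real 0))
    (hS : AdjacentConflicts G S) {P : Program} {B : ℕ}
    (hP : P.Ensures σ B fun τ => (∀ a, a ≠ 7 → a ≠ 19 → τ.nat a = σ.nat a) ∧ τ.real = σ.real ∧
      ∀ e f : G.edgeSet, τ.nat 7 (edge.symm e) (edge.symm f) = 0 ↔ s(e, f) ∉ S) :
    (M.solveProg P).Ensures σ (B + M.timeConst * (k * n))
      (HoldsSolution edge (IsConflictFreeTree G S) obj) := by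
  classical
  obtain ⟨hk3, hn1, F, hL⟩ := hG
  have hcover : ∀ x : Fin N, ∃ e : G.edgeSet, x ∈ (e : Sym2 (Fin N)) := fun x => by
    obtain ⟨w, hw⟩ := hL.exists_edge (Set.mem_univ x)
    exact ⟨⟨_, hw⟩, by simp⟩
  have hm : 0 < m := by
    obtain ⟨x, -⟩ := hL.nonempty
    obtain ⟨e, -⟩ := hcover x
    exact (Nat.zero_le _).trans_lt (edge.symm e).2
  obtain ⟨L, hLlen, hL2⟩ := hL.exists_exceptions hk3
  refine (Program.Ensures.comp hP ?_ (B' := (17 + (N * 29 + 3 * walkTime k * L.length + 8 + 1)) +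
    (initProg.cost + ((m * ((Program.firstMatch Op.test M.opProg allOps).cost + 8 + 1) + 8 + 1) +
    ((layerProg finalTransitions).cost + (8 +
        (announce.cost + (m * (backStep.cost + 6 + 1) + 6 + 1)) + 1)))))).mono ?_ fun _ => id
  · rintro σ₁ ⟨hf1, hr1, hS1⟩
    have hp : Prepared edge S σ₁ :=
      hσ.prepared (hL.nbrs hk3) (fun a ha => hf1 a (by omega) (by omega)) hS1
    have hzero : ∀ a i j, 5 ≤ a → a ≠ 7 → a ≠ 19 → σ₁.nat a i j = 0 := fun a i j h5 h7 h19 => by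
      rw [hf1 a h7 h19, hσ.natZero a i j h5]
    refine Program.Ensures.comp (ensures_searchProg hp
      (by rw [hf1 0 (by omega) (by omega), hσ.numVertices])
      (by rw [hf1 0 (by omega) (by omega), hσ.cycleLength]) hk3 hm hL2).frame ?_
    rintro τ ⟨hτ, hfr, hreal⟩
    obtain ⟨u, v, h13, h14, huv, hcomp⟩ := hτ.completes hk3 hn1 hL
    have h15 : τ.nat 15 0 0 = 0 := by
      rw [hfr 15 (by simp [searchProg, searchStart, tryVertex, walkProg, walkStart, walkLoop,
        walkAccept, walkStep, crossProg, Program.seq]), hzero _ _ _ (by omega) (by omega) (by omega)]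
    have hr : τ.real = σ₁.real := hreal (by simp [searchProg, searchStart, tryVertex, walkProg,
      walkStart, walkLoop, walkAccept, walkStep, crossProg, Program.seq])
    have hM' : M.Correct edge obj (σ₁.real 0) := by rw [hr1]; exact hM
    obtain ⟨hF, hst, hT⟩ := exec_initProg (edge := edge) (S := S) (At := atOf edge σ₁)
      hM.empty huv h13 h14 h15 hτ.frame hr (fun i j => hzero 8 i j (by omega) (by omega) (by omega))
      (fun i j => hzero 9 i j (by omega) (by omega) (by omega))
      (fun i j => by rw [hr1]; exact hσ.realZero 2 i j (by omega))
    have hlf : initProg.LoopFree := by simp [initProg]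
    refine Program.Ensures.comp (hlf.ensures (Q := fun υ => υ = initProg.exec τ) rfl) ?_
    rintro _ rfl
    refine Program.Ensures.comp (hst.ensures hM' hp hS hF hT (by rwa [remaining_empty])) ?_
    rintro υ ⟨A, D, u, v, hD, hDm, hF, hst, hT⟩
    exact hst.ensures_output hF hT hD hDm hcover
      (hzero _ _ _ (by omega) (by omega) (by omega))
      fun x => hzero _ _ _ (by omega) (by omega) (by omega)
  · have hkn : 1 ≤ k * n := Nat.mul_pos (by omega) (by omega)
    have h1 := hL.card_vertices_le
    have h2 := hL.card_edges_le edge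
    have h3 : 3 * walkTime k * L.length ≤
        6 * (walkTime 0 + (walkStep.cost + 19)) * (k * n) := by
      calc 3 * walkTime k * L.length
          ≤ 3 * ((walkTime 0 + (walkStep.cost + 19)) * k) * (2 * n) := by
            gcongr
            exact walkTime_le (by omega)
        _ = _ := by ring
    exact Nat.add_le_add_left (total_time_le hkn h1 h2 h3) B

/-- The program that makes the table of conflicts is fast and correct. -/
theorem EncodesConflicts.ensures_markProg (hG : IsLadder k n G) (hσ : EncodesGraph k n G edge σ)
    (hS : AdjacentConflicts G S) (h : EncodesConflicts edge S σ) :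
    markProg.Ensures σ ((9 * (markStep.cost + 9) + 9) * (k * n)) fun τ =>
      (∀ a, a ≠ 7 → a ≠ 19 → τ.nat a = σ.nat a) ∧ τ.real = σ.real ∧
      ∀ e f : G.edgeSet, τ.nat 7 (edge.symm e) (edge.symm f) = 0 ↔ s(e, f) ∉ S := by
  obtain ⟨hk3, hn1, F, hL⟩ := hG
  refine (LadderTrees.ensures_markProg (fun x y => hσ.natZero 7 x y (by omega))
    (hσ.natZero 19 0 0 (by omega))).frame.mono ?_ ?_
  · have hkn : 1 ≤ k * n := Nat.mul_pos (by omega) (by omega)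
    have h1 := hL.card_vertices_le
    have h2 := h.length_le hσ (hL.nbrs hk3) hS
    calc σ.nat 0 0 4 * (markStep.cost + 8 + 1) + 8 + 1
        ≤ 9 * (k * n) * (markStep.cost + 8 + 1) + 9 * (k * n) := by
          have : σ.nat 0 0 4 ≤ 9 * (k * n) := by omega
          have := Nat.mul_le_mul_right (markStep.cost + 8 + 1) this
          omega
      _ = _ := by ring
  · rintro τ ⟨hτ, hf, hr⟩
    refine ⟨fun a h7 h19 => hf a ?_, hr ?_, fun e f => ?_⟩
    · simp [markProg, markStep, Program.seq, h7, h19]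
    · simp [markProg, markStep, Program.seq]
    · rw [hτ, h.mem_iff]

end Solve

end LadderTrees

/-! ### The three problems as instances of the common algorithm. -/

theorem mainTheorem9 :
    -- minimum spanning trees with adjacent conflict pairs
    (∃ (P : Program) (C : ℕ), ∀ (k n N m : ℕ) (G : SimpleGraph (Fin N)),
      IsLadder k n G → ∀ (edge : Fin m ≃ G.edgeSet) (c : G.edgeSet → ℝ)
        (S : Finset (Sym2 G.edgeSet)), AdjacentConflicts G S →
      ∀ σ : Store, EncodesGraph k n G edge σ → EncodesCosts edge c σ →
        EncodesConflicts edge S σ →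
      ∃ (t : ℕ) (τ : Store), P.Run σ t τ ∧ t ≤ C * (k * n) ∧
        HoldsSolution edge (IsConflictFreeTree G S) (sumCost c) τ) ∧
    -- adjacent-only quadratic bottleneck spanning trees
    (∃ (P : Program) (C : ℕ), ∀ (k n N m : ℕ) (G : SimpleGraph (Fin N)),
      IsLadder k n G → ∀ (edge : Fin m ≃ G.edgeSet) (q : G.edgeSet → G.edgeSet → ℝ),
        (∀ e f : G.edgeSet, e ≠ f → ¬ EdgeAdj G e f → q e f = 0) →
      ∀ σ : Store, EncodesGraph k n G edge σ → EncodesMatrix edge q σ →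
      ∃ (t : ℕ) (τ : Store), P.Run σ t τ ∧ t ≤ C * (k * n) ∧
        HoldsSolution edge (IsSpanningTree G) (maxPairCost q) τ) ∧
    -- bottleneck spanning trees with adjacent conflict pairs
    (∃ (P : Program) (C : ℕ), ∀ (k n N m : ℕ) (G : SimpleGraph (Fin N)),
      IsLadder k n G → ∀ (edge : Fin m ≃ G.edgeSet) (c : G.edgeSet → ℝ)
        (S : Finset (Sym2 G.edgeSet)), AdjacentConflicts G S →
      ∀ σ : Store, EncodesGraph k n G edge σ → EncodesCosts edge c σ →
        EncodesConflicts edge S σ →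
      ∃ (t : ℕ) (τ : Store), P.Run σ t τ ∧ t ≤ C * (k * n) ∧
        HoldsSolution edge (IsConflictFreeTree G S) (maxCost c) τ) := by
  refine ⟨⟨Mode.sum.solveProg markProg, 9 * (markStep.cost + 9) + 9 + Mode.sum.timeConst, ?_⟩,
    ⟨Mode.quadratic.solveProg .skip, 1 + Mode.quadratic.timeConst, ?_⟩,
    ⟨Mode.bottleneck.solveProg markProg,
      9 * (markStep.cost + 9) + 9 + Mode.bottleneck.timeConst, ?_⟩⟩
  · intro k n N m G hG edge c S hS σ hσ hc hconf
    rw [add_mul]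
    exact Mode.ensures_solveProg hG hσ (Mode.correct_sum hc) hS
      (hconf.ensures_markProg hG hσ hS)
  · intro k n N m G hG edge q hq σ hσ hmat
    -- The quadratic problem is the case of no conflicts; the blank table is already correct, so no
    -- preparation is needed.
    have hfeas : IsSpanningTree G = IsConflictFreeTree G ∅ := by
      funext T
      simp [IsConflictFreeTree]
    rw [add_mul, hfeas]
    refine Mode.ensures_solveProg hG hσ (Mode.correct_quadratic hq hmat)
      (by simp [AdjacentConflicts])
      ⟨1, σ, .skip σ, ?_, fun _ _ _ => rfl, rfl, fun e f => ?_⟩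
    · rw [one_mul]
      exact Nat.mul_pos (by have := hG.1; omega) hG.2.1
    · simp [hσ.natZero 7]
  · intro k n N m G hG edge c S hS σ hσ hc hconf
    rw [add_mul]
    exact Mode.ensures_solveProg hG hσ (Mode.correct_bottleneck hc) hS
      (hconf.ensures_markProg hG hσ hS)
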